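/- Let $r\ge 3$ be an integer, $0<\varepsilon<1/(4r)$ and $\delta>0$. Then there are $\eta>0$, a deterministic polynomial-time algorithm $\mathcal A$, and a function $\mathrm{err}:\mathbb N\to\mathbb R$ with $\mathrm{err}(n)\to 0$ as $n\to\infty$ such that the following holds. The inputs of $\mathcal A$ consist of an $r$-uniform hypergraph $G$ on $n$ vertices, a set $X$ of vertices, and $2k$ pairwise disjoint $(r-1)$-tuples $\mathbf u^{(1)},\dots,\mathbf u^{(k)},\mathbf v^{(1)},\dots,\mathbf v^{(k)}$ of distinct vertices; on every such input $\mathcal A$ halts within a number of steps polynomial in $n$. For all $n$ and $k$ with $1\le k\le\eta n$, every vertex set $X\subseteq[n]$ with $|X|\ge\delta n$, and all $2k$ pairwise disjoint $(r-1)$-tuples $\mathbf u^{(1)},\dots,\mathbf u^{(k)},\mathbf v^{(1)},\dots,\mathbf v^{(k)}$ in $[n]$, if $G=\mathcal G^{(r)}(n,p)$ is the random $r$-uniform hypergraph on $[n]$ in which each $r$-set is an edge independently with probability $p=n^{-1+\varepsilon}$, then with probability at least $1-\mathrm{err}(n)$ the algorithm $\mathcal A$, given $G$, $X$ and these tuples,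 outputs pairwise vertex-disjoint tight paths $P_1,\dots,P_k$ in $G$ such that, for each $i$, $P_i$ starts with the tuple $\mathbf u^{(i)}$, ends with the tuple $\mathbf v^{(i)}$, has length (number of edges) at most $(r-1)/\varepsilon+2$, and has all its interior vertices in $X$. Here a tight path is a sequence of distinct vertices any $r$ consecutive of which form an edge, and its interior vertices are those which belong neither to its first $r-1$ nor to its last $r-1$ vertices. -/

import Mathlib

open Finset Filter Topology

/-! A deterministic random access machine, programmed by structured (while) programs.
Its only arithmetic is addition and truncated subtraction, so that in `t` unit-cost steps numbers
grow by at most `O(t)` bits: up to polynomial factors, time is the same as on Turing machines. -/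

namespace RAM

/-- Programs. `x`, `y`, `z` are names of registers; the registers and the cells of the
work memory hold natural numbers. -/
inductive Cmd : Type
  /-- do nothing -/
  | skip : Cmd
  /-- `R[x] := c` -/
  | const (x c : ℕ) : Cmd
  /-- `R[x] := R[y] + R[z]` -/
  | add (x y z : ℕ) : Cmd
  /-- `R[x] := R[y] - R[z]` (truncated at zero) -/
  | sub (x y z : ℕ) : Cmd
  /-- `R[x] := input[R[y]]` (zero beyond the end of the input) -/
  | read (x y : ℕ) : Cmd
  /-- `R[x] := M[R[y]]` -/
  | load (x y : ℕ) : Cmd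
  /-- `M[R[x]] := R[y]` -/
  | store (x y : ℕ) : Cmd
  /-- append `R[x]` to the output -/
  | write (x : ℕ) : Cmd
  /-- first `c`, then `d` -/
  | seq (c d : Cmd) : Cmd
  /-- if `R[x] ≠ 0` then `c` else `d` -/
  | ite (x : ℕ) (c d : Cmd) : Cmd
  /-- while `R[x] ≠ 0` do `c` -/
  | loop (x : ℕ) (c : Cmd) : Cmd

/-- Configurations: registers, work memory, and what has been written so far. -/
structure State : Type where
  reg : ℕ → ℕ
  mem : ℕ → ℕ
  out : List ℕ

/-- The initial configuration: all registers and cells are zero, the output is empty. -/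
def State.init : State := ⟨fun _ => 0, fun _ => 0, []⟩

/-- Assign the value `a` to the register `x`. -/
def State.set (s : State) (x a : ℕ) : State := { s with reg := Function.update s.reg x a }

/-- `Exec inp c s t s'`: on the read-only input `inp`, the program `c` started in the
configuration `s` halts after exactly `t` steps, in the configuration `s'`.
Each elementary command and each test of a register counts as one step. -/
inductive Exec (inp : List ℕ) : Cmd → State → ℕ → State → Prop
  | skip (s : State) : Exec inp .skip s 1 s
  | const (s : State) (x c : ℕ) : Exec inp (.const x c) s 1 (s.set x c)
  | add (s : State) (x y z : ℕ) : Exec inp (.add x y z) s 1 (s.set x (s.reg y + s.reg z))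
  | sub (s : State) (x y z : ℕ) : Exec inp (.sub x y z) s 1 (s.set x (s.reg y - s.reg z))
  | read (s : State) (x y : ℕ) : Exec inp (.read x y) s 1 (s.set x (inp.getD (s.reg y) 0))
  | load (s : State) (x y : ℕ) : Exec inp (.load x y) s 1 (s.set x (s.mem (s.reg y)))
  | store (s : State) (x y : ℕ) :
      Exec inp (.store x y) s 1 { s with mem := Function.update s.mem (s.reg x) (s.reg y) }
  | write (s : State) (x : ℕ) : Exec inp (.write x) s 1 { s with out := s.out ++ [s.reg x] }
  | seq {c d : Cmd} {s s' s'' : State} {t t' : ℕ} :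
      Exec inp c s t s' → Exec inp d s' t' s'' → Exec inp (.seq c d) s (t + t') s''
  | ite_true {x : ℕ} {c d : Cmd} {s s' : State} {t : ℕ} :
      s.reg x ≠ 0 → Exec inp c s t s' → Exec inp (.ite x c d) s (t + 1) s'
  | ite_false {x : ℕ} {c d : Cmd} {s s' : State} {t : ℕ} :
      s.reg x = 0 → Exec inp d s t s' → Exec inp (.ite x c d) s (t + 1) s'
  | loop_done {x : ℕ} {c : Cmd} {s : State} :
      s.reg x = 0 → Exec inp (.loop x c) s 1 s
  | loop_step {x : ℕ} {c : Cmd} {s s' s'' : State} {t t' : ℕ} :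
      s.reg x ≠ 0 → Exec inp c s t s' → Exec inp (.loop x c) s' t' s'' →
        Exec inp (.loop x c) s (t + t' + 1) s''

/-- `f` is computed by a (single, deterministic) program which halts on the encoding of every
input `a`, with output `f a`, after a number of steps that is at most a fixed polynomial in the
length of the encoding. -/
def PolyTimeComputable {α : Type} (encode : α → List ℕ) (f : α → List ℕ) : Prop :=
  ∃ (c : Cmd) (q : Polynomial ℕ), ∀ a : α, ∃ (t : ℕ) (s : State),
    Exec (encode a) c State.init t s ∧ t ≤ q.eval (encode a).length ∧ s.out = f a

end RAM

/-- `r`-uniform hypergraphs on the vertex set `{0, …, n - 1}`, given by their edge sets. -/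
abbrev UHypergraph (r n : ℕ) : Type :=
  {E : Finset (Finset (Fin n)) // ∀ e ∈ E, #e = r}

open Classical in
/-- The probability that the random `r`-uniform hypergraph on `n` vertices has property `Q`,
when each `r`-set is an edge independently with probability `p`. -/
noncomputable def randomHypergraphProb (r n : ℕ) (p : ℝ) (Q : UHypergraph r n → Prop) : ℝ :=
  ∑ G : UHypergraph r n with Q G,
    ∏ e ∈ powersetCard r (univ : Finset (Fin n)), if e ∈ G.1 then p else 1 - p

/-- The sequence `P` of distinct vertices is a tight path in `G`: any `r` consecutive vertices
form an edge. -/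
def IsTightPath {r n : ℕ} (G : UHypergraph r n) (P : List (Fin n)) : Prop :=
  P.Nodup ∧ ∀ i : ℕ, i + r ≤ P.length → ((P.drop i).take r).toFinset ∈ G.1

/-- The length of a tight path in an `r`-uniform hypergraph, that is, its number of edges. -/
def tightPathLength {n : ℕ} (r : ℕ) (P : List (Fin n)) : ℕ := P.length + 1 - r

/-- The inputs of a connection algorithm: an `r`-uniform hypergraph `G` on `n` vertices, a set `X`
of vertices, and `2 k` pairwise disjoint tuples `u i`, `v i` of `r - 1` distinct vertices. -/
structure ConnInput (r : ℕ) : Type where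
  n : ℕ
  G : UHypergraph r n
  X : Finset (Fin n)
  k : ℕ
  u : Fin k → Fin (r - 1) → Fin n
  v : Fin k → Fin (r - 1) → Fin n
  /-- all `2 k (r - 1)` entries of the tuples are different -/
  distinct : Function.Injective
    (Sum.elim (fun x : Fin k × Fin (r - 1) => u x.1 x.2) (fun x : Fin k × Fin (r - 1) => v x.1 x.2))

namespace ConnInput

/-- The input as a list of numbers: `n`, `k`, the indicator function of `X`, the entries of the
tuples `u 0, …, u (k - 1)` and then of `v 0, …, v (k - 1)`, and the adjacency array of `G`. The
latter has `n ^ r` entries, one for each `r`-tuple of vertices (its vertices are the `r` digits in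
base `n` of the position, least significant digit first); an entry is `1` if the vertices of the
tuple form an edge, and `0` otherwise. -/
def encode {r : ℕ} (I : ConnInput r) : List ℕ :=
  [I.n, I.k]
    ++ List.ofFn (fun x : Fin I.n => if x ∈ I.X then 1 else 0)
    ++ (List.ofFn fun i => List.ofFn fun j => (I.u i j : ℕ)).flatten
    ++ (List.ofFn fun i => List.ofFn fun j => (I.v i j : ℕ)).flatten
    ++ List.ofFn (fun a : Fin (I.n ^ r) =>
        if univ.image (finFunctionFinEquiv.symm a : Fin r → Fin I.n) ∈ I.G.1 then 1 else 0)

/-- `P` is a family of vertex-disjoint tight paths of length at most `ℓ`, the `i`-th of which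
starts with the tuple `u i`, ends with the tuple `v i`, and has all its interior vertices (those
neither in the start tuple nor in the end tuple) in `X`. -/
def IsConnection {r : ℕ} (I : ConnInput r) (ℓ : ℝ) (P : Fin I.k → List (Fin I.n)) : Prop :=
  (∀ i, IsTightPath I.G (P i) ∧ List.ofFn (I.u i) <+: P i ∧ List.ofFn (I.v i) <:+ P i ∧
    (tightPathLength r (P i) : ℝ) ≤ ℓ ∧
    ∀ x ∈ P i, x ∉ Set.range (I.u i) → x ∉ Set.range (I.v i) → x ∈ I.X) ∧
  ∀ i j, i ≠ j → List.Disjoint (P i) (P j)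

end ConnInput

/-- A list of vertex sequences as a list of numbers: each sequence is preceded by its number of
vertices. -/
def encodePaths {n : ℕ} (L : List (List (Fin n))) : List ℕ :=
  L.flatMap fun P => P.length :: P.map Fin.val

/-! Write r = ρ + 1 and let L = m + ρ be the least integer exceeding ρ/ε. A tight path with
prescribed end tuples and m interior vertices has L edges. With Θ(n) candidates for each interior
vertex, the expected number of such paths in the random hypergraph is of order n^m p^(m+ρ) = n^c,
where c = ε(m + ρ) - ρ lies in (0, ε].

The part of `X` outside the tuples is split deterministically into T tiers of m layers each, and the
j-th interior vertex of a path must come from the j-th layer of one tier. The algorithm serves the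
pairs in order: it tries the tiers one after the other and takes any path whose interior vertices
are still unused. Brute force over n^m sequences suffices, since m and T depend only on r and ε.

The choices are adaptive, so the randomness is isolated in one property of the edge set, `IsRobust`.
For every tier, every nonempty set S of indices and every set Z of at most m b |S| vertices (and at
most mk), some index of S has a path through the tier that avoids Z, where b = n^(c/2). For fixed
tier, Z and S, Janson's inequality (`janson_inequality`, `bernoulliProb_no_windows_le`) bounds the
failure probability by exp(-Ω(|S| n^c)). As |Z| is at most m n^(c/2) |S|, this survives a union
bound over all triples (`bernoulliProb_not_isRobust_le`).

Given robustness, the rest is deterministic (`IsGreedy.exists_eq_some`). Let R_t be the set of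
indices not served in the tiers before t. The vertices of tier t that get used number at most m
|R_t|. If this were at most m b |R_(t+1)|, some index of R_(t+1) could have been served in tier t.
So |R_t| drops by a factor b per tier, and T ≥ 2/c tiers leave fewer than one index.

The machine part shows that an explicit program makes exactly these greedy choices in polynomial
time (`RAM.exists_polyTimeComputable_isGreedy`). -/

/-! ### Product measures and Janson's inequality. -/

section Bernoulli

variable {α : Type*} [Fintype α] [DecidableEq α]

/-- The probability of the set `E` when each `e` is chosen independently with probability `p e`. -/
noncomputable def bernoulliWeight (p : α → ℝ) (E : Finset α) : ℝ :=
  ∏ e, if e ∈ E then p e else 1 - p e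

open Classical in
/-- The probability of the event `Q` under independent choices with probabilities `p e`. -/
noncomputable def bernoulliProb (p : α → ℝ) (Q : Finset α → Prop) : ℝ :=
  ∑ E with Q E, bernoulliWeight p E

variable {p : α → ℝ}

lemma bernoulliWeight_nonneg (h0 : ∀ e, 0 ≤ p e) (h1 : ∀ e, p e ≤ 1) (E : Finset α) :
    0 ≤ bernoulliWeight p E := by
  classical
  refine prod_nonneg fun e _ => ?_
  split_ifs
  · exact h0 e
  · linarith [h1 e]

lemma bernoulliProb_nonneg (h0 : ∀ e, 0 ≤ p e) (h1 : ∀ e, p e ≤ 1) (Q : Finset α → Prop) :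
    0 ≤ bernoulliProb p Q :=
  sum_nonneg fun E _ => bernoulliWeight_nonneg h0 h1 E

lemma bernoulliProb_mono (h0 : ∀ e, 0 ≤ p e) (h1 : ∀ e, p e ≤ 1) {Q R : Finset α → Prop}
    (h : ∀ E, Q E → R E) : bernoulliProb p Q ≤ bernoulliProb p R := by
  classical
  refine sum_le_sum_of_subset_of_nonneg (fun E hE => ?_)
    fun E _ _ => bernoulliWeight_nonneg h0 h1 E
  simp only [mem_filter, mem_univ, true_and] at hE ⊢
  exact h E hE

lemma bernoulliProb_true : bernoulliProb p (fun _ => True) = 1 := by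
  classical
  have h := Finset.prod_add p (fun e => 1 - p e) (univ : Finset α)
  simp only [bernoulliProb, filter_true, bernoulliWeight]
  rw [← powerset_univ]
  rw [show (∏ i, (p i + (1 - p i))) = 1 from prod_eq_one fun e _ => by ring] at h
  refine Eq.trans (sum_congr rfl fun E _ => ?_) h.symm
  rw [Finset.prod_ite]
  congr 1
  · exact prod_congr (by ext; simp) fun _ _ => rfl
  · exact prod_congr (by ext; simp) fun _ _ => rfl

lemma bernoulliProb_and_add (Q R : Finset α → Prop) :
    bernoulliProb p (fun E => Q E ∧ R E) + bernoulliProb p (fun E => Q E ∧ ¬ R E)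
      = bernoulliProb p Q := by
  classical
  simp only [bernoulliProb, ← filter_filter]
  exact sum_filter_add_sum_filter_not _ _ _

lemma bernoulliProb_not (Q : Finset α → Prop) :
    bernoulliProb p (fun E => ¬ Q E) = 1 - bernoulliProb p Q := by
  have h := bernoulliProb_and_add (p := p) (fun _ => True) Q
  simp only [true_and, bernoulliProb_true] at h
  linarith

lemma bernoulliProb_exists_le (h0 : ∀ e, 0 ≤ p e) (h1 : ∀ e, p e ≤ 1) {ι : Type*} (s : Finset ι)
    (Q : ι → Finset α → Prop) :
    bernoulliProb p (fun E => ∃ i ∈ s, Q i E) ≤ ∑ i ∈ s, bernoulliProb p (Q i) := by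
  classical
  induction s using Finset.induction_on with
  | empty => simp [bernoulliProb]
  | insert a s ha ih =>
    rw [sum_insert ha]
    have h := bernoulliProb_and_add (p := p) (fun E => ∃ i ∈ insert a s, Q i E) (Q a)
    have h2 : bernoulliProb p (fun E => (∃ i ∈ insert a s, Q i E) ∧ Q a E)
        ≤ bernoulliProb p (Q a) := bernoulliProb_mono h0 h1 fun E hE => hE.2
    have h3 : bernoulliProb p (fun E => (∃ i ∈ insert a s, Q i E) ∧ ¬ Q a E)
        ≤ bernoulliProb p (fun E => ∃ i ∈ s, Q i E) := by
      refine bernoulliProb_mono h0 h1 fun E hE => ?_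
      obtain ⟨⟨i, hi, hQ⟩, hn⟩ := hE
      rcases mem_insert.1 hi with rfl | hi
      · exact absurd hQ hn
      · exact ⟨i, hi, hQ⟩
    linarith

open Classical in
/-- Splitting a probability according to one coordinate. -/
lemma bernoulliProb_split (e : α) (Q : Finset α → Prop) :
    bernoulliProb p Q = ∑ E with e ∉ E, (∏ a ∈ univ.erase e, if a ∈ E then p a else 1 - p a) *
      (p e * (if Q (insert e E) then 1 else 0) + (1 - p e) * (if Q E then 1 else 0)) := by
  have hw : ∀ E : Finset α, bernoulliWeight p E = (if e ∈ E then p e else 1 - p e) *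
      ∏ a ∈ univ.erase e, if a ∈ E then p a else 1 - p a := fun E =>
    (mul_prod_erase univ _ (mem_univ e)).symm
  rw [bernoulliProb, sum_filter, ← sum_filter_add_sum_filter_not univ (fun E => e ∈ E)]
  have h1 : ∑ E with e ∈ E, (if Q E then bernoulliWeight p E else 0)
      = ∑ E with e ∉ E, (if Q (insert e E) then bernoulliWeight p (insert e E) else 0) := by
    refine (sum_bij' (fun E _ => insert e E) (fun E _ => E.erase e) ?_ ?_ ?_ ?_ ?_).symm
    · intro E hE; simp
    · intro E hE; simp
    · intro E hE
      simp only [mem_filter, mem_univ, true_and] at hE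
      exact erase_insert hE
    · intro E hE
      simp only [mem_filter, mem_univ, true_and] at hE
      exact insert_erase hE
    · intro E hE; rfl
  rw [h1, ← sum_add_distrib]
  refine sum_congr rfl fun E hE => ?_
  simp only [mem_filter, mem_univ, true_and] at hE
  have h2 : (∏ a ∈ univ.erase e, if a ∈ insert e E then p a else 1 - p a)
      = ∏ a ∈ univ.erase e, if a ∈ E then p a else 1 - p a := by
    refine prod_congr rfl fun a ha => ?_
    have : a ≠ e := (mem_erase.1 ha).1
    simp [this]
  rw [hw, hw, h2]
  simp only [mem_insert_self, if_true, if_neg hE]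
  split_ifs <;> ring

/-- The one-coordinate case of Harris' inequality. With the other coordinates fixed, presence of `e`
can only destroy `Q`, so the two events are negatively correlated. -/
lemma bernoulliProb_mem_and_le (h0 : ∀ e, 0 ≤ p e) (h1 : ∀ e, p e ≤ 1) (e : α)
    {Q : Finset α → Prop} (hQ : ∀ E, e ∉ E → Q (insert e E) → Q E) :
    bernoulliProb p (fun E => e ∈ E ∧ Q E) ≤ p e * bernoulliProb p Q := by
  classical
  rw [bernoulliProb_split e, bernoulliProb_split e Q, mul_sum]
  refine sum_le_sum fun E hE => ?_
  simp only [mem_filter, mem_univ, true_and] at hE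
  rw [mul_left_comm]
  have hP : 0 ≤ ∏ a ∈ univ.erase e, if a ∈ E then p a else 1 - p a := by
    refine prod_nonneg fun a _ => ?_
    split_ifs
    · exact h0 a
    · linarith [h1 a]
  refine mul_le_mul_of_nonneg_left ?_ hP
  have a0 := h0 e
  have a1 := h1 e
  by_cases hi : Q (insert e E)
  · have := hQ E hE hi
    simp [hE, hi, this]
  · by_cases h : Q E <;> simp [hE, hi, h]
    nlinarith

lemma bernoulliProb_mem_and_eq (e : α)
    {Q : Finset α → Prop} (hQ : ∀ E, e ∉ E → (Q (insert e E) ↔ Q E)) :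
    bernoulliProb p (fun E => e ∈ E ∧ Q E) = p e * bernoulliProb p Q := by
  classical
  rw [bernoulliProb_split e, bernoulliProb_split e Q, mul_sum]
  refine sum_congr rfl fun E hE => ?_
  simp only [mem_filter, mem_univ, true_and] at hE
  have := hQ E hE
  by_cases h : Q E <;> simp [hE, this, h, mul_comm]

/-- Harris' inequality for a cylinder event against a decreasing one, by adding the coordinates of
`A` one at a time. At each step the event being conditioned on is insensitive to the new coordinate
apart from its decreasing part. -/
lemma bernoulliProb_subset_and_le (h0 : ∀ e, 0 ≤ p e) (h1 : ∀ e, p e ≤ 1)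
    (A : Finset α) {Q : Finset α → Prop} (hQ : ∀ E F, E ⊆ F → Q F → Q E) :
    bernoulliProb p (fun E => A ⊆ E ∧ Q E) ≤ (∏ e ∈ A, p e) * bernoulliProb p Q := by
  induction A using Finset.induction_on with
  | empty => simp
  | insert a A ha ih =>
    have h := bernoulliProb_mem_and_le h0 h1 a (Q := fun E => A ⊆ E ∧ Q E) (fun E hE hh =>
      ⟨fun x hx => (mem_insert.1 (hh.1 hx)).resolve_left (by rintro rfl; exact ha hx),
        hQ _ _ (subset_insert _ _) hh.2⟩)
    simp only [insert_subset_iff, and_assoc, prod_insert ha, mul_assoc] at h ⊢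
    exact h.trans (mul_le_mul_of_nonneg_left ih (h0 a))

lemma bernoulliProb_subset_and_eq
    (A : Finset α) {Q : Finset α → Prop} (hQ : ∀ e ∈ A, ∀ E, Q (insert e E) ↔ Q E) :
    bernoulliProb p (fun E => A ⊆ E ∧ Q E) = (∏ e ∈ A, p e) * bernoulliProb p Q := by
  induction A using Finset.induction_on with
  | empty => simp
  | insert a A ha ih =>
    have h := bernoulliProb_mem_and_eq (p := p) a (Q := fun E => A ⊆ E ∧ Q E) (fun E hE => by
      rw [hQ a (mem_insert_self _ _), subset_insert_iff_of_notMem ha])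
    simp only [insert_subset_iff, and_assoc, prod_insert ha, mul_assoc] at h ⊢
    rw [h, ih fun e he => hQ e (mem_insert_of_mem he)]

/-- **Janson's inequality.** -/
theorem janson_inequality (h0 : ∀ e, 0 ≤ p e) (h1 : ∀ e, p e ≤ 1) {ι : Type*}
    [DecidableEq ι] (I : Finset ι) (A : ι → Finset α) :
    bernoulliProb p (fun E => ∀ i ∈ I, ¬ A i ⊆ E) ≤
      Real.exp (-(∑ i ∈ I, ∏ e ∈ A i, p e) +
        (∑ i ∈ I, ∑ j ∈ I with j ≠ i ∧ ¬ Disjoint (A i) (A j), ∏ e ∈ A i ∪ A j, p e) / 2) := by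
  induction I using Finset.induction_on with
  | empty => simp [bernoulliProb_true]
  | insert i J hi ih =>
    set D : Finset ι → Finset α → Prop := fun K E => ∀ j ∈ K, ¬ A j ⊆ E with hD
    -- Adding index `i` costs a factor exp(-P + s₁). The events of `J₀` share no coordinate with `A
    -- i` and are independent of it; those of `J₁` are handled by a union bound, each being
    -- negatively correlated with `D J₀`.
    set J₁ := J.filter fun j => ¬ Disjoint (A i) (A j) with hJ₁
    set J₀ := J.filter fun j => Disjoint (A i) (A j) with hJ₀
    set s₁ := ∑ j ∈ J₁, ∏ e ∈ A i ∪ A j, p e with hs₁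
    set P := ∏ e ∈ A i, p e with hP
    have hdec : ∀ K, ∀ E F, E ⊆ F → D K F → D K E := fun K E F hEF h j hj hA =>
      h j hj (hA.trans hEF)
    have hprod : ∀ B : Finset α, 0 ≤ ∏ e ∈ B, p e := fun B => prod_nonneg fun e _ => h0 e
    have hind : bernoulliProb p (fun E => A i ⊆ E ∧ D J₀ E) = P * bernoulliProb p (D J₀) := by
      refine bernoulliProb_subset_and_eq _ fun e he E => ?_
      refine forall₂_congr fun j hj => ?_
      have hdis : Disjoint (A i) (A j) := (mem_filter.1 hj).2
      rw [subset_insert_iff_of_notMem (disjoint_left.1 hdis he)]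
    have hcross : ∀ j ∈ J₁, bernoulliProb p (fun E => A i ∪ A j ⊆ E ∧ D J₀ E) ≤
        (∏ e ∈ A i ∪ A j, p e) * bernoulliProb p (D J₀) := fun j _ =>
      bernoulliProb_subset_and_le h0 h1 _ (hdec J₀)
    have hlow : (P - s₁) * bernoulliProb p (D J) ≤
        bernoulliProb p (fun E => A i ⊆ E ∧ D J E) := by
      have hsub : (P - s₁) * bernoulliProb p (D J₀) ≤
          bernoulliProb p (fun E => A i ⊆ E ∧ D J E) := by
        have hs := bernoulliProb_and_add (p := p) (fun E => A i ⊆ E ∧ D J₀ E)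
          (fun E => ∃ j ∈ J₁, A j ⊆ E)
        have hu := bernoulliProb_exists_le h0 h1 J₁ (fun j E => A i ∪ A j ⊆ E ∧ D J₀ E)
        have hu2 : bernoulliProb p (fun E => (A i ⊆ E ∧ D J₀ E) ∧ ∃ j ∈ J₁, A j ⊆ E) ≤
            bernoulliProb p (fun E => ∃ j ∈ J₁, A i ∪ A j ⊆ E ∧ D J₀ E) := by
          refine bernoulliProb_mono h0 h1 fun E hE => ?_
          obtain ⟨⟨ha, hd⟩, j, hj, hjE⟩ := hE
          exact ⟨j, hj, union_subset ha hjE, hd⟩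
        have hu3 : bernoulliProb p (fun E => (A i ⊆ E ∧ D J₀ E) ∧ ¬ ∃ j ∈ J₁, A j ⊆ E) ≤
            bernoulliProb p (fun E => A i ⊆ E ∧ D J E) := by
          refine bernoulliProb_mono h0 h1 fun E hE => ⟨hE.1.1, fun j hj hjE => ?_⟩
          by_cases hdis : Disjoint (A i) (A j)
          · exact hE.1.2 j (mem_filter.2 ⟨hj, hdis⟩) hjE
          · exact hE.2 ⟨j, mem_filter.2 ⟨hj, hdis⟩, hjE⟩
        have hu4 := sum_le_sum hcross
        rw [← sum_mul] at hu4
        rw [hind] at hs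
        linarith
      -- Passing from `D J₀` to the smaller event `D J` needs a nonnegative factor. For a negative
      -- factor the lower bound is trivial.
      rcases le_total 0 (P - s₁) with hpos | hneg
      · refine le_trans (mul_le_mul_of_nonneg_left ?_ hpos) hsub
        exact bernoulliProb_mono h0 h1 fun E hE j hj => hE j (mem_filter.1 hj).1
      · exact (mul_nonpos_of_nonpos_of_nonneg hneg (bernoulliProb_nonneg h0 h1 _)).trans
          (bernoulliProb_nonneg h0 h1 _)
    have hstep : bernoulliProb p (D (insert i J)) ≤
        bernoulliProb p (D J) * Real.exp (-P + s₁) := by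
      have hs := bernoulliProb_and_add (p := p) (D J) (fun E => A i ⊆ E)
      have e1 : (fun E => D J E ∧ ¬ A i ⊆ E) = D (insert i J) := by
        funext E; simp only [hD, forall_mem_insert, and_comm]
      have e2 : (fun E => D J E ∧ A i ⊆ E) = fun E => A i ⊆ E ∧ D J E := by
        funext E; simp only [and_comm]
      rw [e1, e2] at hs
      have h3 : bernoulliProb p (D (insert i J)) ≤ bernoulliProb p (D J) * (1 + (-P + s₁)) := by
        linarith
      refine h3.trans (mul_le_mul_of_nonneg_left ?_ (bernoulliProb_nonneg h0 h1 _))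
      linarith [Real.add_one_le_exp (-P + s₁)]
    refine hstep.trans ((mul_le_mul_of_nonneg_right ih (Real.exp_pos _).le).trans ?_)
    rw [← Real.exp_add]
    refine Real.exp_le_exp.2 ?_
    rw [sum_insert hi, sum_insert hi]
    have f1 : ((insert i J).filter fun j => j ≠ i ∧ ¬ Disjoint (A i) (A j)) = J₁ := by
      ext j
      simp only [mem_filter, mem_insert, hJ₁]
      constructor
      · rintro ⟨rfl | h, hne, hd⟩
        · exact absurd rfl hne
        · exact ⟨h, hd⟩
      · rintro ⟨h, hd⟩
        exact ⟨Or.inr h, fun h2 => hi (h2 ▸ h), hd⟩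
    -- The double sum runs over ordered pairs, so `i` contributes `s₁` twice: once as its own row
    -- and once spread over the other rows. Halving leaves the single `s₁` that was paid.
    have f2 : ∑ j ∈ J, ∑ l ∈ (insert i J) with l ≠ j ∧ ¬ Disjoint (A j) (A l),
        ∏ e ∈ A j ∪ A l, p e = s₁ +
        ∑ j ∈ J, ∑ l ∈ J with l ≠ j ∧ ¬ Disjoint (A j) (A l), ∏ e ∈ A j ∪ A l, p e := by
      rw [hs₁, hJ₁, sum_filter, ← sum_add_distrib]
      refine sum_congr rfl fun j hj => ?_
      have hne : i ≠ j := fun h => hi (h ▸ hj)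
      rw [filter_insert]
      by_cases hd : Disjoint (A i) (A j)
      · rw [if_neg (by simp [hd.symm]), if_neg (by simp [hd])]
        simp
      · rw [if_pos ⟨hne, fun h => hd h.symm⟩, if_pos hd, sum_insert (by simp [hi]), union_comm]
    rw [f1, f2, ← hs₁, ← hP]
    linarith

end Bernoulli

/-! ### Overlaps of tight paths with prescribed ends, and the resulting Janson bound. -/

section Windows

variable {V : Type*} [DecidableEq V]

/-- The set of the `r` consecutive terms of `f` that start at position `t`. -/
def window (r : ℕ) (f : ℕ → V) (t : ℕ) : Finset V := (range r).image fun j => f (t + j)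

/-- The first `L` windows of `r` consecutive terms of `f`. -/
def windows (r L : ℕ) (f : ℕ → V) : Finset (Finset V) := (range L).image (window r f)

/-- The sequence `f` takes colour `q` at position `q`, for the first `m + 2 * ρ` positions. -/
def IsColored (ρ m : ℕ) (col : V → ℕ) (f : ℕ → V) : Prop := ∀ q < m + 2 * ρ, col (f q) = q

variable {ρ m : ℕ} {col : V → ℕ} {f g : ℕ → V}

/-- A vertex carries its position as its colour. A window, even as an unordered set, therefore
reveals where it starts and which vertex stands at each of its positions. -/
lemma window_eq_imp (hf : IsColored ρ m col f) (hg : IsColored ρ m col g) {t t' : ℕ}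
    (ht : t < m + ρ) (ht' : t' < m + ρ) (h : window (ρ + 1) f t = window (ρ + 1) g t') :
    t = t' ∧ ∀ j ≤ ρ, f (t + j) = g (t + j) := by
  have hkey : ∀ j ≤ ρ, ∃ j' ≤ ρ, f (t + j) = g (t' + j') ∧ t + j = t' + j' := by
    intro j hj
    have : f (t + j) ∈ window (ρ + 1) g t' := by
      rw [← h]; exact mem_image.2 ⟨j, by simp; omega, rfl⟩
    obtain ⟨j', hj', he⟩ := mem_image.1 this
    rw [mem_range] at hj'
    have h1 := hf (t + j) (by omega)
    have h2 := hg (t' + j') (by omega)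
    exact ⟨j', by omega, he.symm, by rw [← h1, ← h2, he]⟩
  have hkey2 : ∃ j ≤ ρ, t' = t + j := by
    have : g (t' + 0) ∈ window (ρ + 1) f t := by
      rw [h]; exact mem_image.2 ⟨0, by simp, rfl⟩
    obtain ⟨j, hj, he⟩ := mem_image.1 this
    rw [mem_range] at hj
    have h1 := hf (t + j) (by omega)
    have h2 := hg (t' + 0) (by omega)
    exact ⟨j, by omega, by rw [he, h2] at h1; omega⟩
  obtain ⟨j₀, -, h0⟩ := hkey2
  obtain ⟨j₁, -, -, h1⟩ := hkey 0 (by omega)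
  have htt : t = t' := by omega
  subst htt
  refine ⟨rfl, fun j hj => ?_⟩
  obtain ⟨j', -, he, heq⟩ := hkey j hj
  have : j' = j := by omega
  rw [he, this]

lemma card_window (hf : IsColored ρ m col f) {t : ℕ} (ht : t < m + ρ) :
    #(window (ρ + 1) f t) = ρ + 1 := by
  rw [window, card_image_of_injOn, card_range]
  intro j hj j' hj' h
  simp only [coe_range, Set.mem_Iio] at hj hj'
  have h1 := hf (t + j) (by omega)
  have h2 := hf (t + j') (by omega)
  simp only at h
  rw [h] at h1
  omega

lemma card_windows (hf : IsColored ρ m col f) : #(windows (ρ + 1) (m + ρ) f) = m + ρ := by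
  rw [windows, card_image_of_injOn, card_range]
  intro t ht t' ht' h
  simp only [coe_range, Set.mem_Iio] at ht ht'
  exact (window_eq_imp hf hf ht ht' h).1

lemma card_windows_inter_le (hf : IsColored ρ m col f) (hg : IsColored ρ m col g) :
    #(windows (ρ + 1) (m + ρ) f ∩ windows (ρ + 1) (m + ρ) g) ≤
      #{t ∈ range (m + ρ) | ∀ j ≤ ρ, f (t + j) = g (t + j)} := by
  refine le_trans (card_le_card ?_) (card_image_le (f := window (ρ + 1) f))
  intro e he
  obtain ⟨h1, h2⟩ := mem_inter.1 he
  obtain ⟨t, ht, rfl⟩ := mem_image.1 h1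
  obtain ⟨t', ht', h⟩ := mem_image.1 h2
  rw [mem_range] at ht ht'
  exact mem_image.2 ⟨t, mem_filter.2 ⟨mem_range.2 ht, (window_eq_imp hf hg ht ht' h.symm).2⟩, rfl⟩

lemma card_filter_range_le (P : ℕ → Prop) [DecidablePred P] :
    #{j ∈ range m | P j} ≤ #{j : Fin m | P j} := by
  refine le_trans (card_le_card fun j hj => ?_) (card_image_le (f := Fin.val))
  obtain ⟨h1, h2⟩ := mem_filter.1 hj
  exact mem_image.2 ⟨⟨j, mem_range.1 h1⟩, by simpa using h2, rfl⟩

/-- Two sequences which differ in an inner term share at most as many windows as inner terms. -/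
lemma card_common_windows_le {j₀ : Fin m} (hj₀ : f (ρ + j₀) ≠ g (ρ + j₀)) :
    #{t ∈ range (m + ρ) | ∀ j ≤ ρ, f (t + j) = g (t + j)} ≤
      #{j : Fin m | f (ρ + j) = g (ρ + j)} := by
  have hlt := j₀.isLt
  -- No common window covers the position `ρ + j₀`, so each lies strictly on one side of it. Windows
  -- on the left are charged to their last vertex, those on the right to their first. Both are inner
  -- vertices, and the charges are distinct.
  have hcase : ∀ t, (∀ j ≤ ρ, f (t + j) = g (t + j)) → t < j₀ ∨ ρ + j₀ < t := by
    intro t h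
    by_contra! hc
    have := h (ρ + j₀ - t) (by omega)
    rw [show t + (ρ + j₀ - t) = ρ + j₀ by omega] at this
    exact hj₀ this
  refine le_trans (card_le_card_of_injOn (t := {j ∈ range m | f (ρ + j) = g (ρ + j)})
    (fun t => if t < j₀ then t else t - ρ) ?_ ?_) (card_filter_range_le _)
  · intro t ht
    obtain ⟨h1, h2⟩ := mem_filter.1 (mem_coe.1 ht)
    rw [mem_range] at h1
    simp only [coe_filter, mem_range, Set.mem_ofPred_eq]
    rcases hcase t h2 with h | h
    · rw [if_pos h, add_comm ρ t]
      exact ⟨by omega, h2 ρ le_rfl⟩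
    · rw [if_neg (by omega), show ρ + (t - ρ) = t + 0 by omega]
      exact ⟨by omega, h2 0 (by omega)⟩
  · intro t ht t' ht' h
    have h1 := hcase t (mem_filter.1 (mem_coe.1 ht)).2
    have h2 := hcase t' (mem_filter.1 (mem_coe.1 ht')).2
    dsimp only at h
    split_ifs at h <;> omega

/-- Two sequences with no common end terms that share windows share more inner terms. -/
lemma card_common_windows_lt (hρ : 1 ≤ ρ)
    (h : ∀ q < m + 2 * ρ, f q = g q → ρ ≤ q ∧ q < ρ + m)
    (hpos : 1 ≤ #{t ∈ range (m + ρ) | ∀ j ≤ ρ, f (t + j) = g (t + j)}) :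
    #{t ∈ range (m + ρ) | ∀ j ≤ ρ, f (t + j) = g (t + j)} + 1 ≤
      #{j : Fin m | f (ρ + j) = g (ρ + j)} := by
  set C := {t ∈ range (m + ρ) | ∀ j ≤ ρ, f (t + j) = g (t + j)} with hC
  refine le_trans ?_ (card_filter_range_le (m := m) fun j => f (ρ + j) = g (ρ + j))
  have hne : C.Nonempty := card_pos.1 hpos
  have hmem : ∀ t ∈ C, ρ ≤ t ∧ t < m ∧ f t = g t ∧ f (ρ + t) = g (ρ + t) := by
    intro t ht
    obtain ⟨h1, h2⟩ := mem_filter.1 ht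
    rw [mem_range] at h1
    have h3 := h (t + 0) (by omega) (h2 0 (by omega))
    have h4 := h (t + ρ) (by omega) (h2 ρ le_rfl)
    exact ⟨h3.1, by omega, h2 0 (by omega), by rw [add_comm]; exact h2 ρ le_rfl⟩
  -- With no common end terms, every common window lies wholly in the inner part. Their last
  -- vertices already give one agreement per window, and the first vertex of the earliest common
  -- window is an additional one.
  have hmin := hmem _ (C.min'_mem hne)
  have hnot : C.min' hne - ρ ∉ C := fun hc => by
    have := C.min'_le _ hc
    omega
  rw [← card_insert_of_notMem hnot]
  refine card_le_card fun t ht => ?_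
  rcases mem_insert.1 ht with rfl | ht
  · refine mem_filter.2 ⟨mem_range.2 (by omega), ?_⟩
    rw [show ρ + (C.min' hne - ρ) = C.min' hne by omega]
    exact hmin.2.2.1
  · exact mem_filter.2 ⟨mem_range.2 (hmem t ht).2.1, (hmem t ht).2.2.2⟩

/-- Group the sequences by the set of indices where they agree with `x`. An agreement set of size a
leaves at most w^(m-a) sequences, so each of the 2^m groups contributes at most 1. -/
lemma sum_inv_pow_agreement_le [Fintype V] {w : ℕ} (hw : 0 < w) (W : Fin m → Finset V)
    (hW : ∀ j, #(W j) = w) (x : Fin m → V) :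
    ∑ y ∈ Fintype.piFinset W, ((w : ℝ) ^ (m - #{j | x j = y j}))⁻¹ ≤ 2 ^ m := by
  have hw' : (0 : ℝ) < w := by exact_mod_cast hw
  rw [← sum_fiberwise_of_maps_to (s := Fintype.piFinset W) (t := univ)
    (g := fun y => ({j | x j = y j} : Finset (Fin m))) (fun _ _ => mem_univ _)]
  have hA : ∀ A : Finset (Fin m), ∑ y ∈ Fintype.piFinset W with ({j | x j = y j} : Finset _) = A,
      ((w : ℝ) ^ (m - #{j | x j = y j}))⁻¹ ≤ 1 := by
    intro A
    rw [sum_congr rfl (g := fun _ => ((w : ℝ) ^ (m - #A))⁻¹)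
      (fun y hy => by rw [(mem_filter.1 hy).2]), sum_const, nsmul_eq_mul]
    rw [← div_eq_mul_inv, div_le_one (by positivity)]
    have hsub : {y ∈ Fintype.piFinset W | ({j | x j = y j} : Finset _) = A} ⊆
        Fintype.piFinset fun j => if j ∈ A then {x j} else W j := by
      intro y hy
      obtain ⟨h1, h2⟩ := mem_filter.1 hy
      rw [Fintype.mem_piFinset] at h1 ⊢
      intro j
      split_ifs with hj
      · rw [← h2] at hj
        simpa using (mem_filter.1 hj).2.symm
      · exact h1 j
    have hcard := card_le_card hsub
    rw [Fintype.card_piFinset] at hcard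
    have hprod : ∏ j, #(if j ∈ A then {x j} else W j) = w ^ (m - #A) := by
      have : ∀ j, #(if j ∈ A then {x j} else W j) = if j ∈ A then 1 else w := by
        intro j; split_ifs <;> simp [hW]
      simp only [this]
      rw [prod_ite, prod_const_one, one_mul, prod_const]
      congr 1
      rw [filter_not, card_sdiff_of_subset (filter_subset _ _)]
      simp
    rw [hprod] at hcard
    exact_mod_cast hcard
  refine (sum_le_sum fun A _ => hA A).trans ?_
  simp

/-- If a family of layers of size `w` is given then, unless these are too large, it is unlikely
that none of the sequences with inner terms in these layers has all its windows chosen. -/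
theorem bernoulliProb_no_windows_le {ι : Type*} [Fintype V] [DecidableEq ι] {w : ℕ} (hρ : 1 ≤ ρ)
    (hw : 0 < w) (S : Finset ι) (W : Fin m → Finset V) (hW : ∀ j, #(W j) = w)
    (F : ι → (Fin m → V) → ℕ → V)
    (hcol : ∀ i ∈ S, ∀ x ∈ Fintype.piFinset W, IsColored ρ m col (F i x))
    (hmid : ∀ i x (j : Fin m), F i x (ρ + j) = x j)
    (hdiff : ∀ i ∈ S, ∀ i' ∈ S, i ≠ i' → ∀ x ∈ Fintype.piFinset W, ∀ x' ∈ Fintype.piFinset W,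
      ∀ q < m + 2 * ρ, F i x q = F i' x' q → ρ ≤ q ∧ q < ρ + m)
    {p : ℝ} (hp0 : 0 < p) (hp1 : p ≤ 1)
    (hsame : ∀ a e, 1 ≤ e → e ≤ a → a < m → (w : ℝ) ^ (m - a) * p ^ (m + ρ - e) ≤ 1 / 2 / 2 ^ m)
    (hother : ∀ a e, 1 ≤ e → e + 1 ≤ a → a ≤ m →
      #S * ((w : ℝ) ^ (m - a) * p ^ (m + ρ - e)) ≤ 1 / 2 / 2 ^ m) :
    bernoulliProb (fun e : Finset V => if #e = ρ + 1 then p else 0)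
      (fun E => ∀ i ∈ S, ∀ x ∈ Fintype.piFinset W, ¬ windows (ρ + 1) (m + ρ) (F i x) ⊆ E) ≤
      Real.exp (-(#S * ((w : ℝ) ^ m * p ^ (m + ρ)) / 2)) := by
  set I := S ×ˢ Fintype.piFinset W with hI
  set A : ι × (Fin m → V) → Finset (Finset V) := fun a => windows (ρ + 1) (m + ρ) (F a.1 a.2)
  set P : Finset V → ℝ := fun e => if #e = ρ + 1 then p else 0 with hP
  have hw' : (0 : ℝ) < w := by exact_mod_cast hw
  have h0 : ∀ e, 0 ≤ P e := fun e => by simp only [hP]; split_ifs <;> linarith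
  have h1 : ∀ e, P e ≤ 1 := fun e => by simp only [hP]; split_ifs <;> linarith
  have hcolI : ∀ a ∈ I, IsColored ρ m col (F a.1 a.2) := fun a ha =>
    hcol _ (mem_product.1 ha).1 _ (mem_product.1 ha).2
  have hprod : ∀ B : Finset (Finset V), (∀ e ∈ B, #e = ρ + 1) → ∏ e ∈ B, P e = p ^ #B := by
    intro B hB
    rw [prod_congr rfl (g := fun _ => p) (fun e he => by simp [hP, hB e he]), prod_const]
  have hunif : ∀ a ∈ I, ∀ e ∈ A a, #e = ρ + 1 := by
    intro a ha e he
    obtain ⟨t, ht, rfl⟩ := mem_image.1 he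
    exact card_window (hcolI a ha) (mem_range.1 ht)
  have hcardA : ∀ a ∈ I, #(A a) = m + ρ := fun a ha => card_windows (hcolI a ha)
  have hJ := janson_inequality h0 h1 I A
  have hev : (fun E : Finset (Finset V) => ∀ i ∈ S, ∀ x ∈ Fintype.piFinset W,
      ¬ windows (ρ + 1) (m + ρ) (F i x) ⊆ E) = fun E => ∀ a ∈ I, ¬ A a ⊆ E := by
    funext E
    simp only [hI, mem_product, Prod.forall, A, eq_iff_iff]
    exact ⟨fun h i x hh => h i hh.1 x hh.2, fun h i hi x hx => h i x ⟨hi, hx⟩⟩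
  rw [hev]
  refine hJ.trans (Real.exp_le_exp.2 ?_)
  have hmu : ∑ a ∈ I, ∏ e ∈ A a, P e = #S * ((w : ℝ) ^ m * p ^ (m + ρ)) := by
    rw [sum_congr rfl (g := fun _ => p ^ (m + ρ))
      (fun a ha => by rw [hprod _ (hunif a ha), hcardA a ha]), sum_const, nsmul_eq_mul, hI,
      card_product, Fintype.card_piFinset]
    simp only [hW, prod_const, card_univ, Fintype.card_fin]
    push_cast; ring
  -- Each row of the correlation sum is at most the weight of its own index. The sum is then at most
  -- the mean μ, and Janson's exponent -μ + Δ/2 is at most -μ/2.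
  have hinner : ∀ a ∈ I, ∑ b ∈ I with b ≠ a ∧ ¬ Disjoint (A a) (A b), ∏ e ∈ A a ∪ A b, P e ≤
      p ^ (m + ρ) := by
    intro a ha
    obtain ⟨haS, haW⟩ := mem_product.1 ha
    have hS : 0 < #S := card_pos.2 ⟨_, haS⟩
    have hS' : (0 : ℝ) < #S := by exact_mod_cast hS
    -- A majorant for the conditional weight of `b` given `a`, with total mass at most 1. Sequences
    -- for the same index account for at most 1/2, and the indices of `S` share another 1/2 equally.
    set G : ι × (Fin m → V) → ℝ := fun b => (if b.1 = a.1 then 1 else (#S : ℝ)⁻¹) *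
      (1 / 2 / 2 ^ m) * ((w : ℝ) ^ (m - #{j | a.2 j = b.2 j}))⁻¹ with hG
    have hterm : ∀ b ∈ I, (b ≠ a ∧ ¬ Disjoint (A a) (A b)) →
        ∏ e ∈ A a ∪ A b, P e ≤ p ^ (m + ρ) * G b := by
      rintro b hb ⟨hne, hnd⟩
      obtain ⟨hbS, hbW⟩ := mem_product.1 hb
      rw [hprod _ (fun e he => (mem_union.1 he).elim (hunif a ha e) (hunif b hb e))]
      have hcu := card_union_add_card_inter (A a) (A b)
      rw [hcardA a ha, hcardA b hb] at hcu
      have hile := card_le_card (inter_subset_left : A a ∩ A b ⊆ A a)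
      rw [hcardA a ha] at hile
      have hi1 : 1 ≤ #(A a ∩ A b) := by
        rw [Nat.one_le_iff_ne_zero, Ne, card_eq_zero, ← disjoint_iff_inter_eq_empty]
        exact hnd
      have hcom := card_windows_inter_le (hcolI a ha) (hcolI b hb)
      have hagr : #{j : Fin m | F a.1 a.2 (ρ + j) = F b.1 b.2 (ρ + j)} =
          #{j | a.2 j = b.2 j} := by simp only [hmid]
      rw [show #(A a ∪ A b) = (m + ρ) + (m + ρ - #(A a ∩ A b)) by omega, pow_add]
      refine mul_le_mul_of_nonneg_left ?_ (by positivity)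
      have hwp : 0 < (w : ℝ) ^ (m - #{j | a.2 j = b.2 j}) := by positivity
      have ham : #{j | a.2 j = b.2 j} ≤ m := by
        simpa using card_le_univ ({j | a.2 j = b.2 j} : Finset (Fin m))
      simp only [hG]
      rw [← div_eq_mul_inv, le_div_iff₀ hwp, mul_comm (p ^ _)]
      by_cases hi : b.1 = a.1
      · rw [if_pos hi, one_mul]
        have hx : ∃ j, a.2 j ≠ b.2 j := by
          by_contra! hc
          exact hne (Prod.ext hi (funext fun j => (hc j).symm))
        obtain ⟨j₀, hj₀⟩ := hx
        have hle := card_common_windows_le (f := F a.1 a.2) (g := F b.1 b.2) (j₀ := j₀)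
          (ρ := ρ) (by rw [hmid, hmid]; exact hj₀)
        rw [hagr] at hle
        refine hsame _ _ hi1 (hcom.trans hle) (lt_of_le_of_ne ham fun h => ?_)
        have : ({j | a.2 j = b.2 j} : Finset (Fin m)) = univ :=
          eq_univ_of_card _ (by simpa using h)
        have := this ▸ mem_univ j₀
        exact hj₀ (by simpa using this)
      · rw [if_neg hi, ← div_eq_inv_mul, le_div_iff₀ hS', mul_comm]
        have hlt := card_common_windows_lt (f := F a.1 a.2) (g := F b.1 b.2) hρ
          (hdiff _ haS _ hbS (Ne.symm hi) _ haW _ hbW) (hi1.trans hcom)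
        rw [hagr] at hlt
        exact hother _ _ hi1 (by
          have : #(A a ∩ A b) ≤ _ := hcom
          omega) ham
    have hGnn : ∀ b, 0 ≤ G b := fun b => by
      simp only [hG]
      split_ifs <;> positivity
    have hstep : ∑ b ∈ I with b ≠ a ∧ ¬ Disjoint (A a) (A b), ∏ e ∈ A a ∪ A b, P e ≤
        p ^ (m + ρ) * ∑ b ∈ I, G b := by
      rw [mul_sum]
      refine (sum_le_sum fun b hb => hterm b (mem_filter.1 hb).1 (mem_filter.1 hb).2).trans ?_
      exact sum_le_sum_of_subset_of_nonneg (filter_subset _ _)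
        fun b _ _ => mul_nonneg (by positivity) (hGnn b)
    refine hstep.trans (mul_le_of_le_one_right (by positivity) ?_)
    rw [hI, sum_product]
    have hsum : ∀ i ∈ S, ∑ y ∈ Fintype.piFinset W, G (i, y) ≤
        (if i = a.1 then 1 / 2 else 0) + (1 / 2) * (#S : ℝ)⁻¹ := by
      intro i _
      have hs := sum_inv_pow_agreement_le hw W hW a.2
      have hc0 : (0 : ℝ) ≤ (if i = a.1 then 1 else (#S : ℝ)⁻¹) * (1 / 2 / 2 ^ m) := by
        split_ifs <;> positivity
      refine ((mul_sum _ _ _).symm.trans_le (mul_le_mul_of_nonneg_left hs hc0)).trans ?_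
      rw [mul_assoc, div_mul_cancel₀ _ (by positivity)]
      have : (0 : ℝ) < (#S : ℝ)⁻¹ := by positivity
      split_ifs <;> linarith
    refine (sum_le_sum hsum).trans ?_
    rw [sum_add_distrib, sum_ite_eq' S a.1, if_pos haS, sum_const, nsmul_eq_mul]
    have : (#S : ℝ) * (1 / 2 * (#S : ℝ)⁻¹) = 1 / 2 := by field_simp
    rw [this]; norm_num
  have hD := sum_le_sum hinner
  have hconst : ∑ _a ∈ I, p ^ (m + ρ) = #S * ((w : ℝ) ^ m * p ^ (m + ρ)) := by
    rw [← hmu]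
    exact sum_congr rfl fun a ha => by rw [hprod _ (hunif a ha), hcardA a ha]
  rw [hconst] at hD
  rw [hmu]
  linarith

end Windows

/-! ### Robustness of the random edge set, by a union bound. -/

section Robust

variable {V ι : Type*} [Fintype V] [DecidableEq V] [Fintype ι] [DecidableEq ι]

/-- Even if a set `Z` of vertices, that is not too large, is removed from the layers of tier `t`,
every set `S` of indices contains one with a sequence through this tier whose windows are chosen. -/
def IsRobust (ρ m T : ℕ) (b : ℝ) (Y : ℕ → Fin m → Finset V) (F : ι → (Fin m → V) → ℕ → V)
    (E : Finset (Finset V)) : Prop :=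
  ∀ t < T, ∀ (Z : Finset V) (S : Finset ι), S.Nonempty → (#Z : ℝ) ≤ m * b * #S →
    #Z ≤ m * Fintype.card ι →
      ∃ i ∈ S, ∃ x ∈ Fintype.piFinset fun j => Y t j \ Z, windows (ρ + 1) (m + ρ) (F i x) ⊆ E

/-- The binomial theorem gives (1 + y)^|γ|, and 1 + y ≤ exp y. -/
lemma sum_pow_card_le_exp (γ : Type*) [Fintype γ] {y : ℝ} (hy : 0 ≤ y) :
    ∑ Z : Finset γ, y ^ #Z ≤ Real.exp (Fintype.card γ * y) := by
  have h := Fintype.sum_pow_mul_eq_add_pow γ y 1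
  simp only [one_pow, mul_one] at h
  rw [h, Real.exp_nat_mul]
  exact pow_le_pow_left₀ (by positivity) (by linarith [Real.add_one_le_exp y]) _

/-- The failure bound exp(-|S| κ) is split into halves, one charged to the elements of `S` and one
to those of `Z`. The condition |Z| ≤ m b |S| makes the second half worth exp(-κ/(2mb)) per element
of `Z`. The sums over `Z` and over nonempty `S` then factor, and the -1 removes the empty `S`. -/
lemma bernoulliProb_not_isRobust_le {ρ m T : ℕ} {b κ : ℝ} (hm : 1 ≤ m) (hb : 1 ≤ b) (hκ : 0 ≤ κ)
    {Y : ℕ → Fin m → Finset V} {F : ι → (Fin m → V) → ℕ → V} {P : Finset V → ℝ}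
    (h0 : ∀ e, 0 ≤ P e) (h1 : ∀ e, P e ≤ 1)
    (hfail : ∀ t < T, ∀ (Z : Finset V) (S : Finset ι), S.Nonempty → #Z ≤ m * Fintype.card ι →
      bernoulliProb P (fun E => ∀ i ∈ S, ∀ x ∈ Fintype.piFinset fun j => Y t j \ Z,
        ¬ windows (ρ + 1) (m + ρ) (F i x) ⊆ E) ≤ Real.exp (-(#S * κ)))
    {y : ℝ} (hy : Real.exp (-(κ / (2 * m * b))) ≤ y) :
    bernoulliProb P (fun E => ¬ IsRobust ρ m T b Y F E) ≤
      T * Real.exp (Fintype.card V * y) * (Real.exp (Fintype.card ι * y) - 1) := by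
  have hm' : (1 : ℝ) ≤ m := by exact_mod_cast hm
  have hy0 : 0 < y := (Real.exp_pos _).trans_le hy
  have hy2 : Real.exp (-(κ / 2)) ≤ y := by
    refine le_trans (Real.exp_le_exp.2 (neg_le_neg ?_)) hy
    refine div_le_div_of_nonneg_left hκ (by norm_num) ?_
    nlinarith
  set I : Finset (ℕ × Finset V × Finset ι) :=
    range T ×ˢ (univ : Finset (Finset V)) ×ˢ univ.erase (∅ : Finset ι) with hI
  have hle : bernoulliProb P (fun E => ¬ IsRobust ρ m T b Y F E) ≤
      bernoulliProb P (fun E => ∃ a ∈ I, ((#a.2.1 : ℝ) ≤ m * b * #a.2.2 ∧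
        #a.2.1 ≤ m * Fintype.card ι) ∧ ∀ i ∈ a.2.2, ∀ x ∈ Fintype.piFinset fun j => Y a.1 j \ a.2.1,
        ¬ windows (ρ + 1) (m + ρ) (F i x) ⊆ E) := by
    refine bernoulliProb_mono h0 h1 fun E hE => ?_
    simp only [IsRobust] at hE
    push Not at hE
    obtain ⟨t, ht, Z, S, hS, hZ, hZ2, hx⟩ := hE
    refine ⟨(t, Z, S), ?_, ⟨hZ, hZ2⟩, hx⟩
    simp [hI, ht, hS.ne_empty]
  refine hle.trans ((bernoulliProb_exists_le h0 h1 _ _).trans ?_)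
  have hterm : ∀ a ∈ I, bernoulliProb P (fun E => ((#a.2.1 : ℝ) ≤ m * b * #a.2.2 ∧
        #a.2.1 ≤ m * Fintype.card ι) ∧ ∀ i ∈ a.2.2, ∀ x ∈ Fintype.piFinset fun j => Y a.1 j \ a.2.1,
        ¬ windows (ρ + 1) (m + ρ) (F i x) ⊆ E) ≤ y ^ #a.2.1 * y ^ #a.2.2 := by
    rintro ⟨t, Z, S⟩ ha
    simp only [hI, mem_product, mem_range, mem_univ, mem_erase, true_and, and_true] at ha
    by_cases hc : (#Z : ℝ) ≤ m * b * #S ∧ #Z ≤ m * Fintype.card ι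
    · refine (bernoulliProb_mono h0 h1 fun E hE => hE.2).trans
        ((hfail t ha.1 Z S (nonempty_iff_ne_empty.2 ha.2) hc.2).trans ?_)
      have e1 : Real.exp (-(κ / (2 * m * b))) ^ #Z ≤ y ^ #Z :=
        pow_le_pow_left₀ (Real.exp_pos _).le hy _
      have e2 : Real.exp (-(κ / 2)) ^ #S ≤ y ^ #S :=
        pow_le_pow_left₀ (Real.exp_pos _).le hy2 _
      refine le_trans ?_ (mul_le_mul e1 e2 (by positivity) (by positivity))
      rw [← Real.exp_nat_mul, ← Real.exp_nat_mul, ← Real.exp_add]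
      refine Real.exp_le_exp.2 ?_
      have : (#Z : ℝ) * (κ / (2 * m * b)) ≤ #S * (κ / 2) := by
        rw [mul_div_assoc', div_le_iff₀ (by positivity)]
        have := mul_le_mul_of_nonneg_right hc.1 hκ
        linarith
      linarith
    -- The size restrictions were put inside the event, so triples violating them contribute
    -- nothing.
    · have hz : ∀ Q : Finset (Finset V) → Prop, (∀ E, ¬ Q E) → bernoulliProb P Q = 0 :=
        fun Q hQ => by simp [bernoulliProb, hQ]
      rw [hz _ fun E hE => hc hE.1]
      positivity
  refine (sum_le_sum hterm).trans ?_
  rw [hI, sum_product]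
  simp only [sum_product]
  rw [sum_const, card_range, nsmul_eq_mul, mul_assoc]
  refine mul_le_mul_of_nonneg_left ?_ (by positivity)
  rw [← sum_mul_sum]
  have hpow := sum_pow_card_le_exp ι hy0.le
  refine mul_le_mul (sum_pow_card_le_exp V hy0.le) ?_ (sum_nonneg fun _ _ => by positivity) (Real.exp_pos _).le
  have := add_sum_erase univ (fun S : Finset ι => y ^ #S) (mem_univ ∅)
  simp only [card_empty, pow_zero] at this
  linarith

/-- The decay of the error in the union bound. -/
lemma tendsto_union_bound (T : ℕ) {C c : ℝ} (hC : 0 < C) (hc : 0 < c) :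
    Tendsto (fun n : ℕ => T * Real.exp (n * Real.exp (-(C * (n : ℝ) ^ c))) *
      (Real.exp (n * Real.exp (-(C * (n : ℝ) ^ c))) - 1)) atTop (𝓝 0) := by
  have h1 : Tendsto (fun x : ℝ => x * Real.exp (-(C * x ^ c))) atTop (𝓝 0) := by
    have h := (tendsto_rpow_mul_exp_neg_mul_atTop_nhds_zero (1 / c) C hC).comp
      (tendsto_rpow_atTop hc)
    refine h.congr' ?_
    filter_upwards [eventually_gt_atTop 0] with x hx
    simp only [Function.comp_apply]
    rw [← Real.rpow_mul hx.le, mul_one_div_cancel hc.ne', Real.rpow_one, neg_mul]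
  have h2 := h1.comp tendsto_natCast_atTop_atTop
  have h3 := (Real.continuous_exp.tendsto 0).comp h2
  have h4 := (h3.const_mul (T : ℝ)).mul (h3.sub_const 1)
  simpa using h4

/-- The choice b = n^(c/2) is a compromise: b must be a positive power of n for the greedy argument,
yet n^c / b must still be a power of n for the union bound. The error depends on n only, uniformly
in the layers and the end tuples. -/
theorem exists_tendsto_bernoulliProb_not_isRobust_le {ρ m : ℕ} (T : ℕ) (hρ : 1 ≤ ρ) (hm : 1 ≤ m)
    {ε c γ η : ℝ} (hε0 : 0 < ε) (hε1 : ε < 1) (hc : c = ε * (m + ρ) - ρ) (hc0 : 0 < c)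
    (hcε : c ≤ ε) (hγ0 : 0 < γ) (hγ : 2 * γ ≤ 1 / 2 / 2 ^ m) (hη : η ≤ 1 / 2 / 2 ^ m) :
    ∃ err : ℕ → ℝ, Tendsto err atTop (𝓝 0) ∧ ∀ n k : ℕ, 1 ≤ γ * n → 1 ≤ n → (k : ℝ) ≤ η * n →
      ∀ Y : ℕ → Fin m → Finset (Fin n), (∀ t < T, ∀ j, (2 * γ + m * η) * n ≤ #(Y t j)) →
      ∀ F : Fin k → (Fin m → Fin n) → ℕ → Fin n,
      (∀ t < T, ∃ col, ∀ i, ∀ x ∈ Fintype.piFinset (Y t), IsColored ρ m col (F i x)) →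
      (∀ i x (j : Fin m), F i x (ρ + j) = x j) →
      (∀ t < T, ∀ i i', i ≠ i' → ∀ x ∈ Fintype.piFinset (Y t), ∀ x' ∈ Fintype.piFinset (Y t),
        ∀ q < m + 2 * ρ, F i x q = F i' x' q → ρ ≤ q ∧ q < ρ + m) →
      bernoulliProb (fun e => if #e = ρ + 1 then (n : ℝ) ^ (-1 + ε) else 0)
        (fun E => ¬ IsRobust ρ m T ((n : ℝ) ^ (c / 2)) Y F E) ≤ err n := by
  have hm' : (1 : ℝ) ≤ m := by exact_mod_cast hm
  refine ⟨_, tendsto_union_bound T (C := γ ^ m / (4 * m)) (c := c / 2) (by positivity)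
    (by positivity), ?_⟩
  intro n k hγn hn hk Y hY F hcol hmid hdiff
  have hn1 : (1 : ℝ) ≤ n := by exact_mod_cast hn
  have hn0 : (0 : ℝ) < n := by linarith
  set p := (n : ℝ) ^ (-1 + ε) with hp
  have hp0 : 0 < p := Real.rpow_pos_of_pos hn0 _
  have hp1 : p ≤ 1 := Real.rpow_le_one_of_one_le_of_nonpos hn1 (by linarith)
  have hpow1 : (1 : ℝ) / 2 / 2 ^ m ≤ 1 := by
    rw [div_le_one (by positivity)]
    have : (1 : ℝ) ≤ 2 ^ m := one_le_pow₀ (by norm_num)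
    linarith
  set w := ⌈γ * n⌉₊ with hw
  have hwlow : γ * n ≤ w := Nat.le_ceil _
  have hwup : (w : ℝ) ≤ 2 * γ * n := by
    have := Nat.ceil_lt_add_one (by positivity : 0 ≤ γ * n)
    linarith
  have hw0 : 0 < w := Nat.ceil_pos.2 (by positivity)
  set κ := (w : ℝ) ^ m * p ^ (m + ρ) / 2 with hκ
  have hb1 : 1 ≤ (n : ℝ) ^ (c / 2) := Real.one_le_rpow hn1 (by positivity)
  have hprp : ∀ a : ℕ, p ^ a = (n : ℝ) ^ ((-1 + ε) * a) := fun a => by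
    rw [hp, Real.rpow_mul_natCast hn0.le]
  have hκlow : γ ^ m * (n : ℝ) ^ c ≤ 2 * κ := by
    have e1 : (γ * n) ^ m ≤ (w : ℝ) ^ m := pow_le_pow_left₀ (by positivity) hwlow _
    have e2 : (n : ℝ) ^ c = (n : ℝ) ^ m * p ^ (m + ρ) := by
      rw [hprp, ← Real.rpow_natCast, ← Real.rpow_add hn0]
      congr 1
      push_cast
      rw [hc]; ring
    rw [e2, ← mul_assoc, ← mul_pow, hκ, mul_div_cancel₀ _ (by norm_num)]
    exact mul_le_mul_of_nonneg_right e1 (by positivity)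
  -- The left side bounds the expected number of extensions of an overlap with a common inner
  -- vertices and e common edges. Its exponent of n is (m - a) - (1 - ε)(m + ρ - e), which is c + (e
  -- - a) - εe.
  have hmix : ∀ a e : ℕ, e ≤ a → a ≤ m → (w : ℝ) ^ (m - a) * p ^ (m + ρ - e) ≤
      (2 * γ) ^ (m - a) * (n : ℝ) ^ (c + (e - a) - ε * e) := by
    intro a e hea ham
    have e1 : (w : ℝ) ^ (m - a) ≤ (2 * γ * n) ^ (m - a) := pow_le_pow_left₀ (by positivity) hwup _
    refine (mul_le_mul_of_nonneg_right e1 (by positivity)).trans (le_of_eq ?_)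
    rw [mul_pow, mul_assoc, hprp, ← Real.rpow_natCast (n : ℝ), ← Real.rpow_add hn0]
    congr 2
    rw [Nat.cast_sub ham, Nat.cast_sub (by omega)]
    push_cast
    rw [hc]; ring
  have hγ1 : 2 * γ ≤ 1 := hγ.trans hpow1
  have hP0 : ∀ e : Finset (Fin n), 0 ≤ (if #e = ρ + 1 then p else 0) := fun e => by
    split_ifs <;> linarith
  have hP1 : ∀ e : Finset (Fin n), (if #e = ρ + 1 then p else 0) ≤ 1 := fun e => by
    split_ifs <;> linarith
  have hmain := bernoulliProb_not_isRobust_le (ρ := ρ) (T := T) (b := (n : ℝ) ^ (c / 2)) (κ := κ)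
    (Y := Y) (F := F) hm hb1 (by positivity) hP0 hP1 ?_
    (y := Real.exp (-(γ ^ m / (4 * m) * (n : ℝ) ^ (c / 2)))) ?_
  · refine hmain.trans ?_
    simp only [Fintype.card_fin]
    have hkn : (k : ℝ) ≤ n := hk.trans (mul_le_of_le_one_left hn0.le (hη.trans hpow1))
    refine mul_le_mul_of_nonneg_left ?_ (by positivity)
    refine sub_le_sub_right (Real.exp_le_exp.2 ?_) 1
    exact mul_le_mul_of_nonneg_right hkn (Real.exp_pos _).le
  · intro t ht Z S hS hZ
    obtain ⟨col, hcolt⟩ := hcol t ht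
    have hsize : ∀ j, w ≤ #(Y t j \ Z) := by
      intro j
      have h1 := hY t ht j
      have h2 : #(Y t j) ≤ #(Y t j \ Z) + #Z := by
        have := le_card_sdiff Z (Y t j)
        omega
      have h3 : (#(Y t j) : ℝ) ≤ #(Y t j \ Z) + #Z := by exact_mod_cast h2
      have h4 : (#Z : ℝ) ≤ m * k := by
        rw [Fintype.card_fin] at hZ
        exact_mod_cast hZ
      have h5 : (m : ℝ) * k ≤ m * (η * n) := mul_le_mul_of_nonneg_left hk (by positivity)
      have h6 : (w : ℝ) ≤ #(Y t j \ Z) := by linarith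
      exact_mod_cast h6
    -- Layers are trimmed to exactly `w` vertices, because Janson's inequality needs an upper bound
    -- on their size as well. Fewer candidate sequences only make failure likelier, so the bound
    -- transfers back.
    choose W hWsub hWcard using fun j => exists_subset_card_eq (hsize j)
    have hWY : ∀ x ∈ Fintype.piFinset W, x ∈ Fintype.piFinset (Y t) := fun x hx => by
      rw [Fintype.mem_piFinset] at hx ⊢
      exact fun j => (mem_sdiff.1 (hWsub j (hx j))).1
    have hprob := bernoulliProb_no_windows_le hρ hw0 S W hWcard F (col := col)
      (fun i _ x hx => hcolt i x (hWY x hx)) hmid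
      (fun i _ i' _ hii x hx x' hx' => hdiff t ht i i' hii x (hWY x hx) x' (hWY x' hx')) hp0 hp1
      ?_ ?_
    · refine le_trans (bernoulliProb_mono hP0 hP1 fun E hE i hi x hx => ?_)
        (hprob.trans (le_of_eq ?_))
      · refine hE i hi x ?_
        rw [Fintype.mem_piFinset] at hx ⊢
        exact fun j => hWsub j (hx j)
      · rw [hκ]; congr 1; ring
    · intro a e he hea ham
      refine (hmix a e hea ham.le).trans ?_
      have he' : (1 : ℝ) ≤ e := by exact_mod_cast he
      have hea' : (e : ℝ) ≤ a := by exact_mod_cast hea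
      -- For the same index, 1 ≤ e ≤ a and c ≤ ε only make the exponent nonpositive. The smallness
      -- comes from the remaining factor (2γ)^(m-a), with a < m.
      have e1 : (n : ℝ) ^ (c + (e - a) - ε * e) ≤ 1 :=
        Real.rpow_le_one_of_one_le_of_nonpos hn1 (by nlinarith)
      have e2 : (2 * γ) ^ (m - a) ≤ 2 * γ := pow_le_of_le_one (by positivity) hγ1 (by omega)
      calc _ ≤ (2 * γ) ^ (m - a) * 1 := mul_le_mul_of_nonneg_left e1 (by positivity)
        _ ≤ _ := by linarith
    · intro a e he hea ham
      have he' : (1 : ℝ) ≤ e := by exact_mod_cast he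
      have hea' : (e : ℝ) + 1 ≤ a := by exact_mod_cast hea
      -- For different indices the extra agreement e + 1 ≤ a gains a full factor 1/n, which cancels
      -- the at most ηn indices.
      have e1 : (n : ℝ) ^ (c + (e - a) - ε * e) ≤ (n : ℝ) ^ (-1 : ℝ) :=
        Real.rpow_le_rpow_of_exponent_le hn1 (by nlinarith)
      have e2 : (2 * γ) ^ (m - a) ≤ 1 := pow_le_one₀ (by positivity) hγ1
      have e3 : (w : ℝ) ^ (m - a) * p ^ (m + ρ - e) ≤ (n : ℝ)⁻¹ := by
        refine (hmix a e (by omega) ham).trans ?_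
        rw [← Real.rpow_neg_one]
        calc _ ≤ 1 * (n : ℝ) ^ (c + (e - a) - ε * e) :=
              mul_le_mul_of_nonneg_right e2 (by positivity)
          _ ≤ _ := by linarith
      have hSk : (#S : ℝ) ≤ η * n := by
        have : #S ≤ k := by simpa using card_le_univ S
        exact le_trans (by exact_mod_cast this) hk
      have hη0 : 0 ≤ η * n := le_trans (by positivity) hSk
      calc _ ≤ η * n * (n : ℝ)⁻¹ := mul_le_mul hSk e3 (by positivity) hη0
        _ = η := by field_simp
        _ ≤ _ := hη
  · refine Real.exp_le_exp.2 (neg_le_neg ?_)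
    rw [le_div_iff₀ (by positivity)]
    have e1 : (n : ℝ) ^ c = (n : ℝ) ^ (c / 2) * (n : ℝ) ^ (c / 2) := by
      rw [← Real.rpow_add hn0]; congr 1; ring
    rw [e1] at hκlow
    have e2 : γ ^ m / (4 * m) * (n : ℝ) ^ (c / 2) * (2 * m * (n : ℝ) ^ (c / 2)) =
        γ ^ m * ((n : ℝ) ^ (c / 2) * (n : ℝ) ^ (c / 2)) / 2 := by
      field_simp
      ring
    rw [e2]
    linarith

end Robust

/-! ### The greedy procedure serves every index when the edge set is robust. -/

section Greedy

variable {V : Type*} [DecidableEq V] {ρ m k T : ℕ}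

/-- The vertex `y` is used by a sequence with index less than `i`. -/
def IsUsed (res : Fin k → Option (ℕ × (Fin m → V))) (i : Fin k) (y : V) : Prop :=
  ∃ i' < i, ∃ t x, res i' = some (t, x) ∧ ∃ j, x j = y

/-- The vertices `x` in tier `t` are unused before step `i`, and yield chosen windows. -/
def IsFreeChoice (ρ : ℕ) (Y : ℕ → Fin m → Finset V) (F : Fin k → (Fin m → V) → ℕ → V)
    (E : Finset (Finset V)) (res : Fin k → Option (ℕ × (Fin m → V))) (i : Fin k) (t : ℕ)
    (x : Fin m → V) : Prop :=
  (∀ j, x j ∈ Y t j ∧ ¬ IsUsed res i (x j)) ∧ windows (ρ + 1) (m + ρ) (F i x) ⊆ E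

/-- Each step makes a free choice in the first of `T` tiers where there is one, if any. -/
def IsGreedy (ρ T : ℕ) (Y : ℕ → Fin m → Finset V) (F : Fin k → (Fin m → V) → ℕ → V)
    (E : Finset (Finset V)) (res : Fin k → Option (ℕ × (Fin m → V))) : Prop :=
  ∀ i, (∀ t x, res i = some (t, x) → t < T ∧ IsFreeChoice ρ Y F E res i t x) ∧
    ∀ t' < T, (∀ t x, res i = some (t, x) → t' < t) → ∀ x, ¬ IsFreeChoice ρ Y F E res i t' x

/-- The number of indices still unserved after a tier shrinks by the factor `b`. Otherwise
robustness, applied to the unserved indices and the vertices used in that tier, yields a free choice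
that the procedure would have taken. After `T` tiers fewer than k / b^T < 1 indices remain. -/
theorem IsGreedy.exists_eq_some {Y : ℕ → Fin m → Finset V} {F : Fin k → (Fin m → V) → ℕ → V}
    {E : Finset (Finset V)} {res : Fin k → Option (ℕ × (Fin m → V))} {b : ℝ}
    (hres : IsGreedy ρ T Y F E res) (hE : IsRobust ρ m T b Y F E)
    (hY : ∀ t t' j j' y, y ∈ Y t j → y ∈ Y t' j' → t = t') (hm : 1 ≤ m) (hb : 0 < b)
    (hk : k < b ^ T) (i : Fin k) : ∃ t x, res i = some (t, x) := by
  classical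
  set R : ℕ → Finset (Fin k) := fun t => {i | ∀ t' x, res i = some (t', x) → t ≤ t'} with hR
  have hmem : ∀ t i, i ∈ R t ↔ ∀ t' x, res i = some (t', x) → t ≤ t' := fun t i => by simp [hR]
  have hm0 : (0 : ℝ) < m := by exact_mod_cast hm
  have hstep : ∀ t < T, #(R (t + 1)) * b ≤ #(R t) := by
    intro t ht
    rcases (R (t + 1)).eq_empty_or_nonempty with hemp | hne
    · rw [hemp]; simp
    -- All vertices ever used in tier `t`, including those used after the index under consideration.
    -- This makes `Z` independent of the order of the steps, and more than what is forbidden at any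
    -- step.
    set Z : Finset V := (R t).biUnion fun i => match res i with
      | some (t', x) => if t' = t then univ.image x else ∅
      | none => ∅ with hZ
    have hZcard : #Z ≤ #(R t) * m := by
      refine card_biUnion_le_card_mul _ _ _ fun i _ => ?_
      rcases res i with _ | ⟨t', x⟩
      · simp
      · dsimp only
        split_ifs
        · exact card_image_le.trans (by simp)
        · simp
    have hZmem : ∀ i' x, res i' = some (t, x) → ∀ j, x j ∈ Z := by
      intro i' x hx j
      refine mem_biUnion.2 ⟨i', (hmem _ _).2 fun t' x' h => ?_, by simp [hx]⟩
      rw [hx] at h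
      simp only [Option.some.injEq, Prod.mk.injEq] at h
      omega
    have hRk : #(R t) ≤ k := by simpa using card_le_univ (R t)
    have hlarge : ¬ (#Z : ℝ) ≤ m * b * #(R (t + 1)) := by
      intro hle
      obtain ⟨i, hi, x, hx, hw⟩ := hE t ht Z _ hne hle (by
        rw [Fintype.card_fin, mul_comm m]
        exact hZcard.trans (Nat.mul_le_mul_right _ hRk))
      rw [Fintype.mem_piFinset] at hx
      refine (hres i).2 t ht (fun t' x' h => (hmem _ _).1 hi t' x' h) x ⟨fun j => ?_, hw⟩
      obtain ⟨h1, h2⟩ := mem_sdiff.1 (hx j)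
      refine ⟨h1, ?_⟩
      -- Tiers are disjoint, so a vertex of tier `t` can only have been used by a path through tier
      -- `t`. Such vertices were all put into `Z`.
      rintro ⟨i', -, t', x', he, j', hj'⟩
      have h3 := (((hres i').1 t' x' he).2.1 j').1
      rw [hj'] at h3
      have := hY _ _ _ _ _ h1 h3
      subst this
      exact h2 (hj' ▸ hZmem i' x' he j')
    have h4 : (#Z : ℝ) ≤ #(R t) * m := by exact_mod_cast hZcard
    push Not at hlarge
    have h5 : m * (#(R (t + 1)) * b) ≤ m * (#(R t) : ℝ) := by linarith
    exact le_of_mul_le_mul_left h5 hm0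
  have hind : ∀ t ≤ T, #(R t) * b ^ t ≤ k := by
    intro t
    induction t with
    | zero =>
      intro _
      have : #(R 0) ≤ k := by simpa using card_le_univ (R 0)
      simpa using this
    | succ t ih =>
      intro ht
      refine le_trans ?_ (ih (by omega))
      rw [pow_succ', ← mul_assoc]
      exact mul_le_mul_of_nonneg_right (hstep t (by omega)) (by positivity)
  have hT := hind T le_rfl
  have hempty : #(R T) = 0 := by
    by_contra h
    have h1 : (1 : ℝ) ≤ #(R T) := by exact_mod_cast Nat.one_le_iff_ne_zero.2 h
    nlinarith [pow_pos hb T]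
  by_contra hnone
  push Not at hnone
  have : i ∈ R T := (hmem _ _).2 fun t' x h => absurd h (hnone t' x)
  rw [card_eq_zero] at hempty
  simp [hempty] at this

end Greedy

/-! ### Rules for running time and correctness of programs, and the test of a single candidate path.
-/

namespace RAM

variable {inp : List ℕ}

/-- Started in `s`, the program `c` halts after at most `N` steps in a state with property `Q`. -/
def Runs (inp : List ℕ) (c : Cmd) (s : State) (N : ℕ) (Q : State → Prop) : Prop :=
  ∃ t s', Exec inp c s t s' ∧ t ≤ N ∧ Q s'

section Rules

variable {c d : Cmd} {s : State} {N N' : ℕ} {Q Q' : State → Prop} {x y z a : ℕ}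

lemma Runs.mono (h : Runs inp c s N Q) (hN : N ≤ N') (hQ : ∀ s', Q s' → Q' s') :
    Runs inp c s N' Q' := by
  obtain ⟨t, s', h1, h2, h3⟩ := h
  exact ⟨t, s', h1, h2.trans hN, hQ _ h3⟩

lemma Runs.of_le (h : Runs inp c s N Q) (hN : N ≤ N') : Runs inp c s N' Q :=
  h.mono hN fun _ => id

lemma Runs.seq (h : Runs inp c s N fun s' => Runs inp d s' N' Q) :
    Runs inp (.seq c d) s (N + N') Q := by
  obtain ⟨t, s', h1, h2, t', s'', h3, h4, h5⟩ := h
  exact ⟨_, s'', .seq h1 h3, by omega, h5⟩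

lemma Runs.skip (h : Q s) : Runs inp .skip s 1 Q := ⟨1, _, .skip s, le_rfl, h⟩

lemma Runs.const (h : Q (s.set x a)) : Runs inp (.const x a) s 1 Q :=
  ⟨1, _, .const s x a, le_rfl, h⟩

lemma Runs.add (h : Q (s.set x (s.reg y + s.reg z))) : Runs inp (.add x y z) s 1 Q :=
  ⟨1, _, .add s x y z, le_rfl, h⟩

lemma Runs.sub (h : Q (s.set x (s.reg y - s.reg z))) : Runs inp (.sub x y z) s 1 Q :=
  ⟨1, _, .sub s x y z, le_rfl, h⟩

lemma Runs.read (h : Q (s.set x (inp.getD (s.reg y) 0))) : Runs inp (.read x y) s 1 Q :=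
  ⟨1, _, .read s x y, le_rfl, h⟩

lemma Runs.load (h : Q (s.set x (s.mem (s.reg y)))) : Runs inp (.load x y) s 1 Q :=
  ⟨1, _, .load s x y, le_rfl, h⟩

lemma Runs.store (h : Q { s with mem := Function.update s.mem (s.reg x) (s.reg y) }) :
    Runs inp (.store x y) s 1 Q := ⟨1, _, .store s x y, le_rfl, h⟩

lemma Runs.write (h : Q { s with out := s.out ++ [s.reg x] }) : Runs inp (.write x) s 1 Q :=
  ⟨1, _, .write s x, le_rfl, h⟩

lemma Runs.ite (hc : s.reg x ≠ 0 → Runs inp c s N Q) (hd : s.reg x = 0 → Runs inp d s N Q) :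
    Runs inp (.ite x c d) s (N + 1) Q := by
  by_cases h : s.reg x = 0
  · obtain ⟨t, s', h1, h2, h3⟩ := hd h
    exact ⟨_, s', .ite_false h h1, by omega, h3⟩
  · obtain ⟨t, s', h1, h2, h3⟩ := hc h
    exact ⟨_, s', .ite_true h h1, by omega, h3⟩

/-- The rule for a simple command followed by `d`. -/
lemma Runs.cons (h : Runs inp c s 1 fun s' => Runs inp d s' N Q) :
    Runs inp (.seq c d) s (N + 1) Q :=
  h.seq.mono (by omega) fun _ => id

/-- The index `f` of the invariant is fuel: an upper bound for the number of iterations left. Since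
`hstep` forces it to be positive whenever the body is entered, a loop with no fuel has already
reached its exit condition. -/
lemma Runs.loop (Inv : ℕ → State → Prop) (hstep : ∀ f s, Inv f s → s.reg x ≠ 0 →
    ∃ f', f = f' + 1 ∧ Runs inp c s N (Inv f')) (f : ℕ) (s : State) (h : Inv f s) :
    Runs inp (.loop x c) s (f * (N + 1) + 1) fun s' => s'.reg x = 0 ∧ ∃ f', Inv f' s' := by
  induction f generalizing s with
  | zero =>
    by_cases hx : s.reg x = 0
    · exact ⟨1, s, .loop_done hx, by omega, hx, 0, h⟩
    · obtain ⟨f', h0, -⟩ := hstep 0 s h hx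
      omega
  | succ f ih =>
    by_cases hx : s.reg x = 0
    · exact ⟨1, s, .loop_done hx, by omega, hx, _, h⟩
    · obtain ⟨f', h0, t, s', h1, h2, h3⟩ := hstep _ s h hx
      obtain rfl : f' = f := by omega
      obtain ⟨t', s'', h4, h5, h6⟩ := ih s' h3
      exact ⟨_, s'', .loop_step hx h1 h4, by rw [Nat.succ_mul]; omega, h6⟩

/-- The commands `f 0, …, f (d - 1)` in this order. -/
def iter (f : ℕ → Cmd) : ℕ → Cmd
  | 0 => .skip
  | d + 1 => .seq (iter f d) (f d)

lemma Runs.iter {f : ℕ → Cmd} (Inv : ℕ → State → Prop) (d : ℕ)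
    (hstep : ∀ j < d, ∀ s, Inv j s → Runs inp (f j) s N (Inv (j + 1))) (h : Inv 0 s) :
    Runs inp (RAM.iter f d) s (d * N + 1) (Inv d) := by
  induction d with
  | zero => exact (Runs.skip h).mono (by omega) fun _ => id
  | succ d ih =>
    refine ((ih fun j hj => hstep j (by omega)).mono le_rfl fun s' hs' => ?_).seq.mono
      (N := (d * N + 1) + N) (by rw [Nat.succ_mul]; omega) fun _ => id
    exact hstep d (by omega) s' hs'

end Rules

@[simp] lemma State.set_reg (s : State) (x a y : ℕ) :
    (s.set x a).reg y = if y = x then a else s.reg y := by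
  simp [State.set, Function.update_apply]

@[simp] lemma State.set_mem (s : State) (x a : ℕ) : (s.set x a).mem = s.mem := rfl

@[simp] lemma State.set_out (s : State) (x a : ℕ) : (s.set x a).out = s.out := rfl

/-- The states agree except for registers with numbers less than `d`. -/
def SameFrom (d : ℕ) (s s' : State) : Prop :=
  (∀ y, d ≤ y → s'.reg y = s.reg y) ∧ s'.mem = s.mem ∧ s'.out = s.out

lemma SameFrom.refl (d : ℕ) (s : State) : SameFrom d s s := ⟨fun _ _ => rfl, rfl, rfl⟩

lemma SameFrom.trans {d : ℕ} {s s' s'' : State} (h : SameFrom d s s') (h' : SameFrom d s' s'') :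
    SameFrom d s s'' :=
  ⟨fun y hy => (h'.1 y hy).trans (h.1 y hy), h'.2.1.trans h.2.1, h'.2.2.trans h.2.2⟩

lemma SameFrom.mono {d d' : ℕ} {s s' : State} (h : SameFrom d s s') (hd : d ≤ d') :
    SameFrom d' s s' :=
  ⟨fun y hy => h.1 y (hd.trans hy), h.2⟩

lemma SameFrom.set {d x a : ℕ} {s s' : State} (h : SameFrom d s s') (hx : x < d) :
    SameFrom d s (s'.set x a) :=
  ⟨fun y hy => by rw [State.set_reg, if_neg (by omega), h.1 y hy], h.2⟩

/-! Registers `0, …, 9` are scratch, `10` holds the result of a check, `11` the number `n` of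
vertices, `12` the number `k`, `13` the position of the adjacency array, `14` and `15` those of the
current tuples, `17` whether a path has been found, `18` the number of rounds left. The terms of
the path are in the registers from `20` on, followed by the control registers of the search. -/

/-- `R[0] := R[0] * R[11] + R[y]` -/
def mulAdd (y : ℕ) : Cmd :=
  .seq (.const 4 0) <| .seq (.add 2 11 4) <| .seq (.const 1 0) <| .seq (.const 3 1) <|
    .seq (.loop 2 (.seq (.add 1 1 0) (.sub 2 2 3))) (.add 0 1 y)

lemma runs_mulAdd (s : State) {y : ℕ} (hy : 10 ≤ y) :
    Runs inp (mulAdd y) s (s.reg 11 * 3 + 6) fun s' =>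
      s'.reg 0 = s.reg 0 * s.reg 11 + s.reg y ∧ SameFrom 10 s s' := by
  refine Runs.cons (.const (Runs.cons (.add (Runs.cons (.const (Runs.cons (.const ?_)))))))
  refine Runs.of_le (N := s.reg 11 * 3 + 1 + 1) (Runs.seq ?_) (by omega)
  refine (Runs.loop (N := 2) (fun f s' => s'.reg 2 = f ∧ s'.reg 3 = 1 ∧ s'.reg 0 = s.reg 0 ∧
    s'.reg 1 + f * s.reg 0 = s.reg 11 * s.reg 0 ∧ SameFrom 10 s s') ?_ (s.reg 11) _ ?_).mono
    le_rfl ?_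
  · rintro f s' ⟨h2, h3, h0, h1, hs⟩ hne
    rw [h2] at hne
    obtain ⟨f', rfl⟩ := Nat.exists_eq_succ_of_ne_zero hne
    refine ⟨f', rfl, .cons (.add (.sub ?_))⟩
    refine ⟨by simp [h2, h3], by simp [h3], by simp [h0], ?_,
      (hs.set (by norm_num)).set (by norm_num)⟩
    simp [h0]
    rw [← h1, Nat.succ_mul]; ring
  · refine ⟨by simp, by simp, by simp, by simp, ?_⟩
    exact ((((SameFrom.refl _ _).set (by norm_num)).set (by norm_num)).set (by norm_num)).set
      (by norm_num)
  · rintro s' ⟨hx, f, h2, h3, h0, h1, hs⟩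
    refine Runs.add ?_
    refine ⟨?_, hs.set (by norm_num)⟩
    rw [h2] at hx
    subst hx
    simp only [State.set_reg, if_true, hs.1 y hy]
    rw [show s'.reg 1 = s.reg 11 * s.reg 0 by simpa using h1]
    ring

/-- `R[0]` becomes the number with base `R[11]` digits `R[y], …, R[y + d - 1]`. -/
def horner : ℕ → ℕ → Cmd
  | 0, _ => .const 0 0
  | d + 1, y => .seq (horner d (y + 1)) (mulAdd y)

lemma runs_horner (d : ℕ) (s : State) {y : ℕ} (hy : 10 ≤ y) :
    Runs inp (horner d y) s (d * (s.reg 11 * 3 + 6) + 1) fun s' =>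
      s'.reg 0 = ∑ j ∈ range d, s.reg (y + j) * s.reg 11 ^ j ∧ SameFrom 10 s s' := by
  induction d generalizing y with
  | zero =>
    refine Runs.of_le (N := 1) (Runs.const ?_) (by omega)
    exact ⟨by simp, (SameFrom.refl _ _).set (by norm_num)⟩
  | succ d ih =>
    refine ((ih (y := y + 1) (by omega)).mono le_rfl fun s' hs' => ?_).seq.mono
      (N := (d * (s.reg 11 * 3 + 6) + 1) + (s.reg 11 * 3 + 6))
      (by rw [Nat.succ_mul]; omega) fun _ => id
    obtain ⟨h0, hs⟩ := hs'
    refine (runs_mulAdd s' hy).mono (by rw [hs.1 11 (by norm_num)]) fun s'' hs'' => ?_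
    obtain ⟨h0', hs'⟩ := hs''
    refine ⟨?_, hs.trans hs'⟩
    rw [h0', h0, hs.1 11 (by norm_num), hs.1 y hy, sum_range_succ', sum_mul]
    congr 1
    · refine sum_congr rfl fun j _ => ?_
      rw [show y + 1 + j = y + (j + 1) by omega, pow_succ, mul_assoc]
    · simp

/-- The command `c` sets `R[10] := 0` if `φ` does not hold, and leaves everything else in place. -/
structure IsCheck (inp : List ℕ) (c : Cmd) (N : ℕ → ℕ) (φ : State → Prop) : Prop where
  run : ∀ s, Runs inp c s (N (s.reg 11)) fun s' =>
    (s'.reg 10 ≠ 0 ↔ s.reg 10 ≠ 0 ∧ φ s) ∧ SameFrom 11 s s'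
  stable : ∀ s s', SameFrom 11 s s' → (φ s' ↔ φ s)

/-- A check may only clear register 10 and spoil scratch registers, on which no tested condition
depends. A sequence of checks therefore computes the conjunction of the conditions at the start. -/
lemma IsCheck.iter {f : ℕ → Cmd} {N : ℕ → ℕ} {φ : ℕ → State → Prop} (d : ℕ)
    (h : ∀ j < d, IsCheck inp (f j) N (φ j)) :
    IsCheck inp (RAM.iter f d) (fun n => d * N n + 1) (fun s => ∀ j < d, φ j s) where
  run s := by
    refine (Runs.iter (fun j s' => (s'.reg 10 ≠ 0 ↔ s.reg 10 ≠ 0 ∧ ∀ i < j, φ i s) ∧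
      SameFrom 11 s s') d ?_ ⟨by simp, .refl _ _⟩)
    rintro j hj s' ⟨h1, h2⟩
    refine ((h j hj).run s').mono (by rw [h2.1 11 le_rfl]) fun s'' hs'' => ?_
    obtain ⟨h3, h4⟩ := hs''
    refine ⟨?_, h2.trans h4⟩
    rw [h3, h1, (h j hj).stable _ _ h2, and_assoc]
    refine and_congr_right fun _ => ⟨fun hh i hi => ?_, fun hh => ⟨fun i hi => hh i (by omega),
      hh j (by omega)⟩⟩
    rcases Nat.lt_succ_iff_lt_or_eq.1 hi with h5 | rfl
    · exact hh.1 i h5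
    · exact hh.2
  stable s s' hs := forall₂_congr fun j hj => (h j hj).stable s s' hs

/-- Checks whether the window of `ρ + 1` terms from position `e` on is an edge. -/
def edgeCheck (ρ e : ℕ) : Cmd :=
  .seq (horner (ρ + 1) (20 + e)) <| .seq (.add 0 0 13) <| .seq (.read 0 0) <|
    .ite 0 .skip (.const 10 0)

lemma isCheck_edgeCheck (ρ e : ℕ) :
    IsCheck inp (edgeCheck ρ e) (fun n => (ρ + 1) * (n * 3 + 6) + 5) (fun s =>
      inp.getD (∑ j ∈ range (ρ + 1), s.reg (20 + (e + j)) * s.reg 11 ^ j + s.reg 13) 0 ≠ 0) where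
  run s := by
    refine ((runs_horner (ρ + 1) s (y := 20 + e) (by omega)).mono le_rfl
      fun s' hs' => ?_).seq.mono (N := ((ρ + 1) * (s.reg 11 * 3 + 6) + 1) + 4) (by omega)
      fun _ => id
    obtain ⟨h0, hs⟩ := hs'
    refine .cons (.add (.cons (.read (.ite (fun h => .skip ?_) (fun h => .const ?_)))))
    all_goals
      simp only [State.set_reg, if_true, h0, hs.1 13 (by norm_num), add_assoc] at h
    · refine ⟨?_, ?_⟩
      · simp only [State.set_reg, hs.1 10 le_rfl]
        exact (and_iff_left h).symm
      · exact ((hs.mono (by norm_num)).set (by norm_num)).set (by norm_num)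
    · refine ⟨⟨fun hh => absurd (by simp) hh, fun hh => absurd h hh.2⟩, ?_⟩
      exact (((hs.mono (by norm_num)).set (by norm_num)).set
        (by norm_num)).set (by norm_num)
  stable s s' hs := by
    have h : ∀ j, s'.reg (20 + (e + j)) = s.reg (20 + (e + j)) := fun j => hs.1 _ (by omega)
    simp only [h, hs.1 11 le_rfl, hs.1 13 (by norm_num)]

/-- Checks whether `M[R[y]] = a`. -/
def classCheck (y a : ℕ) : Cmd :=
  .seq (.load 0 y) <| .seq (.const 1 a) <| .seq (.sub 2 0 1) <| .seq (.sub 3 1 0) <|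
    .seq (.add 2 2 3) <| .ite 2 (.const 10 0) .skip

lemma isCheck_classCheck {y : ℕ} (hy : 11 ≤ y) (a : ℕ) :
    IsCheck inp (classCheck y a) (fun _ => 7) (fun s => s.mem (s.reg y) = a) where
  run s := by
    refine .cons (.load (.cons (.const (.cons (.sub (.cons (.sub (.cons (.add (.ite
      (fun h => .const ?_) (fun h => .skip ?_)))))))))))
    all_goals simp at h
    · refine ⟨?_, ?_⟩
      · simp; omega
      · exact ((((((SameFrom.refl _ _).set (by norm_num)).set (by norm_num)).set
          (by norm_num)).set (by norm_num)).set (by norm_num)).set (by norm_num)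
    · refine ⟨?_, ?_⟩
      · simp; omega
      · exact (((((SameFrom.refl _ _).set (by norm_num)).set (by norm_num)).set
          (by norm_num)).set (by norm_num)).set (by norm_num)
  stable s s' hs := by rw [hs.1 y hy, hs.2.1]

/-- The sequence `q` has inner terms of the classes for tier `t`, and all its windows are edges. -/
def IsChoice (inp : List ℕ) (ρ m n base : ℕ) (mem : ℕ → ℕ) (t : ℕ) (q : ℕ → ℕ) : Prop :=
  (∀ j < m, mem (q (ρ + j)) = t * m + j + 1) ∧
    ∀ e < m + ρ, inp.getD (∑ j ∈ range (ρ + 1), q (e + j) * n ^ j + base) 0 ≠ 0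

lemma IsChoice.congr {ρ m n base : ℕ} {mem : ℕ → ℕ} {t : ℕ} {q q' : ℕ → ℕ}
    (h : ∀ e < m + 2 * ρ, q e = q' e) (hq : IsChoice inp ρ m n base mem t q) :
    IsChoice inp ρ m n base mem t q' := by
  refine ⟨fun j hj => ?_, fun e he => ?_⟩
  · rw [← h _ (by omega)]; exact hq.1 j hj
  · rw [sum_congr rfl fun j hj => by rw [← h (e + j) (by rw [mem_range] at hj; omega)]]
    exact hq.2 e he

/-- Checks whether the terms of the sequence form a choice in tier `t`. -/
def choiceCheck (ρ m t : ℕ) : Cmd :=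
  .seq (.const 10 1) <| .seq (iter (fun j => classCheck (20 + (ρ + j)) (t * m + j + 1)) m)
    (iter (edgeCheck ρ) (m + ρ))

/-- A bound for the running time of a check. -/
def checkTime (ρ m n : ℕ) : ℕ := (m * 7 + 1) + ((m + ρ) * ((ρ + 1) * (n * 3 + 6) + 5) + 1) + 1

lemma runs_choiceCheck (ρ m t : ℕ) (s : State) :
    Runs inp (choiceCheck ρ m t) s (checkTime ρ m (s.reg 11)) fun s' =>
      (s'.reg 10 ≠ 0 ↔ IsChoice inp ρ m (s.reg 11) (s.reg 13) s.mem t fun e => s.reg (20 + e)) ∧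
        SameFrom 11 s s' := by
  have h1 := IsCheck.iter (inp := inp) m fun j (_ : j < m) =>
    isCheck_classCheck (inp := inp) (y := 20 + (ρ + j)) (by omega) (t * m + j + 1)
  have h2 := IsCheck.iter (inp := inp) (m + ρ) fun e (_ : e < m + ρ) =>
    isCheck_edgeCheck (inp := inp) ρ e
  refine .cons (.const (Runs.seq ((h1.run _).mono (le_of_eq (by simp)) fun s' hs' => ?_)))
  obtain ⟨h3, h4⟩ := hs'
  have h0 : SameFrom 11 s (s.set 10 1) := (SameFrom.refl _ _).set (by norm_num)
  have h5 := h0.trans h4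
  refine (h2.run s').mono (le_of_eq (by rw [h5.1 11 le_rfl])) fun s'' hs'' => ?_
  obtain ⟨h6, h7⟩ := hs''
  refine ⟨?_, h5.trans h7⟩
  rw [h6, h3, h2.stable _ _ h5, h1.stable _ _ h0]
  simp [IsChoice]

end RAM

/-! ### Exhaustive search for a path, and one round of the algorithm. -/

namespace RAM

variable {inp : List ℕ}

/-- Searches for the first `d` inner terms of a choice in tier `t`, given all the other terms. -/
def search (ρ m t : ℕ) : ℕ → Cmd
  | 0 => .seq (choiceCheck ρ m t) (.ite 10 (.const 17 1) .skip)
  | d + 1 => .seq (.const (20 + (ρ + d)) 0) <| .seq (.const 4 0) <|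
      .seq (.add (20 + 2 * ρ + m + d) 11 4) <| .loop (20 + 2 * ρ + m + d) <|
      .seq (search ρ m t d) <| .ite 17 (.const (20 + 2 * ρ + m + d) 0) <|
        .seq (.const 3 1) <| .seq (.add (20 + (ρ + d)) (20 + (ρ + d)) 3) <|
          .sub (20 + 2 * ρ + m + d) 11 (20 + (ρ + d))

/-- A bound for the running time of a search. -/
def searchTime (ρ m n : ℕ) : ℕ → ℕ
  | 0 => checkTime ρ m n + 2
  | d + 1 => n * (searchTime ρ m n d + 5) + 4

/-- What a search for the first `d` inner terms leaves in place. -/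
def SearchFrame (ρ m d : ℕ) (s s' : State) : Prop :=
  s'.mem = s.mem ∧ s'.out = s.out ∧ ∀ y, 11 ≤ y → y ≠ 17 → (y < 20 + ρ ∨ 20 + ρ + d ≤ y) →
    (y < 20 + 2 * ρ + m ∨ 20 + 2 * ρ + m + d ≤ y) → s'.reg y = s.reg y

lemma SearchFrame.trans {ρ m d : ℕ} {s s' s'' : State} (h : SearchFrame ρ m d s s')
    (h' : SearchFrame ρ m d s' s'') : SearchFrame ρ m d s s'' :=
  ⟨h'.1.trans h.1, h'.2.1.trans h.2.1,
    fun y h1 h2 h3 h4 => (h'.2.2 y h1 h2 h3 h4).trans (h.2.2 y h1 h2 h3 h4)⟩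

lemma SearchFrame.mono {ρ m d d' : ℕ} {s s' : State} (h : SearchFrame ρ m d s s') (hd : d ≤ d') :
    SearchFrame ρ m d' s s' :=
  ⟨h.1, h.2.1, fun y h1 h2 h3 h4 => h.2.2 y h1 h2 (by omega) (by omega)⟩

lemma SearchFrame.set {ρ m d x a : ℕ} {s s' : State} (h : SearchFrame ρ m d s s')
    (hx : x < 11 ∨ x = 17 ∨ (20 + ρ ≤ x ∧ x < 20 + ρ + d) ∨
      (20 + 2 * ρ + m ≤ x ∧ x < 20 + 2 * ρ + m + d)) : SearchFrame ρ m d s (s'.set x a) :=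
  ⟨h.1, h.2.1, fun y h1 h2 h3 h4 => by
    rw [State.set_reg, if_neg (by omega)]; exact h.2.2 y h1 h2 h3 h4⟩

lemma SearchFrame.refl (ρ m d : ℕ) (s : State) : SearchFrame ρ m d s s :=
  ⟨rfl, rfl, fun _ _ _ _ _ => rfl⟩

/-- The result of a search for the first `d` inner terms of a choice in tier `t`. -/
def SearchResult (inp : List ℕ) (ρ m t d : ℕ) (s s' : State) : Prop :=
  (s'.reg 17 ≠ 0 ∧ IsChoice inp ρ m (s.reg 11) (s.reg 13) s.mem t (fun e => s'.reg (20 + e)) ∧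
      ∀ j < d, s'.reg (20 + (ρ + j)) < s.reg 11) ∨
    (s'.reg 17 = 0 ∧ ∀ q : ℕ → ℕ,
      (∀ e < m + 2 * ρ, e < ρ ∨ ρ + d ≤ e → q e = s.reg (20 + e)) →
      (∀ j < d, q (ρ + j) < s.reg 11) → ¬ IsChoice inp ρ m (s.reg 11) (s.reg 13) s.mem t q)

/-- Nested loops, one for each inner term. Level d + 1 runs its term through 0, …, n - 1 and calls
level d for each value, which is why the time is polynomial of degree depending on d. -/
lemma runs_search (ρ m t d : ℕ) (hd : d ≤ m) (s : State) (h17 : s.reg 17 = 0) :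
    Runs inp (search ρ m t d) s (searchTime ρ m (s.reg 11) d) fun s' =>
      SearchFrame ρ m d s s' ∧ SearchResult inp ρ m t d s s' := by
  induction d generalizing s with
  | zero =>
    refine Runs.seq (N := checkTime ρ m (s.reg 11)) (N' := 2)
      ((runs_choiceCheck ρ m t s).mono le_rfl ?_)
    rintro s' ⟨h1, h2⟩
    have hfr : SearchFrame ρ m 0 s s' := ⟨h2.2.1, h2.2.2, fun y hy _ _ _ => h2.1 y hy⟩
    refine .ite (fun h => .const ?_) (fun h => .skip ?_)
    · refine ⟨hfr.set (by omega), Or.inl ⟨by simp, ?_, by simp⟩⟩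
      refine (h1.1 h).congr fun e _ => ?_
      rw [State.set_reg, if_neg (by omega), h2.1 _ (by omega)]
    · refine ⟨hfr, Or.inr ⟨(h2.1 17 (by norm_num)).trans h17, fun q hq _ hc => ?_⟩⟩
      exact h1.2 (hc.congr fun e he => hq e he (by omega)) h
  | succ d ih =>
    set n := s.reg 11 with hn
    set idx := 20 + (ρ + d) with hidx
    set ctrl := 20 + 2 * ρ + m + d with hctrl
    -- Either a choice has been found and the control register is zeroed to leave the loop, or all
    -- smaller values of the current term have been refuted and the control register counts the
    -- values left.
    let Inv : ℕ → State → Prop := fun f s' => SearchFrame ρ m (d + 1) s s' ∧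
      ((s'.reg 17 ≠ 0 ∧ s'.reg ctrl = 0 ∧
        IsChoice inp ρ m n (s.reg 13) s.mem t (fun e => s'.reg (20 + e)) ∧
        ∀ j < d + 1, s'.reg (20 + (ρ + j)) < n) ∨
      (s'.reg 17 = 0 ∧ s'.reg ctrl = f ∧ f + s'.reg idx = n ∧ ∀ q : ℕ → ℕ,
        (∀ e < m + 2 * ρ, e < ρ ∨ ρ + (d + 1) ≤ e → q e = s.reg (20 + e)) →
        (∀ j < d, q (ρ + j) < n) → q (ρ + d) < s'.reg idx →
          ¬ IsChoice inp ρ m n (s.reg 13) s.mem t q))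
    have hloop := Runs.loop (inp := inp) (x := ctrl) (N := searchTime ρ m n d + 4)
      (c := .seq (search ρ m t d) <| .ite 17 (.const ctrl 0) <|
        .seq (.const 3 1) <| .seq (.add idx idx 3) <| .sub ctrl 11 idx) Inv ?_
    · refine Runs.of_le (N := n * (searchTime ρ m n d + 4 + 1) + 1 + 1 + 1 + 1) ?_
        le_rfl
      refine .cons (.const (.cons (.const (.cons (.add ?_)))))
      refine (hloop n _ ⟨?_, Or.inr ⟨?_, ?_, ?_, ?_⟩⟩).mono le_rfl ?_
      · exact (((SearchFrame.refl _ _ _ _).set (by omega)).set (by omega)).set (by omega)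
      · simp only [State.set_reg]
        rw [if_neg (by omega), if_neg (by omega), if_neg (by omega), h17]
      · simp [hn]
        rw [if_pos rfl, if_neg (by omega)]
      · simp only [State.set_reg]
        rw [if_neg (by omega), if_neg (by omega), if_pos rfl]
        rfl
      · intro q _ _ hlt
        simp only [State.set_reg] at hlt
        rw [if_neg (by omega), if_neg (by omega), if_pos rfl] at hlt
        omega
      · rintro s' ⟨hx, f, hfr, ⟨h1, h2, h3, h4⟩ | ⟨h1, h2, h3, h4⟩⟩
        · exact ⟨hfr, Or.inl ⟨h1, h3, h4⟩⟩
        · refine ⟨hfr, Or.inr ⟨h1, fun q hq hb => h4 q hq (fun j hj => hb j (by omega)) ?_⟩⟩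
          have := hb d (by omega)
          omega
    · rintro f s' ⟨hfr, ⟨h1, h2, h3, h4⟩ | ⟨h1, h2, h3, h4⟩⟩ hne
      · exact absurd h2 hne
      rw [h2] at hne
      obtain ⟨f', rfl⟩ := Nat.exists_eq_succ_of_ne_zero hne
      refine ⟨f', rfl, Runs.seq (N := searchTime ρ m n d) (N' := 4) ?_⟩
      have h11 : s'.reg 11 = n := hfr.2.2 11 le_rfl (by norm_num) (by omega) (by omega)
      have h13 : s'.reg 13 = s.reg 13 :=
        hfr.2.2 13 (by norm_num) (by norm_num) (by omega) (by omega)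
      refine (ih (by omega) s' h1).mono (by rw [h11]) ?_
      rintro s'' ⟨hfr', hres⟩
      have hfr2 := hfr.trans (hfr'.mono (by omega : d ≤ d + 1))
      have hidx' : s''.reg idx = s'.reg idx :=
        hfr'.2.2 idx (by omega) (by omega) (by omega) (by omega)
      rcases hres with ⟨g1, g2, g3⟩ | ⟨g1, g2⟩
      · refine .ite (fun _ => .of_le (.const ⟨hfr2.set (by omega), Or.inl ⟨?_, ?_, ?_, ?_⟩⟩)
          (by norm_num : 1 ≤ 3)) (fun h => absurd h g1)
        · simpa [show ¬ 17 = ctrl by omega] using g1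
        · simp
        · rw [h11, h13, hfr.1] at g2
          exact g2.congr fun e he => by rw [State.set_reg, if_neg (by omega)]
        · intro j hj
          rw [State.set_reg, if_neg (by omega)]
          rcases Nat.lt_succ_iff_lt_or_eq.1 hj with h5 | rfl
          · exact (g3 j h5).trans_eq h11
          · rw [hidx']; omega
      · refine .ite (fun h => absurd g1 h) (fun _ => .cons (.const (.cons (.add (.sub ?_)))))
        have h11' : s''.reg 11 = n :=
          (hfr'.2.2 11 le_rfl (by norm_num) (by omega) (by omega)).trans h11
        have hc1 : ¬ 17 = ctrl := by omega
        have hc2 : ¬ 17 = idx := by omega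
        have hc3 : ¬ idx = ctrl := by omega
        have hc4 : ¬ idx = 3 := by omega
        have hc5 : ¬ 11 = idx := by omega
        refine ⟨((hfr2.set (by omega)).set (by omega)).set (by omega), Or.inr ⟨?_, ?_, ?_, ?_⟩⟩
        · simp [hc1, hc2, g1]
        · simp [hc4, hc5, h11', hidx']; omega
        · simp [hc3, hc4, hidx']; omega
        · intro q hq hb hlt
          simp only [State.set_reg, hc3, hc4, hidx', if_true, if_false] at hlt
          rcases Nat.lt_succ_iff_lt_or_eq.1 hlt with h5 | h5
          · exact h4 q hq hb h5
          · have := g2 q (fun e he hor => ?_) (by rw [h11]; exact hb)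
            · rwa [h11, h13, hfr.1] at this
            · by_cases hed : e = ρ + d
              · rw [hed]; exact h5
              · rw [hq e he (by omega)]
                -- The frame condition ensures that earlier iterations have not touched the terms
                -- outside the searched range.
                exact (hfr.2.2 _ (by omega) (by omega) (by omega) (by omega)).symm

/-- Searches for a choice in each tier, until one is found. -/
def searchAll (ρ m T : ℕ) : Cmd := iter (fun t => .ite 17 .skip (search ρ m t m)) T

/-- The result of the search for a choice in the first `T` tiers. -/
def SearchAllResult (inp : List ℕ) (ρ m T : ℕ) (s s' : State) : Prop :=
  (s'.reg 17 ≠ 0 ∧ ∃ t < T,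
      IsChoice inp ρ m (s.reg 11) (s.reg 13) s.mem t (fun e => s'.reg (20 + e)) ∧
      (∀ j < m, s'.reg (20 + (ρ + j)) < s.reg 11) ∧ ∀ t' < t, ∀ q : ℕ → ℕ,
        (∀ e < m + 2 * ρ, e < ρ ∨ ρ + m ≤ e → q e = s.reg (20 + e)) →
        (∀ j < m, q (ρ + j) < s.reg 11) → ¬ IsChoice inp ρ m (s.reg 11) (s.reg 13) s.mem t' q) ∨
    (s'.reg 17 = 0 ∧ ∀ t' < T, ∀ q : ℕ → ℕ,
      (∀ e < m + 2 * ρ, e < ρ ∨ ρ + m ≤ e → q e = s.reg (20 + e)) →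
      (∀ j < m, q (ρ + j) < s.reg 11) → ¬ IsChoice inp ρ m (s.reg 11) (s.reg 13) s.mem t' q)

lemma runs_searchAll (ρ m T : ℕ) (s : State) (h17 : s.reg 17 = 0) :
    Runs inp (searchAll ρ m T) s (T * (searchTime ρ m (s.reg 11) m + 2) + 1) fun s' =>
      SearchFrame ρ m m s s' ∧ SearchAllResult inp ρ m T s s' := by
  refine Runs.iter (fun t s' => SearchFrame ρ m m s s' ∧ SearchAllResult inp ρ m t s s') T ?_
    ⟨.refl _ _ _ _, Or.inr ⟨h17, fun t' ht' => absurd ht' (by omega)⟩⟩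
  rintro t ht s' ⟨hfr, ⟨h1, t₀, ht₀, h2⟩ | ⟨h1, h2⟩⟩
  · refine Runs.ite (N := searchTime ρ m (s.reg 11) m + 1)
      (fun _ => .of_le (.skip ⟨hfr, Or.inl ⟨h1, t₀, by omega, h2⟩⟩) (by omega))
      (fun h => absurd h h1)
  · refine Runs.ite (N := searchTime ρ m (s.reg 11) m + 1) (fun h => absurd h1 h) (fun _ => ?_)
    have h11 : s'.reg 11 = s.reg 11 := hfr.2.2 11 le_rfl (by norm_num) (by omega) (by omega)
    have h13 : s'.reg 13 = s.reg 13 :=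
      hfr.2.2 13 (by norm_num) (by norm_num) (by omega) (by omega)
    refine (runs_search ρ m t m le_rfl s' h1).mono (by rw [h11]; omega) ?_
    rintro s'' ⟨hfr', hres⟩
    refine ⟨hfr.trans hfr', ?_⟩
    simp only [SearchResult, h11, h13, hfr.1] at hres
    rcases hres with ⟨g1, g2, g3⟩ | ⟨g1, g2⟩
    · exact Or.inl ⟨g1, t, by omega, g2, g3, h2⟩
    · refine Or.inr ⟨g1, fun t' ht' q hq hb => ?_⟩
      rcases Nat.lt_succ_iff_lt_or_eq.1 ht' with h5 | rfl
      · exact h2 t' h5 q hq hb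
      · refine g2 q (fun e he hor => ?_) hb
        rw [hq e he hor]
        exact (hfr.2.2 _ (by omega) (by omega) (by omega) (by omega)).symm

/-- Loads the two tuples of the current round into the end registers. -/
def loadEnds (ρ m : ℕ) : Cmd :=
  iter (fun j => .seq (.const 4 j) <| .seq (.add 0 14 4) <| .seq (.read (20 + j) 0) <|
    .seq (.add 0 15 4) <| .read (20 + (ρ + m + j)) 0) ρ

/-- The sequence `q` has the ends that are found in the input at positions `pu` and `pv`. -/
def HasEnds (inp : List ℕ) (ρ m pu pv : ℕ) (q : ℕ → ℕ) : Prop :=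
  ∀ j < ρ, q j = inp.getD (pu + j) 0 ∧ q (ρ + m + j) = inp.getD (pv + j) 0

lemma runs_loadEnds (ρ m : ℕ) (s : State) :
    Runs inp (loadEnds ρ m) s (ρ * 5 + 1) fun s' =>
      HasEnds inp ρ m (s.reg 14) (s.reg 15) (fun e => s'.reg (20 + e)) ∧
      (∀ y, 11 ≤ y → y < 20 → s'.reg y = s.reg y) ∧ s'.mem = s.mem ∧ s'.out = s.out := by
  refine (Runs.iter (fun i s' => (∀ j < i, s'.reg (20 + j) = inp.getD (s.reg 14 + j) 0 ∧
    s'.reg (20 + (ρ + m + j)) = inp.getD (s.reg 15 + j) 0) ∧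
      (∀ y, 11 ≤ y → y < 20 → s'.reg y = s.reg y) ∧ s'.mem = s.mem ∧ s'.out = s.out) ρ ?_ ?_)
  · rintro i hi s' ⟨h1, h2, h3, h4⟩
    refine .cons (.const (.cons (.add (.cons (.read (.cons (.add (.read ?_))))))))
    refine ⟨fun j hj => ?_, fun y hy hy' => ?_, h3, h4⟩
    · have e1 : ¬ 20 + j = 0 := by omega
      have e2 : ¬ 20 + j = 4 := by omega
      have e3 : ¬ 20 + j = 20 + (ρ + m + i) := by omega
      have e4 : ¬ 20 + (ρ + m + j) = 20 + i := by omega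
      have e5 : ¬ 20 + (ρ + m + j) = 0 := by omega
      have e6 : ¬ 20 + (ρ + m + j) = 4 := by omega
      have e7 : ¬ 0 = 20 + i := by omega
      have e8 : ¬ 4 = 20 + i := by omega
      have e9 : ¬ 15 = 20 + i := by omega
      simp only [State.set_reg, e1, e2, e3, e4, e5, e6, e7, e8, e9, if_false, if_true,
        h2 14 (by norm_num) (by norm_num), h2 15 (by norm_num) (by norm_num)]
      by_cases hji : j = i
      · subst hji
        simp
      · have e11 : ¬ 20 + j = 20 + i := by omega
        have e12 : ¬ 20 + (ρ + m + j) = 20 + (ρ + m + i) := by omega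
        simp only [e11, e12, if_false]
        exact h1 j (by omega)
    · simp only [State.set_reg]
      rw [if_neg (by omega), if_neg (by omega), if_neg (by omega), if_neg (by omega),
        if_neg (by omega)]
      exact h2 y hy hy'
  · exact ⟨by simp, fun _ _ _ => rfl, rfl, rfl⟩

/-- Writes the sequence in the registers, and sets the classes of its inner terms to zero. -/
def writePath (ρ m : ℕ) : Cmd :=
  .seq (.const 0 (m + 2 * ρ)) <| .seq (.write 0) <|
    .seq (iter (fun e => .write (20 + e)) (m + 2 * ρ)) <|
    iter (fun j => .seq (.const 0 0) (.store (20 + (ρ + j)) 0)) m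

lemma runs_writePath (ρ m : ℕ) (s : State) :
    Runs inp (writePath ρ m) s ((m + 2 * ρ + 1) + (m * 2 + 1) + 1 + 1) fun s' =>
      (∀ y, 10 ≤ y → s'.reg y = s.reg y) ∧
      s'.out = s.out ++ (m + 2 * ρ) :: (List.range (m + 2 * ρ)).map (fun e => s.reg (20 + e)) ∧
      (∀ j < m, s'.mem (s.reg (20 + (ρ + j))) = 0) ∧
      ∀ y, (∀ j < m, s.reg (20 + (ρ + j)) ≠ y) → s'.mem y = s.mem y := by
  refine .cons (.const (.cons (.write (Runs.seq ?_))))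
  refine Runs.mono (N := (m + 2 * ρ) * 1 + 1)
    (Runs.iter (fun i s' => (∀ y, 10 ≤ y → s'.reg y = s.reg y) ∧ s'.mem = s.mem ∧
    s'.out = s.out ++ (m + 2 * ρ) :: (List.range i).map (fun e => s.reg (20 + e))) _ ?_ ?_)
    (by omega) ?_
  · rintro i hi s' ⟨h1, h2, h3⟩
    refine .write ⟨h1, h2, ?_⟩
    simp [h3, List.range_succ, h1 (20 + i) (by omega)]
  · refine ⟨fun y hy => by simp [show ¬ y = 0 by omega], rfl, by simp⟩
  rintro s' ⟨h1, h2, h3⟩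
  refine (Runs.iter (N := 2) (fun i s'' => (∀ y, 10 ≤ y → s''.reg y = s.reg y) ∧
    s''.out = s'.out ∧ (∀ j < i, s''.mem (s.reg (20 + (ρ + j))) = 0) ∧
      ∀ y, (∀ j < i, s.reg (20 + (ρ + j)) ≠ y) → s''.mem y = s.mem y) _ ?_ ?_).mono le_rfl ?_
  · rintro i hi s'' ⟨g1, g2, g3, g4⟩
    refine .cons (.const (.store ⟨fun y hy => ?_, g2, fun j hj => ?_, fun y hy => ?_⟩))
    · simp only [State.set_reg]
      rw [if_neg (by omega)]
      exact g1 y hy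
    · simp only [State.set_reg, State.set_mem, if_true]
      rw [if_neg (by omega), g1 _ (by omega), Function.update_apply]
      split_ifs with h
      · rfl
      · refine g3 j (lt_of_le_of_ne (by omega) ?_)
        rintro rfl
        exact h rfl
    · simp only [State.set_reg, State.set_mem, if_true]
      rw [if_neg (by omega), g1 _ (by omega), Function.update_of_ne (hy i (by omega)).symm]
      exact g4 y fun j hj => hy j (by omega)
  · exact ⟨h1, rfl, by simp, fun y _ => by rw [h2]⟩
  · rintro s'' ⟨g1, g2, g3, g4⟩
    exact ⟨g1, by rw [g2, h3], g3, g4⟩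

/-- No sequence with the given ends is a choice in tier `t`. -/
def NoChoice (inp : List ℕ) (ρ m n base pu pv : ℕ) (mem : ℕ → ℕ) (t : ℕ) : Prop :=
  ∀ q, HasEnds inp ρ m pu pv q → (∀ j < m, q (ρ + j) < n) → ¬ IsChoice inp ρ m n base mem t q

/-- One round changes the memory and the output from `a` to `a'`. -/
def RoundResult (inp : List ℕ) (ρ m T n base pu pv : ℕ) (a a' : (ℕ → ℕ) × List ℕ) : Prop :=
  (∃ t < T, ∃ q, HasEnds inp ρ m pu pv q ∧ (∀ j < m, q (ρ + j) < n) ∧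
      IsChoice inp ρ m n base a.1 t q ∧ (∀ t' < t, NoChoice inp ρ m n base pu pv a.1 t') ∧
      (∀ j < m, a'.1 (q (ρ + j)) = 0) ∧ (∀ y, (∀ j < m, q (ρ + j) ≠ y) → a'.1 y = a.1 y) ∧
      a'.2 = a.2 ++ (m + 2 * ρ) :: (List.range (m + 2 * ρ)).map q) ∨
    ((∀ t < T, NoChoice inp ρ m n base pu pv a.1 t) ∧ a'.1 = a.1 ∧ a'.2 = a.2 ++ [0])

/-- One round: find a path between two tuples, and write it. -/
def round (ρ m T : ℕ) : Cmd :=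
  .seq (loadEnds ρ m) <| .seq (.const 17 0) <| .seq (searchAll ρ m T) <|
    .seq (.ite 17 (writePath ρ m) (.seq (.const 0 0) (.write 0))) <|
    .seq (.const 4 ρ) <| .seq (.add 14 14 4) <| .seq (.add 15 15 4) <|
    .seq (.const 4 1) <| .sub 18 18 4

/-- A bound for the running time of a round. -/
def roundTime (ρ m T n : ℕ) : ℕ :=
  (ρ * 5 + 1) + ((T * (searchTime ρ m n m + 2) + 1) +
    ((m + 2 * ρ + 1) + (m * 2 + 1) + 1 + 1 + 1 + 5) + 1)

lemma runs_round (ρ m T : ℕ) (s : State) :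
    Runs inp (round ρ m T) s (roundTime ρ m T (s.reg 11)) fun s' =>
      RoundResult inp ρ m T (s.reg 11) (s.reg 13) (s.reg 14) (s.reg 15) (s.mem, s.out)
        (s'.mem, s'.out) ∧ s'.reg 11 = s.reg 11 ∧ s'.reg 13 = s.reg 13 ∧
      s'.reg 14 = s.reg 14 + ρ ∧ s'.reg 15 = s.reg 15 + ρ ∧ s'.reg 18 = s.reg 18 - 1 := by
  refine Runs.seq ((runs_loadEnds ρ m s).mono le_rfl ?_)
  rintro s₁ ⟨a1, a2, a3, a4⟩
  refine .cons (.const (Runs.seq ((runs_searchAll ρ m T _ (by simp)).mono (by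
    simp [a2 11 le_rfl (by norm_num)]) ?_)))
  rintro s₂ ⟨b1, b2⟩
  have hb : ∀ y, 11 ≤ y → y ≠ 17 → y < 20 → s₂.reg y = s.reg y := fun y h1 h2 h3 => by
    rw [b1.2.2 y h1 h2 (by omega) (by omega), State.set_reg, if_neg h2, a2 y h1 h3]
  have hb2 : ∀ e, e < ρ ∨ ρ + m ≤ e → e < m + 2 * ρ → s₂.reg (20 + e) = s₁.reg (20 + e) :=
    fun e h1 h2 => by
      rw [b1.2.2 _ (by omega) (by omega) (by omega) (by omega), State.set_reg, if_neg (by omega)]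
  have hends : HasEnds inp ρ m (s.reg 14) (s.reg 15) (fun e => s₂.reg (20 + e)) := by
    intro j hj
    show s₂.reg (20 + j) = _ ∧ s₂.reg (20 + (ρ + m + j)) = _
    rw [hb2 j (by omega) (by omega), hb2 (ρ + m + j) (by omega) (by omega)]
    exact a1 j hj
  have hmem : s₂.mem = s.mem := b1.1.trans a3
  have hout : s₂.out = s.out := b1.2.1.trans a4
  have hq : ∀ q, HasEnds inp ρ m (s.reg 14) (s.reg 15) q →
      ∀ e < m + 2 * ρ, e < ρ ∨ ρ + m ≤ e → q e = s₁.reg (20 + e) := by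
    intro q hq e he hor
    rcases hor with h | h
    · exact (hq e h).1.trans (a1 e h).1.symm
    · obtain ⟨j, rfl⟩ := Nat.exists_eq_add_of_le h
      exact (hq j (by omega)).2.trans (a1 j (by omega)).2.symm
  have hregs : ∀ (q : ℕ → ℕ) e, (q e = (s₁.set 17 0).reg (20 + e)) = (q e = s₁.reg (20 + e)) :=
    fun q e => by rw [State.set_reg, if_neg (by omega)]
  simp only [SearchAllResult, hregs, State.set_mem, a3] at b2
  simp only [State.set_reg, show ¬ 11 = 17 by norm_num, show ¬ 13 = 17 by norm_num, if_false,
    a2 11 le_rfl (by norm_num), a2 13 (by norm_num) (by norm_num)] at b2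
  let Q : State → Prop := fun s' =>
    RoundResult inp ρ m T (s.reg 11) (s.reg 13) (s.reg 14) (s.reg 15) (s.mem, s.out)
      (s'.mem, s'.out) ∧ ∀ y, 11 ≤ y → y ≠ 17 → y < 20 → s'.reg y = s.reg y
  refine Runs.seq (N := (m + 2 * ρ + 1) + (m * 2 + 1) + 1 + 1 + 1) (N' := 5)
    (Runs.mono (Q := Q) ?_ le_rfl ?_)
  · rcases b2 with ⟨c1, t, ht, c2, c3, c4⟩ | ⟨c1, c2⟩
    · refine .ite (fun _ => (runs_writePath ρ m s₂).mono le_rfl ?_) (fun h => absurd h c1)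
      rintro s₃ ⟨d1, d2, d3, d4⟩
      refine ⟨Or.inl ⟨t, ht, _, hends, c3, c2, fun t' ht' q hqe hbd => c4 t' ht' q (hq q hqe) hbd,
        d3, ?_, ?_⟩, fun y h1 h2 h3 => ?_⟩
      · intro y hy
        exact (d4 y hy).trans (congrFun hmem y)
      · exact d2.trans (by rw [hout])
      · rw [d1 y (by omega), hb y h1 h2 h3]
    · refine .ite (fun h => absurd c1 h) (fun _ => .of_le (N := 1 + 1)
        (.cons (.const (.write ?_))) (by omega))
      refine ⟨Or.inr ⟨fun t ht q hqe hbd => c2 t ht q (hq q hqe) hbd, hmem, by simp [hout]⟩,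
        fun y h1 h2 h3 => ?_⟩
      simp only [State.set_reg]
      rw [if_neg (by omega), hb y h1 h2 h3]
  · rintro s₃ ⟨d1, d2⟩
    refine .cons (.const (.cons (.add (.cons (.add (.cons (.const (.sub ⟨d1, ?_⟩))))))))
    simp [d2]

end RAM

/-! ### Initialisation of the vertex classes, the whole program, and its running time. -/

namespace RAM

variable {inp : List ℕ}

/-- The number `y` occurs in the input at one of the positions from `lo` on, before `hi`. -/
def IsMarked (inp : List ℕ) (lo hi y : ℕ) : Prop := ∃ a, lo ≤ a ∧ a < hi ∧ inp.getD a 0 = y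

/-- The number `y` is in the given set, and not in one of the tuples. -/
def IsAvailable (inp : List ℕ) (lo hi y : ℕ) : Prop :=
  ¬ IsMarked inp lo hi y ∧ inp.getD (y + 2) 0 ≠ 0

/-- Reads the parameters, and computes the positions of the parts of the input. -/
def readParameters (ρ : ℕ) : Cmd :=
  .seq (.const 0 0) <| .seq (.read 11 0) <| .seq (.const 0 1) <| .seq (.read 12 0) <|
    .seq (.const 1 2) <| .seq (.add 14 11 1) <| .seq (.const 4 0) <| .seq (.add 15 14 4) <|
    .seq (iter (fun _ => .add 15 15 12) ρ) <| .seq (.add 13 15 4) <|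
    iter (fun _ => .add 13 13 12) ρ

/-- The registers hold the parameters of the input. -/
def HasParameters (inp : List ℕ) (ρ : ℕ) (s : State) : Prop :=
  s.reg 11 = inp.getD 0 0 ∧ s.reg 12 = inp.getD 1 0 ∧ s.reg 14 = inp.getD 0 0 + 2 ∧
    s.reg 15 = inp.getD 0 0 + 2 + ρ * inp.getD 1 0 ∧
    s.reg 13 = inp.getD 0 0 + 2 + ρ * inp.getD 1 0 + ρ * inp.getD 1 0

lemma runs_iter_add {x y : ℕ} (hxy : y ≠ x) (d : ℕ) (s : State) :
    Runs inp (iter (fun _ => .add x x y) d) s (d * 1 + 1) fun s' =>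
      s'.reg x = s.reg x + d * s.reg y ∧ (∀ z, z ≠ x → s'.reg z = s.reg z) ∧
      s'.mem = s.mem ∧ s'.out = s.out := by
  refine Runs.iter (fun i s' => s'.reg x = s.reg x + i * s.reg y ∧
    (∀ z, z ≠ x → s'.reg z = s.reg z) ∧ s'.mem = s.mem ∧ s'.out = s.out) d ?_
    ⟨by simp, fun _ _ => rfl, rfl, rfl⟩
  rintro i _ s' ⟨h1, h2, h3, h4⟩
  refine .add ⟨?_, fun z hz => ?_, h3, h4⟩
  · simp [h1, h2 y hxy]; ring
  · simp [hz, h2 z hz]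

lemma runs_readParameters (ρ : ℕ) :
    Runs inp (readParameters ρ) State.init ((ρ * 1 + 1) + ((ρ * 1 + 1) + 1) + 8) fun s' =>
      HasParameters inp ρ s' ∧ s'.mem = (fun _ => 0) ∧ s'.out = [] := by
  refine .cons (.const (.cons (.read (.cons (.const (.cons (.read (.cons (.const (.cons (.add
    (.cons (.const (.cons (.add (Runs.seq ((runs_iter_add (by norm_num) ρ _).mono le_rfl
    ?_)))))))))))))))))
  rintro s ⟨h1, h2, h3, h4⟩
  refine .cons (.add ((runs_iter_add (by norm_num) ρ _).mono le_rfl ?_))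
  rintro s' ⟨g1, g2, g3, g4⟩
  refine ⟨⟨?_, ?_, ?_, ?_, ?_⟩, ?_, ?_⟩
  · rw [g2 11 (by norm_num)]; simp [h2, State.init]
  · rw [g2 12 (by norm_num)]; simp [h2, State.init]
  · rw [g2 14 (by norm_num)]; simp [h2, State.init]
  · rw [g2 15 (by norm_num)]; simp [h1, State.init]
  · rw [g1]; simp [h1, h2, State.init]
  · rw [g3, State.set_mem, h3]; rfl
  · rw [g4, State.set_out, h4]; rfl

/-- Marks all vertices of the tuples in the memory. -/
def markTuples : Cmd :=
  .seq (.const 4 0) <| .seq (.add 0 14 4) <| .seq (.sub 2 13 0) <|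
    .loop 2 <| .seq (.read 1 0) <| .seq (.const 3 1) <| .seq (.store 1 3) <|
      .seq (.add 0 0 3) <| .sub 2 13 0

lemma runs_markTuples (s : State) (hmem : s.mem = fun _ => 0) (hle : s.reg 14 ≤ s.reg 13) :
    Runs inp markTuples s ((s.reg 13 - s.reg 14) * 6 + 4) fun s' =>
      (∀ y, s'.mem y ≠ 0 ↔ IsMarked inp (s.reg 14) (s.reg 13) y) ∧ s'.out = s.out ∧
        ∀ y, 10 ≤ y → s'.reg y = s.reg y := by
  have hloop := Runs.loop (inp := inp) (x := 2) (N := 5)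
    (c := .seq (.read 1 0) <| .seq (.const 3 1) <| .seq (.store 1 3) <|
      .seq (.add 0 0 3) <| .sub 2 13 0)
    (fun f s' => s'.reg 2 = f ∧ s'.reg 0 + f = s.reg 13 ∧ s.reg 14 ≤ s'.reg 0 ∧
      (∀ y, s'.mem y ≠ 0 ↔ IsMarked inp (s.reg 14) (s'.reg 0) y) ∧ s'.out = s.out ∧
        ∀ y, 10 ≤ y → s'.reg y = s.reg y) ?_
  · refine Runs.of_le (N := (s.reg 13 - s.reg 14) * (5 + 1) + 1 + 1 + 1 + 1)
      (.cons (.const (.cons (.add (.cons (.sub ?_)))))) (by omega)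
    refine (hloop _ _ ?_).mono le_rfl ?_
    · refine ⟨by simp, by simp; omega, by simp, fun y => ?_, rfl, fun y hy => ?_⟩
      · simp only [State.set_mem, hmem, ne_eq, not_true_eq_false, false_iff]
        rintro ⟨a, h1, h2, -⟩
        simp at h2
        omega
      · simp [show ¬ y = 2 by omega, show ¬ y = 0 by omega, show ¬ y = 4 by omega]
    · rintro s' ⟨hx, f, h1, h2, h3, h4, h5, h6⟩
      refine ⟨?_, h5, h6⟩
      rwa [show s'.reg 0 = s.reg 13 by omega] at h4
  · rintro f s' ⟨h1, h2, h3, h4, h5, h6⟩ hne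
    rw [h1] at hne
    obtain ⟨f', rfl⟩ := Nat.exists_eq_succ_of_ne_zero hne
    refine ⟨f', rfl, .cons (.read (.cons (.const (.cons (.store (.cons (.add (.sub ?_))))))))⟩
    refine ⟨?_, ?_, ?_, fun y => ?_, h5, fun y hy => ?_⟩
    · simp [h6 13 (by norm_num)]; omega
    · simp; omega
    · simp; omega
    · simp only [State.set_mem, State.set_reg]
      norm_num [Function.update_apply]
      split_ifs with h
      · simp only [not_false_eq_true, true_iff]
        exact ⟨s'.reg 0, h3, by omega, by simp [h]⟩
      · rw [← ne_eq, h4 y]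
        constructor
        · rintro ⟨a, g1, g2, g3⟩
          exact ⟨a, g1, by omega, g3⟩
        · rintro ⟨a, g1, g2, g3⟩
          refine ⟨a, g1, lt_of_le_of_ne (by omega) ?_, g3⟩
          rintro rfl
          exact h (by simpa using g3.symm)
    · simp [show ¬ y = 0 by omega, show ¬ y = 1 by omega, show ¬ y = 2 by omega,
        show ¬ y = 3 by omega, h6 y hy]

/-- Distributes the available vertices evenly among the classes `1, …, N`. -/
def assignClasses (N : ℕ) : Cmd :=
  .seq (.const 5 1) <| .seq (.const 0 0) <| .seq (.sub 2 11 0) <| .loop 2 <|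
    .seq (.seq (.load 1 0) <| .ite 1 (.seq (.const 1 0) (.store 0 1)) <|
      .seq (.const 1 2) <| .seq (.add 1 1 0) <| .seq (.read 1 1) <|
        .ite 1 (.seq (.store 0 5) <| .seq (.const 1 1) <| .seq (.add 5 5 1) <|
          .seq (.const 3 (N + 1)) <| .seq (.sub 3 3 5) <| .ite 3 .skip (.const 5 1)) .skip) <|
    .seq (.const 3 1) <| .seq (.add 0 0 3) <| .sub 2 11 0

/-- The available vertices below `n` have been distributed among the classes `1, …, N`. -/
def IsClassAssignment (inp : List ℕ) (N lo hi n : ℕ) (mem : ℕ → ℕ) : Prop :=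
  ∀ [DecidablePred (IsAvailable inp lo hi)], ∀ y < n,
    mem y = if IsAvailable inp lo hi y then Nat.count (IsAvailable inp lo hi) y % N + 1 else 0

/-- The machine has no division, so classes are dealt out by a counter running cyclically through 1,
…, N. This is the update rule of that counter. -/
lemma succ_mod_add_one {N a : ℕ} (hN : 1 ≤ N) :
    (a + 1) % N + 1 = if N + 1 - (a % N + 1 + 1) = 0 then 1 else a % N + 1 + 1 := by
  have h := Nat.mod_lt a hN
  rw [Nat.add_mod]
  split_ifs with h1
  · have : a % N = N - 1 := by omega
    rw [this]
    rcases Nat.lt_or_ge 1 N with h2 | h2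
    · rw [Nat.mod_eq_of_lt h2, Nat.sub_add_cancel hN, Nat.mod_self]
    · obtain rfl : N = 1 := by omega
      simp
  · have h2 : 1 < N := by omega
    rw [Nat.mod_eq_of_lt h2, Nat.mod_eq_of_lt (by omega)]

/-- The same cells first hold the marks of tuple vertices and then the classes. A cell is
overwritten only when its vertex is visited, so the marks ahead of the sweep are still intact. -/
lemma runs_assignClasses {N : ℕ} (hN : 1 ≤ N) {lo hi : ℕ} (s : State)
    (hmem : ∀ y, s.mem y ≠ 0 ↔ IsMarked inp lo hi y) :
    Runs inp (assignClasses N) s (s.reg 11 * 17 + 4) fun s' =>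
      IsClassAssignment inp N lo hi (s.reg 11) s'.mem ∧ s'.out = s.out ∧
        ∀ y, 10 ≤ y → s'.reg y = s.reg y := by
  classical
  set av := IsAvailable inp lo hi with hav
  let Mid : ℕ → State → Prop := fun a s' => s'.reg 5 = Nat.count av (a + 1) % N + 1 ∧
      (∀ y < a + 1, s'.mem y = if av y then Nat.count av y % N + 1 else 0) ∧
      (∀ y, a + 1 ≤ y → s'.mem y = s.mem y) ∧ s'.out = s.out ∧ s'.reg 0 = a ∧
        ∀ y, 10 ≤ y → s'.reg y = s.reg y
  have hloop := Runs.loop (inp := inp) (x := 2) (N := 13 + 3)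
    (c := .seq (.seq (.load 1 0) <| .ite 1 (.seq (.const 1 0) (.store 0 1)) <|
      .seq (.const 1 2) <| .seq (.add 1 1 0) <| .seq (.read 1 1) <|
        .ite 1 (.seq (.store 0 5) <| .seq (.const 1 1) <| .seq (.add 5 5 1) <|
          .seq (.const 3 (N + 1)) <| .seq (.sub 3 3 5) <| .ite 3 .skip (.const 5 1)) .skip) <|
      .seq (.const 3 1) <| .seq (.add 0 0 3) <| .sub 2 11 0)
    (fun f s' => s'.reg 2 = f ∧ s'.reg 0 + f = s.reg 11 ∧
      s'.reg 5 = Nat.count av (s'.reg 0) % N + 1 ∧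
      (∀ y < s'.reg 0, s'.mem y = if av y then Nat.count av y % N + 1 else 0) ∧
      (∀ y, s'.reg 0 ≤ y → s'.mem y = s.mem y) ∧ s'.out = s.out ∧
        ∀ y, 10 ≤ y → s'.reg y = s.reg y) ?_
  · refine Runs.of_le (N := s.reg 11 * (13 + 3 + 1) + 1 + 1 + 1 + 1)
      (.cons (.const (.cons (.const (.cons (.sub ?_)))))) (by omega)
    refine (hloop _ _ ?_).mono le_rfl ?_
    · refine ⟨by simp, by simp, by simp, by simp, fun y _ => rfl, rfl, fun y hy => ?_⟩
      simp [show ¬ y = 2 by omega, show ¬ y = 0 by omega, show ¬ y = 5 by omega]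
    · rintro s' ⟨hx, f, h1, h2, h3, h4, h5, h6, h7⟩
      refine ⟨fun y hy => ?_, h6, h7⟩
      rw [h4 y (by omega)]
      congr
  · rintro f s' ⟨h1, h2, h3, h4, h5, h6, h7⟩ hne
    rw [h1] at hne
    obtain ⟨f', rfl⟩ := Nat.exists_eq_succ_of_ne_zero hne
    refine ⟨f', rfl, Runs.seq (Runs.mono (Q := Mid (s'.reg 0)) (N := 13) ?_ le_rfl ?_)⟩
    · refine .cons (.load (.ite (fun h => ?_) (fun h => ?_)))
      · simp at h
        have hm : IsMarked inp lo hi (s'.reg 0) := by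
          rw [← hmem, ← h5 _ le_rfl]; exact h
        have hna : ¬ av (s'.reg 0) := fun h => h.1 hm
        refine Runs.of_le (N := 1 + 1) (.cons (.const (.store ?_))) (by norm_num)
        refine ⟨?_, fun y hy => ?_, fun y hy => ?_, h6, by simp, fun y hy => ?_⟩
        · simp [h3, Nat.count_succ, hna]
        · simp only [State.set_reg, State.set_mem, Function.update_apply]
          norm_num
          split_ifs with e1 e2 e2
          · exact absurd (e1 ▸ e2) hna
          · rfl
          · rw [h4 y (by omega), if_pos e2]
          · rw [h4 y (by omega), if_neg e2]
        · simp only [State.set_reg, State.set_mem, Function.update_apply]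
          norm_num
          rw [if_neg (by omega), h5 y (by omega)]
        · simp [show ¬ y = 1 by omega, h7 y hy]
      · simp at h
        have hm : ¬ IsMarked inp lo hi (s'.reg 0) := by
          rw [← hmem, ← h5 _ le_rfl]; simpa using h
        refine .cons (.const (.cons (.add (.cons (.read (.ite (fun g => ?_) (fun g => ?_)))))))
        · simp [add_comm 2] at g
          have hna : av (s'.reg 0) := ⟨hm, by simpa using g⟩
          let P : State → Prop := fun s'' => s''.reg 5 = Nat.count av (s'.reg 0) % N + 1 + 1 ∧
            (∀ y < s'.reg 0 + 1, s''.mem y = if av y then Nat.count av y % N + 1 else 0) ∧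
            (∀ y, s'.reg 0 + 1 ≤ y → s''.mem y = s.mem y) ∧ s''.out = s.out ∧
            s''.reg 0 = s'.reg 0 ∧ s''.reg 3 = N + 1 - s''.reg 5 ∧
            ∀ y, 10 ≤ y → s''.reg y = s.reg y
          have hfin : ∀ s'', P s'' → Runs inp (.ite 3 .skip (.const 5 1)) s'' 2
              (Mid (s'.reg 0)) := by
            rintro s'' ⟨p1, p2, p3, p4, p5, p6, p7⟩
            rw [p1] at p6
            have hmod := succ_mod_add_one (a := Nat.count av (s'.reg 0)) hN
            rw [← p6] at hmod
            refine .ite (fun hz => .skip ⟨?_, p2, p3, p4, p5, p7⟩)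
              (fun hz => .const ⟨?_, p2, p3, p4, by simpa using p5, fun y hy => ?_⟩)
            · rw [Nat.count_succ, if_pos hna, hmod, if_neg hz, p1]
            · rw [Nat.count_succ, if_pos hna, hmod, if_pos hz]; simp
            · rw [State.set_reg, if_neg (by omega), p7 y hy]
          refine Runs.of_le (N := 2 + 1 + 1 + 1 + 1 + 1)
            (.cons (.store (.cons (.const (.cons (.add (.cons (.const (.cons (.sub
              (hfin _ ?_)))))))))))
            (by norm_num)
          refine ⟨by simp [h3], fun y hy => ?_, fun y hy => ?_, h6, by simp, by simp,
            fun y hy => ?_⟩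
          · simp only [State.set_reg, State.set_mem, Function.update_apply]
            norm_num
            split_ifs with e1 e2 e2
            · rw [h3, e1]
            · exact absurd (e1 ▸ hna) e2
            · rw [h4 y (by omega), if_pos e2]
            · rw [h4 y (by omega), if_neg e2]
          · simp only [State.set_reg, State.set_mem, Function.update_apply]
            norm_num
            rw [if_neg (by omega), h5 y (by omega)]
          · simp [show ¬ y = 1 by omega, show ¬ y = 3 by omega, show ¬ y = 5 by omega, h7 y hy]
        · simp [add_comm 2] at g
          have hna : ¬ av (s'.reg 0) := fun h => h.2 (by simpa using g)
          refine Runs.of_le (N := 1) (.skip ?_) (by norm_num)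
          refine ⟨by simp [h3, Nat.count_succ, hna], fun y hy => ?_, fun y hy => h5 y (by omega),
            h6, by simp, fun y hy => ?_⟩
          · rcases Nat.lt_succ_iff_lt_or_eq.1 hy with e | rfl
            · exact h4 y e
            · rw [if_neg hna]; simpa using h
          · simp [show ¬ y = 1 by omega, h7 y hy]
    · rintro s'' ⟨p1, p2, p3, p4, p5, p6⟩
      refine .cons (.const (.cons (.add (.sub ⟨?_, ?_, ?_, ?_, ?_, p4, fun y hy => ?_⟩))))
      · simp [p5, p6 11 (by norm_num)]; omega
      · simp [p5]; omega
      · simpa [p5] using p1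
      · simpa [p5] using p2
      · simpa [p5] using p3
      · simp [show ¬ y = 0 by omega, show ¬ y = 2 by omega, show ¬ y = 3 by omega, p6 y hy]

/-- The whole program. -/
def connect (ρ m T : ℕ) : Cmd :=
  .seq (readParameters ρ) <| .seq markTuples <| .seq (assignClasses (T * m)) <|
    .seq (.const 4 0) <| .seq (.add 18 12 4) <| .loop 18 (round ρ m T)

/-- A bound for the running time of the whole program. -/
def connectTime (ρ m T n k : ℕ) : ℕ :=
  ((ρ * 1 + 1) + ((ρ * 1 + 1) + 1) + 8) + (((ρ * k + ρ * k) * 6 + 4) +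
    ((n * 17 + 4) + (k * (roundTime ρ m T n + 1) + 1 + 1 + 1)))

/-- The memory and the output after each of `k` rounds. -/
def IsRun (inp : List ℕ) (ρ m T n k : ℕ) (run : ℕ → (ℕ → ℕ) × List ℕ) : Prop :=
  IsClassAssignment inp (T * m) (n + 2) (n + 2 + ρ * k + ρ * k) n (run 0).1 ∧ (run 0).2 = [] ∧
    ∀ i < k, RoundResult inp ρ m T n (n + 2 + ρ * k + ρ * k) (n + 2 + i * ρ)
      (n + 2 + ρ * k + i * ρ) (run i) (run (i + 1))

theorem runs_connect (ρ m T : ℕ) (hmT : 1 ≤ T * m) :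
    Runs inp (connect ρ m T) State.init (connectTime ρ m T (inp.getD 0 0) (inp.getD 1 0)) fun s' =>
      ∃ run, IsRun inp ρ m T (inp.getD 0 0) (inp.getD 1 0) run ∧
        s'.out = (run (inp.getD 1 0)).2 := by
  set n := inp.getD 0 0 with hn
  set k := inp.getD 1 0 with hk
  refine Runs.seq ((runs_readParameters ρ).mono le_rfl ?_)
  rintro s₁ ⟨⟨a1, a2, a3, a4, a5⟩, a6, a7⟩
  rw [← hn] at a1 a3 a4 a5
  rw [← hk] at a2 a4 a5
  refine Runs.seq ((runs_markTuples s₁ a6 (by omega)).mono (by omega) ?_)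
  rintro s₂ ⟨b1, b2, b3⟩
  refine Runs.seq ((runs_assignClasses hmT s₂ b1).mono
    (by rw [b3 11 (by norm_num), a1]) ?_)
  rintro s₃ ⟨c1, c2, c3⟩
  rw [b3 11 (by norm_num), a1, a3, a5] at c1
  have hreg : ∀ y, 10 ≤ y → s₃.reg y = s₁.reg y := fun y hy => (c3 y hy).trans (b3 y hy)
  -- The invariant carries the whole history `run` of memory and output, since the later analysis
  -- needs what each round saw.
  let Inv : ℕ → State → Prop := fun f s => s.reg 18 = f ∧ s.reg 11 = n ∧
    s.reg 13 = n + 2 + ρ * k + ρ * k ∧ ∃ i, f + i = k ∧ s.reg 14 = n + 2 + i * ρ ∧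
      s.reg 15 = n + 2 + ρ * k + i * ρ ∧ ∃ run : ℕ → (ℕ → ℕ) × List ℕ,
      run 0 = (s₃.mem, []) ∧ run i = (s.mem, s.out) ∧
      ∀ i' < i, RoundResult inp ρ m T n (n + 2 + ρ * k + ρ * k) (n + 2 + i' * ρ)
        (n + 2 + ρ * k + i' * ρ) (run i') (run (i' + 1))
  have hloop := Runs.loop (inp := inp) (x := 18) (N := roundTime ρ m T n) (c := round ρ m T) Inv ?_
  · refine .cons (.const (.cons (.add ?_)))
    refine (hloop k _ ⟨?_, ?_, ?_, 0, rfl, ?_, ?_, fun _ => (s₃.mem, []), rfl, ?_, ?_⟩).mono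
      le_rfl ?_
    · simp [hreg, a2]
    · simp [hreg, a1]
    · simp [hreg, a5]
    · simp [hreg, a3]
    · simp [hreg, a4]
    · simp [c2, b2, a7]
    · intro i' hi'
      omega
    · rintro s ⟨hx, f, d1, d2, d3, i, d4, d5, d6, run, d7, d8, d9⟩
      obtain rfl : i = k := by omega
      exact ⟨run, ⟨by rw [d7]; exact c1, by rw [d7], d9⟩, by rw [d8]⟩
  · rintro f s ⟨d1, d2, d3, i, d4, d5, d6, run, d7, d8, d9⟩ hne
    rw [d1] at hne
    obtain ⟨f', rfl⟩ := Nat.exists_eq_succ_of_ne_zero hne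
    refine ⟨f', rfl, (runs_round ρ m T s).mono (by rw [d2]) ?_⟩
    rintro s' ⟨e1, e2, e3, e4, e5, e6⟩
    rw [d2, d3, d5, d6] at e1
    refine ⟨by omega, by omega, by omega, i + 1, by omega, by rw [e4, d5]; ring,
      by rw [e5, d6]; ring, Function.update run (i + 1) (s'.mem, s'.out), ?_, by simp, ?_⟩
    · rw [Function.update_of_ne (by omega), d7]
    · intro i' hi'
      rw [Function.update_of_ne (by omega)]
      rcases Nat.lt_succ_iff_lt_or_eq.1 hi' with h | rfl
      · rw [Function.update_of_ne (by omega)]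
        exact d9 i' h
      · rw [Function.update_self, d8]
        exact e1

/-! Polynomial bounds for the running time. -/

lemma exists_polynomial_searchTime (ρ m d : ℕ) :
    ∃ q : Polynomial ℕ, ∀ n, q.eval n = searchTime ρ m n d := by
  induction d with
  | zero =>
    refine ⟨.C (m * 7 + 1) + (.C (m + ρ) * (.C (ρ + 1) * (.X * .C 3 + .C 6) + .C 5) + .C 1) +
      .C 1 + .C 2, fun n => ?_⟩
    simp only [Polynomial.eval_add, Polynomial.eval_mul, Polynomial.eval_C, Polynomial.eval_X]
    rfl
  | succ d ih =>
    obtain ⟨q, hq⟩ := ih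
    refine ⟨.X * (q + .C 5) + .C 4, fun n => ?_⟩
    simp only [Polynomial.eval_add, Polynomial.eval_mul, Polynomial.eval_C, Polynomial.eval_X, hq]
    rfl

lemma exists_polynomial_connectTime (ρ m T : ℕ) :
    ∃ q : Polynomial ℕ, ∀ n k N, n ≤ N → k ≤ N → connectTime ρ m T n k ≤ q.eval N := by
  obtain ⟨q, hq⟩ := exists_polynomial_searchTime ρ m m
  refine ⟨.C ((ρ * 1 + 1) + ((ρ * 1 + 1) + 1) + 8) + (((.C ρ * .X + .C ρ * .X) * .C 6 + .C 4) +
    ((.X * .C 17 + .C 4) + (.X * ((.C (ρ * 5 + 1) + ((.C T * (q + .C 2) + .C 1) +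
    .C ((m + 2 * ρ + 1) + (m * 2 + 1) + 1 + 1 + 1 + 5) + .C 1)) + .C 1) + .C 1 + .C 1 + .C 1))),
    fun n k N hn hk => ?_⟩
  -- A polynomial with natural coefficients is monotone, so the bound in n and k may be evaluated at
  -- any common upper bound, such as the input length.
  have hmono : q.eval n ≤ q.eval N := by
    rw [Polynomial.eval_eq_sum_range, Polynomial.eval_eq_sum_range]
    exact sum_le_sum fun i _ => Nat.mul_le_mul_left _ (Nat.pow_le_pow_left hn i)
  simp only [Polynomial.eval_add, Polynomial.eval_mul, Polynomial.eval_C, Polynomial.eval_X,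
    connectTime, roundTime, ← hq n]
  gcongr

end RAM

/-! ### Paths as lists, and positions in flattened arrays. -/

section Lists

/-- The sequence of vertices of a path with end tuples `u`, `v` and interior `x`. -/
def pathList {V : Type*} {ρ m : ℕ} (u : Fin ρ → V) (x : Fin m → V) (v : Fin ρ → V) : List V :=
  List.ofFn u ++ List.ofFn x ++ List.ofFn v

variable {V : Type*} {ρ m : ℕ} (u : Fin ρ → V) (x : Fin m → V) (v : Fin ρ → V)

lemma length_pathList : (pathList u x v).length = m + 2 * ρ := by
  simp [pathList]; omega

lemma mem_pathList {y : V} :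
    y ∈ pathList u x v ↔ (∃ e, u e = y) ∨ (∃ j, x j = y) ∨ ∃ e, v e = y := by
  simp [pathList, List.mem_ofFn]

lemma getD_ofFn {n : ℕ} (f : Fin n → V) (d : V) (j : Fin n) : (List.ofFn f).getD j d = f j := by
  rw [List.getD_eq_getElem _ _ (by simp)]
  simp

lemma getD_pathList_left (d : V) (e : Fin ρ) : (pathList u x v).getD e d = u e := by
  rw [pathList, List.append_assoc, List.getD_append _ _ _ _ (by simp), getD_ofFn]

lemma getD_pathList_mid (d : V) (j : Fin m) : (pathList u x v).getD (ρ + j) d = x j := by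
  rw [pathList, List.append_assoc, List.getD_append_right _ _ _ _ (by simp),
    List.getD_append _ _ _ _ (by simp)]
  simp

lemma getD_pathList_right (d : V) (e : Fin ρ) :
    (pathList u x v).getD (ρ + m + e) d = v e := by
  rw [pathList, List.getD_append_right _ _ _ _ (by simp)]
  simp

lemma pathList_cases (d : V) {q : ℕ} (hq : q < m + 2 * ρ) :
    (∃ e : Fin ρ, q = e ∧ (pathList u x v).getD q d = u e) ∨
    (∃ j : Fin m, q = ρ + j ∧ (pathList u x v).getD q d = x j) ∨
    ∃ e : Fin ρ, q = ρ + m + e ∧ (pathList u x v).getD q d = v e := by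
  rcases Nat.lt_or_ge q ρ with h | h
  · exact Or.inl ⟨⟨q, h⟩, rfl, getD_pathList_left u x v d ⟨q, h⟩⟩
  obtain ⟨j, rfl⟩ := Nat.exists_eq_add_of_le h
  rcases Nat.lt_or_ge j m with h' | h'
  · exact Or.inr (Or.inl ⟨⟨j, h'⟩, rfl, getD_pathList_mid u x v d ⟨j, h'⟩⟩)
  obtain ⟨e, rfl⟩ := Nat.exists_eq_add_of_le h'
  rw [← add_assoc]
  exact Or.inr (Or.inr ⟨⟨e, by omega⟩, rfl, getD_pathList_right u x v d ⟨e, by omega⟩⟩)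

lemma toFinset_take_drop [DecidableEq V] (p : List V) (d : V) {r i : ℕ} (h : i + r ≤ p.length) :
    ((p.drop i).take r).toFinset = window r (fun e => p.getD e d) i := by
  have : (p.drop i).take r = (List.range r).map fun j => p.getD (i + j) d := by
    refine List.ext_getElem (by simp; omega) fun j h1 h2 => ?_
    simp only [List.length_map, List.length_range] at h2
    simp [List.getElem?_eq_getElem (show i + j < p.length by omega)]
  rw [this]
  ext y
  simp [window]

/-- The list of colours is 0, 1, 2, …, so no vertex can occur twice. -/
lemma nodup_of_isColored {col : V → ℕ} (p : List V) (d : V) {ρ m : ℕ} (hp : p.length = m + 2 * ρ)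
    (h : IsColored ρ m col fun e => p.getD e d) : p.Nodup := by
  refine List.Nodup.of_map col ?_
  have : p.map col = List.range (m + 2 * ρ) := by
    refine List.ext_getElem (by simp [hp]) fun j h1 h2 => ?_
    simp only [List.length_range] at h2
    have := h j h2
    dsimp only at this
    rw [List.getD_eq_getElem _ _ (by omega)] at this
    simpa using this
  rw [this]
  exact List.nodup_range

lemma flatten_ofFn_ofFn {α : Type*} {k n : ℕ} (f : Fin k → Fin n → α) :
    (List.ofFn fun i => List.ofFn (f i)).flatten =
      List.ofFn fun a : Fin (k * n) => f a.divNat a.modNat := by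
  rw [List.ofFn_mul]
  congr 2
  funext i
  congr 1
  funext j
  have hj := j.isLt
  congr 1
  · ext; simp [Fin.divNat, Nat.add_div_of_dvd_right, Nat.div_eq_of_lt hj, j.pos]
  · ext; simp [Fin.modNat, Nat.mod_eq_of_lt hj]

lemma getD_flatten_ofFn_ofFn {α : Type*} {k n : ℕ} (f : Fin k → Fin n → α) (d : α) (i : Fin k)
    (j : Fin n) : (List.ofFn fun i => List.ofFn (f i)).flatten.getD (i * n + j) d = f i j := by
  have hlt : (i : ℕ) * n + j < k * n := by
    calc (i : ℕ) * n + j < i * n + n := by omega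
      _ = (i + 1) * n := by ring
      _ ≤ k * n := Nat.mul_le_mul_right _ i.isLt
  rw [flatten_ofFn_ofFn]
  refine (getD_ofFn _ d ⟨i * n + j, hlt⟩).trans ?_
  have hj := j.isLt
  congr 1
  · ext; simp [Fin.divNat, Nat.add_div_of_dvd_right, Nat.div_eq_of_lt hj, j.pos]
  · ext; simp [Fin.modNat, Nat.mod_eq_of_lt hj]

lemma length_flatten_ofFn_ofFn {α : Type*} {k n : ℕ} (f : Fin k → Fin n → α) :
    (List.ofFn fun i => List.ofFn (f i)).flatten.length = k * n := by
  rw [flatten_ofFn_ofFn, List.length_ofFn]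

end Lists

/-! ### Locating the parts of the encoded input. -/

namespace ConnInput

variable {r : ℕ} (I : ConnInput r)

lemma getD_encode_zero : I.encode.getD 0 0 = I.n := by simp [encode]

lemma getD_encode_one : I.encode.getD 1 0 = I.k := by simp [encode]

lemma encode_eq : I.encode = [I.n, I.k] ++
    (List.ofFn (fun x : Fin I.n => if x ∈ I.X then 1 else 0) ++
    ((List.ofFn fun i => List.ofFn fun j => (I.u i j : ℕ)).flatten ++
    ((List.ofFn fun i => List.ofFn fun j => (I.v i j : ℕ)).flatten ++
    List.ofFn (fun a : Fin (I.n ^ r) =>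
        if univ.image (finFunctionFinEquiv.symm a : Fin r → Fin I.n) ∈ I.G.1 then 1 else 0)))) := by
  simp only [encode, List.append_assoc]

lemma getD_encode_vertex (x : Fin I.n) : I.encode.getD (x + 2) 0 = if x ∈ I.X then 1 else 0 := by
  rw [encode_eq, List.getD_append_right _ _ _ _ (by simp), List.getD_append _ _ _ _ (by simp)]
  exact getD_ofFn _ 0 x

lemma getD_encode_left (i : Fin I.k) (j : Fin (r - 1)) :
    I.encode.getD (I.n + 2 + i * (r - 1) + j) 0 = I.u i j := by
  have hlt : (i : ℕ) * (r - 1) + j < I.k * (r - 1) := by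
    calc (i : ℕ) * (r - 1) + j < i * (r - 1) + (r - 1) := by omega
      _ = (i + 1) * (r - 1) := by ring
      _ ≤ I.k * (r - 1) := Nat.mul_le_mul_right _ i.isLt
  rw [encode_eq, List.getD_append_right _ _ _ _ (by simp; omega),
    List.getD_append_right _ _ _ _ (by simp; omega), List.getD_append _ _ _ _
      (by rw [length_flatten_ofFn_ofFn]; simp; omega)]
  rw [← getD_flatten_ofFn_ofFn (fun i j => (I.u i j : ℕ)) 0 i j]
  congr 1
  simp; omega

lemma getD_encode_right (i : Fin I.k) (j : Fin (r - 1)) :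
    I.encode.getD (I.n + 2 + (r - 1) * I.k + i * (r - 1) + j) 0 = I.v i j := by
  have hlt : (i : ℕ) * (r - 1) + j < I.k * (r - 1) := by
    calc (i : ℕ) * (r - 1) + j < i * (r - 1) + (r - 1) := by omega
      _ = (i + 1) * (r - 1) := by ring
      _ ≤ I.k * (r - 1) := Nat.mul_le_mul_right _ i.isLt
  rw [mul_comm (r - 1) I.k]
  rw [encode_eq, List.getD_append_right _ _ _ _ (by simp; omega),
    List.getD_append_right _ _ _ _ (by simp; omega), List.getD_append_right _ _ _ _
      (by rw [length_flatten_ofFn_ofFn]; simp; omega), List.getD_append _ _ _ _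
      (by rw [length_flatten_ofFn_ofFn, length_flatten_ofFn_ofFn]; simp; omega)]
  rw [← getD_flatten_ofFn_ofFn (fun i j => (I.v i j : ℕ)) 0 i j]
  congr 1
  rw [length_flatten_ofFn_ofFn]
  simp; omega

/-- `finFunctionFinEquiv` numbers the tuples by their base n digits, least significant first. This
is the sum that `RAM.horner` evaluates. -/
lemma getD_encode_edge (f : Fin r → Fin I.n) :
    I.encode.getD (∑ j : Fin r, (f j : ℕ) * I.n ^ (j : ℕ) +
      (I.n + 2 + (r - 1) * I.k + (r - 1) * I.k)) 0 = if univ.image f ∈ I.G.1 then 1 else 0 := by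
  rw [mul_comm (r - 1) I.k]
  rw [encode_eq, List.getD_append_right _ _ _ _ (by simp; omega),
    List.getD_append_right _ _ _ _ (by simp; omega), List.getD_append_right _ _ _ _
      (by rw [length_flatten_ofFn_ofFn]; simp; omega), List.getD_append_right _ _ _ _
      (by rw [length_flatten_ofFn_ofFn, length_flatten_ofFn_ofFn]; simp; omega)]
  have h := getD_ofFn (fun a : Fin (I.n ^ r) =>
        if univ.image (finFunctionFinEquiv.symm a : Fin r → Fin I.n) ∈ I.G.1 then 1 else 0) 0
        (finFunctionFinEquiv f)
  rw [Equiv.symm_apply_apply, finFunctionFinEquiv_apply] at h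
  rw [← h]
  congr 1
  rw [length_flatten_ofFn_ofFn, length_flatten_ofFn_ofFn]
  simp; omega

lemma le_length_encode : I.n ≤ I.encode.length ∧ (2 ≤ r → I.k ≤ I.encode.length) := by
  rw [encode_eq]
  simp only [List.length_append, length_flatten_ofFn_ofFn, List.length_ofFn]
  refine ⟨by omega, fun hr => ?_⟩
  have : I.k * 1 ≤ I.k * (r - 1) := Nat.mul_le_mul_left _ (by omega)
  omega

lemma exists_left_or_right {a : ℕ} (h1 : I.n + 2 ≤ a)
    (h2 : a < I.n + 2 + (r - 1) * I.k + (r - 1) * I.k) :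
    ∃ i j, I.encode.getD a 0 = I.u i j ∨ I.encode.getD a 0 = I.v i j := by
  have key : ∀ b < (r - 1) * I.k, ∃ (i : Fin I.k) (j : Fin (r - 1)), b = i * (r - 1) + j := by
    intro b hb
    have hr : 0 < r - 1 := Nat.pos_of_ne_zero fun h => by simp [h] at hb
    exact ⟨⟨b / (r - 1), Nat.div_lt_of_lt_mul hb⟩, ⟨b % (r - 1), Nat.mod_lt _ hr⟩,
      (Nat.div_add_mod' b (r - 1)).symm⟩
  obtain ⟨b, rfl⟩ := Nat.exists_eq_add_of_le h1
  rcases Nat.lt_or_ge b ((r - 1) * I.k) with h | h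
  · obtain ⟨i, j, rfl⟩ := key b h
    exact ⟨i, j, Or.inl (by rw [← add_assoc]; exact I.getD_encode_left i j)⟩
  · obtain ⟨b', rfl⟩ := Nat.exists_eq_add_of_le h
    obtain ⟨i, j, rfl⟩ := key b' (by omega)
    exact ⟨i, j, Or.inr (by rw [← I.getD_encode_right i j]; congr 1; omega)⟩

end ConnInput

/-! ### Splitting the free vertices into tiers and layers of nearly equal size. -/

section Layers

variable {n : ℕ}

/-- The natural number `y` is in the given set of vertices. -/
def InSet (X : Finset (Fin n)) (y : ℕ) : Prop := ∃ h : y < n, (⟨y, h⟩ : Fin n) ∈ X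

open Classical in
/-- The elements of `X` whose rank is congruent to `c` modulo `N`. -/
noncomputable def layer (X : Finset (Fin n)) (N c : ℕ) : Finset (Fin n) :=
  {y ∈ X | Nat.count (InSet X) y % N = c}

/-- The elements of rank aN + c for a < |X| / N all exist and all belong to the layer. -/
lemma div_le_card_layer (X : Finset (Fin n)) {N c : ℕ} (hc : c < N) :
    #X / N ≤ #(layer X N c) := by
  classical
  have hset : Set.ofPred (InSet X) = ↑(X.image Fin.val) := by
    ext y
    simp only [coe_image]
    constructor
    · rintro ⟨h, hy⟩
      exact ⟨_, hy, rfl⟩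
    · rintro ⟨z, hz, rfl⟩
      exact ⟨z.isLt, hz⟩
  have hfin : (Set.ofPred (InSet X)).Finite := hset ▸ finite_toSet _
  have hcard : #hfin.toFinset = #X := by
    have : hfin.toFinset = X.image Fin.val := by
      apply Finset.coe_injective
      rw [Set.Finite.coe_toFinset, hset]
    rw [this, card_image_of_injective _ Fin.val_injective]
  have hlt : ∀ a < #X / N, a * N + c < #hfin.toFinset := by
    intro a ha
    rw [hcard]
    have : (a + 1) * N ≤ #X := (Nat.mul_le_mul_right _ ha).trans (Nat.div_mul_le_self _ _)
    rw [Nat.succ_mul] at this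
    omega
  have hsub : (range (#X / N)).image (fun a => Nat.nth (InSet X) (a * N + c)) ⊆
      (layer X N c).image Fin.val := by
    intro y hy
    obtain ⟨a, ha, rfl⟩ := mem_image.1 hy
    rw [mem_range] at ha
    obtain ⟨h1, h2⟩ : InSet X (Nat.nth (InSet X) (a * N + c)) :=
      Nat.nth_mem _ fun _ => hlt a ha
    refine mem_image.2 ⟨_, mem_filter.2 ⟨h2, ?_⟩, rfl⟩
    rw [Nat.count_nth fun _ => hlt a ha]
    simp [Nat.add_mod, Nat.mod_eq_of_lt hc]
  have h := card_le_card hsub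
  rw [card_image_of_injective _ Fin.val_injective, card_image_of_injOn, card_range] at h
  · exact h
  · intro a ha b hb hab
    simp only [coe_range, Set.mem_Iio] at ha hb
    have := Nat.nth_injOn hfin (Set.mem_Iio.2 (hlt a ha)) (Set.mem_Iio.2 (hlt b hb)) hab
    have : a * N = b * N := by omega
    exact Nat.eq_of_mul_eq_mul_right (by omega) this

/-- The elements of `X` that are in none of the tuples. -/
def freeVertices {k ρ : ℕ} (X : Finset (Fin n)) (u v : Fin k → Fin ρ → Fin n) : Finset (Fin n) :=
  {y ∈ X | (∀ i j, u i j ≠ y) ∧ ∀ i j, v i j ≠ y}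

lemma card_le_card_freeVertices_add {k ρ : ℕ} (X : Finset (Fin n)) (u v : Fin k → Fin ρ → Fin n) :
    #X ≤ #(freeVertices X u v) + 2 * (k * ρ) := by
  have hsub : X ⊆ freeVertices X u v ∪
      (univ.image (fun a : Fin k × Fin ρ => u a.1 a.2) ∪
        univ.image (fun a : Fin k × Fin ρ => v a.1 a.2)) := by
    intro y hy
    simp only [mem_union, mem_image, mem_univ, true_and, Prod.exists, freeVertices, mem_filter]
    by_cases h1 : ∃ i j, u i j = y
    · exact Or.inr (Or.inl h1)
    by_cases h2 : ∃ i j, v i j = y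
    · exact Or.inr (Or.inr h2)
    push Not at h1 h2
    exact Or.inl ⟨hy, h1, h2⟩
  have h1 : ∀ w : Fin k → Fin ρ → Fin n,
      #(univ.image (fun a : Fin k × Fin ρ => w a.1 a.2)) ≤ k * ρ := fun w =>
    card_image_le.trans (by simp)
  have h2 := (card_le_card hsub).trans ((card_union_le _ _).trans
    (Nat.add_le_add_left (card_union_le _ _) _))
  have := h1 u
  have := h1 v
  omega

/-- The `T` tiers of `m` layers each. -/
noncomputable def tier {k ρ : ℕ} (m T : ℕ) (X : Finset (Fin n)) (u v : Fin k → Fin ρ → Fin n)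
    (t : ℕ) (j : Fin m) : Finset (Fin n) :=
  layer (freeVertices X u v) (T * m) (t * m + j)

lemma mul_add_lt {T m t j : ℕ} (ht : t < T) (hj : j < m) : t * m + j < T * m :=
  calc t * m + j < t * m + m := by omega
    _ = (t + 1) * m := by ring
    _ ≤ T * m := Nat.mul_le_mul_right _ ht

lemma mem_tier_unique {k ρ m T : ℕ} {X : Finset (Fin n)} {u v : Fin k → Fin ρ → Fin n}
    {t t' : ℕ} {j j' : Fin m} {y : Fin n} (h : y ∈ tier m T X u v t j)
    (h' : y ∈ tier m T X u v t' j') : t = t' ∧ j = j' := by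
  have h1 := (mem_filter.1 h).2
  have h2 := (mem_filter.1 h').2
  rw [h1] at h2
  have e1 := congrArg (· / m) h2
  have e2 := congrArg (· % m) h2
  simp only [Nat.mod_eq_of_lt j.isLt, Nat.mod_eq_of_lt j'.isLt,
    mul_comm _ m, Nat.mul_add_div j.pos, Nat.div_eq_of_lt j.isLt,
    Nat.div_eq_of_lt j'.isLt, Nat.mul_add_mod] at e1 e2
  exact ⟨by omega, Fin.ext e2⟩

lemma mem_freeVertices_of_mem_tier {k ρ m T : ℕ} {X : Finset (Fin n)}
    {u v : Fin k → Fin ρ → Fin n} {t : ℕ} {j : Fin m} {y : Fin n} (h : y ∈ tier m T X u v t j) :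
    y ∈ freeVertices X u v := (mem_filter.1 h).1

/-- The terms of the path with given interior vertices. -/
def pathTerm {k ρ m : ℕ} (hρ : 0 < ρ) (u v : Fin k → Fin ρ → Fin n) (i : Fin k) (x : Fin m → Fin n)
    (e : ℕ) : Fin n := (pathList (u i) x (v i)).getD e (u i ⟨0, hρ⟩)

end Layers

/-! ### Translating runs of the program into greedy choices. -/

namespace RAM

variable {ρ m T : ℕ}

lemma isAvailable_encode (I : ConnInput (ρ + 1)) {y : ℕ} (hy : y < I.n) :
    IsAvailable I.encode (I.n + 2) (I.n + 2 + ρ * I.k + ρ * I.k) y ↔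
      InSet (freeVertices I.X I.u I.v) y := by
  have h1 := I.getD_encode_vertex ⟨y, hy⟩
  simp only at h1
  have hlt : ∀ (i : Fin I.k) (j : Fin ρ), (i : ℕ) * ρ + j < ρ * I.k := fun i j => by
    rw [mul_comm ρ]; exact mul_add_lt i.isLt j.isLt
  rw [IsAvailable, h1]
  simp only [InSet, hy, exists_true_left, freeVertices, mem_filter]
  rw [and_comm]
  refine and_congr (by simp) ⟨fun h => ⟨fun i j he => h ?_, fun i j he => h ?_⟩, ?_⟩
  · have := hlt i j
    exact ⟨I.n + 2 + i * ρ + j, by omega, by omega,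
      (I.getD_encode_left i j).trans (congrArg Fin.val he)⟩
  · have := hlt i j
    exact ⟨I.n + 2 + ρ * I.k + i * ρ + j, by omega, by omega,
      (I.getD_encode_right i j).trans (congrArg Fin.val he)⟩
  · rintro ⟨h2, h3⟩ ⟨a, ha, ha', he⟩
    obtain ⟨i, j, h | h⟩ := I.exists_left_or_right ha ha'
    · exact h2 i j (Fin.ext (h.symm.trans he))
    · exact h3 i j (Fin.ext (h.symm.trans he))

/-- The classes computed by the machine are those of the layers, shifted by 1 so that 0 can stand
for an unavailable vertex. -/
lemma class_eq_iff (I : ConnInput (ρ + 1)) {mem : ℕ → ℕ}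
    (h : IsClassAssignment I.encode (T * m) (I.n + 2) (I.n + 2 + ρ * I.k + ρ * I.k) I.n mem)
    (y : Fin I.n) (t : ℕ) (j : Fin m) :
    mem y = t * m + j + 1 ↔ y ∈ tier m T I.X I.u I.v t j := by
  classical
  have h1 := h y y.isLt
  have hcount : Nat.count (IsAvailable I.encode (I.n + 2) (I.n + 2 + ρ * I.k + ρ * I.k)) y =
      Nat.count (InSet (freeVertices I.X I.u I.v)) y := by
    rw [Nat.count_eq_card_filter_range, Nat.count_eq_card_filter_range]
    congr 1
    refine filter_congr fun z hz => isAvailable_encode I ?_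
    have := mem_range.1 hz
    omega
  rw [h1, hcount]
  simp only [isAvailable_encode I y.isLt]
  have hin : InSet (freeVertices I.X I.u I.v) y ↔ y ∈ freeVertices I.X I.u I.v :=
    ⟨fun ⟨_, h⟩ => h, fun h => ⟨y.isLt, h⟩⟩
  simp only [tier, layer, mem_filter, hin]
  split_ifs with hy
  · simp [hy]
  · simp [hy]

lemma isChoice_windows_iff (hρ : 0 < ρ) (I : ConnInput (ρ + 1)) (i : Fin I.k)
    (x : Fin m → Fin I.n) :
    (∀ e < m + ρ, I.encode.getD (∑ j ∈ range (ρ + 1),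
      (pathTerm hρ I.u I.v i x (e + j) : ℕ) * I.n ^ j + (I.n + 2 + ρ * I.k + ρ * I.k)) 0 ≠ 0) ↔
    windows (ρ + 1) (m + ρ) (pathTerm hρ I.u I.v i x) ⊆ I.G.1 := by
  simp only [windows, image_subset_iff, mem_range]
  refine forall₂_congr fun e _ => ?_
  have h := I.getD_encode_edge fun j => pathTerm hρ I.u I.v i x (e + j)
  rw [Fin.sum_univ_eq_sum_range
    (fun j => (pathTerm hρ I.u I.v i x (e + j) : ℕ) * I.n ^ j) (ρ + 1)] at h
  have hw : univ.image (fun j : Fin (ρ + 1) => pathTerm hρ I.u I.v i x (e + j)) =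
      window (ρ + 1) (pathTerm hρ I.u I.v i x) e := by
    ext y
    simp only [window, mem_image, mem_univ, true_and, mem_range]
    exact ⟨fun ⟨j, hj⟩ => ⟨j, j.isLt, hj⟩, fun ⟨j, hj, h⟩ => ⟨⟨j, hj⟩, h⟩⟩
  rw [hw] at h
  simp only [Nat.add_sub_cancel] at h
  rw [h]
  simp

end RAM

/-- The list of vertices of the path that has been chosen, if any. -/
def chosenPath {V : Type*} {ρ m : ℕ} (u v : Fin ρ → V) : Option (ℕ × (Fin m → V)) → List V
  | some (_, x) => pathList u x v
  | none => []

namespace RAM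

variable {ρ m T : ℕ}

/-- A choice, or the absence of one, that explains the change of memory and output in one round. -/
def IsExplained (hρ : 0 < ρ) (T : ℕ) (I : ConnInput (ρ + 1)) (i : Fin I.k)
    (a a' : (ℕ → ℕ) × List ℕ) (o : Option (ℕ × (Fin m → Fin I.n))) : Prop :=
  (∀ t x, o = some (t, x) → t < T ∧ IsChoice I.encode ρ m I.n (I.n + 2 + ρ * I.k + ρ * I.k) a.1 t
      (fun e => pathTerm hρ I.u I.v i x e)) ∧
  (∀ t' < T, (∀ t x, o = some (t, x) → t' < t) → ∀ x : Fin m → Fin I.n,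
    ¬ IsChoice I.encode ρ m I.n (I.n + 2 + ρ * I.k + ρ * I.k) a.1 t'
      (fun e => pathTerm hρ I.u I.v i x e)) ∧
  (∀ y : Fin I.n, (∃ t x, o = some (t, x) ∧ ∃ j, x j = y) → a'.1 y = 0) ∧
  (∀ y : Fin I.n, (¬ ∃ t x, o = some (t, x) ∧ ∃ j, x j = y) → a'.1 y = a.1 y) ∧
  a'.2 = a.2 ++ ((chosenPath (I.u i) (I.v i) o).length ::
    (chosenPath (I.u i) (I.v i) o).map Fin.val)

/-- Relates the machine's sequences of numbers, of which only the first m + 2ρ terms matter, to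
paths with vertices in `Fin I.n`. -/
lemma hasEnds_iff (hρ : 0 < ρ) (I : ConnInput (ρ + 1)) (i : Fin I.k) (x : Fin m → Fin I.n)
    {q : ℕ → ℕ} (hx : ∀ j : Fin m, q (ρ + j) = x j) :
    HasEnds I.encode ρ m (I.n + 2 + i * ρ) (I.n + 2 + ρ * I.k + i * ρ) q ↔
      ∀ e < m + 2 * ρ, q e = pathTerm hρ I.u I.v i x e := by
  have h1 := fun j : Fin ρ => I.getD_encode_left i j
  have h2 := fun j : Fin ρ => I.getD_encode_right i j
  simp only [Nat.add_sub_cancel] at h1 h2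
  constructor
  · intro h e he
    rcases pathList_cases (I.u i) x (I.v i) (I.u i ⟨0, hρ⟩) he with
      ⟨e', rfl, h'⟩ | ⟨j, rfl, h'⟩ | ⟨e', rfl, h'⟩
    · rw [pathTerm, h', (h e' e'.isLt).1, h1 e']
    · rw [pathTerm, h']
      exact hx j
    · rw [pathTerm, h']
      exact (h e' e'.isLt).2.trans (h2 e')
  · intro h j hj
    refine ⟨?_, ?_⟩
    · rw [h j (by omega), h1 ⟨j, hj⟩, pathTerm]
      exact congrArg Fin.val (getD_pathList_left _ _ _ _ ⟨j, hj⟩)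
    · rw [h _ (by omega), h2 ⟨j, hj⟩, pathTerm]
      exact congrArg Fin.val (getD_pathList_right _ _ _ _ ⟨j, hj⟩)

lemma not_isChoice_of_noChoice (hρ : 0 < ρ) (I : ConnInput (ρ + 1)) (i : Fin I.k) {base t : ℕ}
    {mem : ℕ → ℕ} (h : NoChoice I.encode ρ m I.n base (I.n + 2 + i * ρ)
      (I.n + 2 + ρ * I.k + i * ρ) mem t) (x : Fin m → Fin I.n) :
    ¬ IsChoice I.encode ρ m I.n base mem t (fun e => pathTerm hρ I.u I.v i x e) := by
  have hx : ∀ j : Fin m, pathTerm hρ I.u I.v i x (ρ + j) = x j := fun j =>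
    getD_pathList_mid _ _ _ _ j
  refine h _ ((hasEnds_iff hρ I i x fun j => by rw [hx]).2 fun e _ => rfl) fun j hj => ?_
  exact (pathTerm hρ I.u I.v i x (ρ + j)).isLt

lemma exists_isExplained (hρ : 0 < ρ) (I : ConnInput (ρ + 1)) (i : Fin I.k)
    {a a' : (ℕ → ℕ) × List ℕ}
    (h : RoundResult I.encode ρ m T I.n (I.n + 2 + ρ * I.k + ρ * I.k) (I.n + 2 + i * ρ)
      (I.n + 2 + ρ * I.k + i * ρ) a a') :
    ∃ o : Option (ℕ × (Fin m → Fin I.n)), IsExplained hρ T I i a a' o := by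
  rcases h with ⟨t, ht, q, hq, hb, hc, hno, hz, hs, ho⟩ | ⟨hno, hs, ho⟩
  · set x : Fin m → Fin I.n := fun j => ⟨q (ρ + j), hb j j.isLt⟩ with hx
    have hqx := (hasEnds_iff hρ I i x (q := q) fun j => rfl).1 hq
    refine ⟨some (t, x), ?_, ?_, ?_, ?_, ?_⟩
    · rintro t' x' h
      simp only [Option.some.injEq, Prod.mk.injEq] at h
      obtain ⟨rfl, rfl⟩ := h
      exact ⟨ht, hc.congr hqx⟩
    · intro t' _ ht'
      exact not_isChoice_of_noChoice hρ I i (hno t' (ht' t x rfl))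
    · rintro y ⟨t', x', h, j, rfl⟩
      simp only [Option.some.injEq, Prod.mk.injEq] at h
      obtain ⟨rfl, rfl⟩ := h
      exact hz j j.isLt
    · intro y hy
      refine hs y fun j hj h => hy ⟨t, x, rfl, ⟨j, hj⟩, Fin.ext h⟩
    · rw [ho]
      simp only [chosenPath, length_pathList]
      congr 2
      refine List.ext_getElem (by simp [length_pathList]) fun e h1 h2 => ?_
      simp only [List.length_map, List.length_range] at h1
      simp only [List.getElem_map, List.getElem_range]
      rw [hqx e h1, pathTerm, List.getD_eq_getElem _ _ (by rw [length_pathList]; exact h1)]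
  · refine ⟨none, by simp, ?_, by simp, ?_, ?_⟩
    · intro t' ht' _
      exact not_isChoice_of_noChoice hρ I i (hno t' ht')
    · intro y _
      rw [hs]
    · rw [ho]; simp [chosenPath]

theorem exists_isGreedy (hρ : 0 < ρ) (I : ConnInput (ρ + 1))
    {run : ℕ → (ℕ → ℕ) × List ℕ} (hrun : IsRun I.encode ρ m T I.n I.k run) :
    ∃ res : Fin I.k → Option (ℕ × (Fin m → Fin I.n)),
      IsGreedy ρ T (tier m T I.X I.u I.v) (pathTerm hρ I.u I.v) I.G.1 res ∧
      (run I.k).2 = encodePaths (List.ofFn fun i => chosenPath (I.u i) (I.v i) (res i)) := by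
  obtain ⟨hcls, hout, hstep⟩ := hrun
  choose res hres using fun i : Fin I.k => exists_isExplained (m := m) (T := T) hρ I i (hstep i i.isLt)
  -- The memory before round i is determined by the initial classes and the used vertices, whose
  -- cells are 0. As genuine classes are at least 1, the memory test in a round means: in the right
  -- layer and unused.
  let UsedBefore : ℕ → Fin I.n → Prop := fun i y =>
    ∃ i' : Fin I.k, i'.val < i ∧ ∃ t x, res i' = some (t, x) ∧ ∃ j, x j = y
  have hmem : ∀ i ≤ I.k, ∀ y : Fin I.n, (UsedBefore i y → (run i).1 y = 0) ∧
      (¬ UsedBefore i y → (run i).1 y = (run 0).1 y) := by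
    intro i
    induction i with
    | zero => exact fun _ y => ⟨fun ⟨i', h, _⟩ => absurd h (by omega), fun _ => rfl⟩
    | succ i ih =>
      intro hi y
      obtain ⟨-, -, h3, h4, -⟩ := hres ⟨i, hi⟩
      obtain ⟨ih1, ih2⟩ := ih (by omega) y
      refine ⟨fun h => ?_, fun h => ?_⟩
      · by_cases hy : ∃ t x, res ⟨i, hi⟩ = some (t, x) ∧ ∃ j, x j = y
        · exact h3 y hy
        · obtain ⟨i', hi', hh⟩ := h
          refine (h4 y hy).trans (ih1 ⟨i', ?_, hh⟩)
          refine lt_of_le_of_ne (by omega) fun he => hy ?_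
          obtain rfl : i' = ⟨i, hi⟩ := Fin.ext he
          exact hh
      · refine (h4 y fun hy => h ⟨⟨i, hi⟩, Nat.lt_succ_self i, hy⟩).trans (ih2 fun hh => h ?_)
        obtain ⟨i', hi', hh⟩ := hh
        exact ⟨i', by omega, hh⟩
  have hiff : ∀ (i : Fin I.k) (t : ℕ) (x : Fin m → Fin I.n),
      IsChoice I.encode ρ m I.n (I.n + 2 + ρ * I.k + ρ * I.k) (run i).1 t
        (fun e => pathTerm hρ I.u I.v i x e) ↔
      IsFreeChoice ρ (tier m T I.X I.u I.v) (pathTerm hρ I.u I.v) I.G.1 res i t x := by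
    intro i t x
    refine and_congr ⟨fun h j => ?_, fun h j hj => ?_⟩ (isChoice_windows_iff hρ I i x)
    · have h1 := h j j.isLt
      have hx : pathTerm hρ I.u I.v i x (ρ + j) = x j := getD_pathList_mid _ _ _ _ j
      dsimp only at h1
      rw [hx] at h1
      obtain ⟨h2, h3⟩ := hmem i i.isLt.le (x j)
      have hnot : ¬ UsedBefore i (x j) := fun h => by rw [h2 h] at h1; omega
      rw [h3 hnot] at h1
      exact ⟨(class_eq_iff I hcls _ _ _).1 h1, hnot⟩
    · obtain ⟨h1, h2⟩ := h ⟨j, hj⟩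
      have hx : pathTerm hρ I.u I.v i x (ρ + j) = x ⟨j, hj⟩ :=
        getD_pathList_mid _ _ _ _ ⟨j, hj⟩
      dsimp only
      rw [hx, (hmem i i.isLt.le _).2 h2]
      exact (class_eq_iff I hcls _ _ _).2 h1
  refine ⟨res, fun i => ⟨fun t x h => ?_, fun t' ht' h x => ?_⟩, ?_⟩
  · obtain ⟨h1, h2⟩ := (hres i).1 t x h
    exact ⟨h1, (hiff i t x).1 h2⟩
  · rw [← hiff]
    exact (hres i).2.1 t' ht' h x
  · have hind : ∀ i ≤ I.k, (run i).2 = encodePaths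
        ((List.ofFn fun i => chosenPath (I.u i) (I.v i) (res i)).take i) := by
      intro i
      induction i with
      | zero => simp [hout, encodePaths]
      | succ i ih =>
        intro hi
        rw [(hres ⟨i, hi⟩).2.2.2.2, ih (by omega)]
        rw [List.take_succ_eq_append_getElem (by simpa using hi)]
        simp [encodePaths]
    rw [hind I.k le_rfl, List.take_of_length_le (by simp)]

/-- The program computes a greedy connection in polynomial time. -/
theorem exists_polyTimeComputable_isGreedy (hρ : 0 < ρ) (hm : 0 < m) (hT : 0 < T) :
    ∃ A : (I : ConnInput (ρ + 1)) → List (List (Fin I.n)),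
      PolyTimeComputable ConnInput.encode (fun I => encodePaths (A I)) ∧
      ∀ I, ∃ res : Fin I.k → Option (ℕ × (Fin m → Fin I.n)),
        IsGreedy ρ T (tier m T I.X I.u I.v) (pathTerm hρ I.u I.v) I.G.1 res ∧
        A I = List.ofFn fun i => chosenPath (I.u i) (I.v i) (res i) := by
  have hrun := fun I : ConnInput (ρ + 1) =>
    runs_connect (inp := I.encode) ρ m T (Nat.mul_pos hT hm)
  obtain ⟨q, hq⟩ := exists_polynomial_connectTime ρ m T
  simp only [ConnInput.getD_encode_zero, ConnInput.getD_encode_one] at hrun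
  choose t s hexec ht run hisrun hout using hrun
  choose res hres hres' using fun I => exists_isGreedy hρ I (hisrun I)
  refine ⟨fun I => List.ofFn fun i => chosenPath (I.u i) (I.v i) (res I i),
    ⟨connect ρ m T, q, fun I => ⟨t I, s I, hexec I, ?_, ?_⟩⟩, fun I => ⟨res I, hres I, rfl⟩⟩
  · obtain ⟨h1, h2⟩ := I.le_length_encode
    exact (ht I).trans (hq _ _ _ h1 (h2 (by omega)))
  · rw [hout I, hres' I]

end RAM

/-! ### Comparison with the random uniform hypergraph. -/

section RandomHypergraph

/-- Giving probability 0 to sets that do not have r elements turns the random hypergraph into a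
product measure on all families of sets. Families that are not uniform have weight 0, and for
uniform ones the additional factors are 1. -/
lemma one_sub_le_randomHypergraphProb {r n : ℕ} {p : ℝ} (hp0 : 0 ≤ p) (hp1 : p ≤ 1)
    {Q : UHypergraph r n → Prop} {R : Finset (Finset (Fin n)) → Prop} (hRQ : ∀ G, R G.1 → Q G) :
    1 - bernoulliProb (fun e : Finset (Fin n) => if #e = r then p else 0) (fun E => ¬ R E) ≤
      randomHypergraphProb r n p Q := by
  classical
  set P : Finset (Fin n) → ℝ := fun e => if #e = r then p else 0 with hP
  have h0 : ∀ e, 0 ≤ P e := fun e => by simp only [hP]; split_ifs <;> linarith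
  have h1 : ∀ e, P e ≤ 1 := fun e => by simp only [hP]; split_ifs <;> linarith
  rw [bernoulliProb_not, sub_sub_cancel]
  have hwt : ∀ G : UHypergraph r n, bernoulliWeight P G.1 =
      ∏ e ∈ powersetCard r (univ : Finset (Fin n)), if e ∈ G.1 then p else 1 - p := by
    intro G
    rw [bernoulliWeight, ← prod_subset (subset_univ (powersetCard r (univ : Finset (Fin n))))]
    · refine prod_congr rfl fun e he => ?_
      simp [hP, (mem_powersetCard.1 he).2]
    · intro e _ he
      have hcard : #e ≠ r := fun h => he (mem_powersetCard.2 ⟨subset_univ _, h⟩)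
      rw [if_neg fun h => hcard (G.2 e h)]
      simp [hP, hcard]
  have hzero : ∀ E : Finset (Finset (Fin n)), (¬ ∀ e ∈ E, #e = r) → bernoulliWeight P E = 0 := by
    intro E hE
    push Not at hE
    obtain ⟨e, he, hne⟩ := hE
    exact prod_eq_zero (mem_univ e) (by simp [he, hP, hne])
  have hsum : bernoulliProb P R = ∑ G : UHypergraph r n with R G.1, bernoulliWeight P G.1 := by
    rw [bernoulliProb, ← sum_subset (filter_subset (fun E => ∀ e ∈ E, #e = r) _)
      (fun E hE hE' => hzero E fun h => hE' (mem_filter.2 ⟨hE, h⟩))]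
    refine (sum_bij (fun G _ => G.1) ?_ ?_ ?_ ?_).symm
    · intro G hG
      rw [mem_filter, mem_filter]
      exact ⟨⟨mem_univ _, (mem_filter.1 hG).2⟩, G.2⟩
    · intro G _ G' _ h
      exact Subtype.ext h
    · intro E hE
      rw [mem_filter, mem_filter] at hE
      exact ⟨⟨E, hE.2⟩, mem_filter.2 ⟨mem_univ _, hE.1.2⟩, rfl⟩
    · intro G _
      rfl
  rw [hsum, randomHypergraphProb]
  simp only [← hwt]
  refine sum_le_sum_of_subset_of_nonneg (fun G hG => ?_)
    fun G _ _ => bernoulliWeight_nonneg h0 h1 _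
  exact mem_filter.2 ⟨mem_univ _, hRQ G (mem_filter.1 hG).2⟩

lemma randomHypergraphProb_nonneg {r n : ℕ} {p : ℝ} (hp0 : 0 ≤ p) (hp1 : p ≤ 1)
    (Q : UHypergraph r n → Prop) : 0 ≤ randomHypergraphProb r n p Q := by
  classical
  refine sum_nonneg fun G _ => prod_nonneg fun e _ => ?_
  split_ifs <;> linarith

end RandomHypergraph

/-! ### Greedy choices form disjoint tight paths, and the layers are large. -/

section Paths

variable {n k ρ m T : ℕ} {X : Finset (Fin n)} {u v : Fin k → Fin ρ → Fin n}

/-- All entries of the tuples are different. -/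
def TuplesDistinct (u v : Fin k → Fin ρ → Fin n) : Prop :=
  Function.Injective (Sum.elim
    (fun x : Fin k × Fin ρ => u x.1 x.2) (fun x : Fin k × Fin ρ => v x.1 x.2))

lemma TuplesDistinct.left_inj (h : TuplesDistinct u v) {i i' : Fin k} {e e' : Fin ρ}
    (he : u i e = u i' e') : i = i' ∧ e = e' := by
  have := @h (Sum.inl (i, e)) (Sum.inl (i', e')) he
  simpa using this

lemma TuplesDistinct.right_inj (h : TuplesDistinct u v) {i i' : Fin k} {e e' : Fin ρ}
    (he : v i e = v i' e') : i = i' ∧ e = e' := by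
  have := @h (Sum.inr (i, e)) (Sum.inr (i', e')) he
  simpa using this

lemma TuplesDistinct.left_ne_right (h : TuplesDistinct u v) (i i' : Fin k) (e e' : Fin ρ) :
    u i e ≠ v i' e' := fun he => by
  have := @h (Sum.inl (i, e)) (Sum.inr (i', e')) he
  simp at this

/-- A vertex determines its position because all tuple entries are distinct, interior vertices avoid
the tuples, and different positions use different layers. An end vertex also determines the path.
This provides both the colouring and the absence of common ends that the overlap estimates require.
-/
lemma pathTerm_eq_imp (hρ : 0 < ρ) (huv : TuplesDistinct u v) {t : ℕ} {i i' : Fin k}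
    {x x' : Fin m → Fin n} (hx : ∀ j, x j ∈ tier m T X u v t j)
    (hx' : ∀ j, x' j ∈ tier m T X u v t j) {q q' : ℕ} (hq : q < m + 2 * ρ) (hq' : q' < m + 2 * ρ)
    (h : pathTerm hρ u v i x q = pathTerm hρ u v i' x' q') :
    q = q' ∧ (i = i' ∨ (ρ ≤ q ∧ q < ρ + m)) := by
  have hf : ∀ j, x j ∈ freeVertices X u v := fun j => mem_freeVertices_of_mem_tier (hx j)
  have hf' : ∀ j, x' j ∈ freeVertices X u v := fun j => mem_freeVertices_of_mem_tier (hx' j)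
  simp only [freeVertices, mem_filter] at hf hf'
  simp only [pathTerm] at h
  rcases pathList_cases (u i) x (v i) (u i ⟨0, hρ⟩) hq with ⟨e, rfl, g⟩ | ⟨j, rfl, g⟩ | ⟨e, rfl, g⟩ <;>
  rcases pathList_cases (u i') x' (v i') (u i' ⟨0, hρ⟩) hq' with
    ⟨e', rfl, g'⟩ | ⟨j', rfl, g'⟩ | ⟨e', rfl, g'⟩ <;>
  rw [g, g'] at h
  · obtain ⟨rfl, rfl⟩ := huv.left_inj h
    exact ⟨rfl, Or.inl rfl⟩
  · exact absurd h ((hf' j').2.1 _ _)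
  · exact absurd h (huv.left_ne_right _ _ _ _)
  · exact absurd h.symm ((hf j).2.1 _ _)
  · have := hx j
    rw [h] at this
    obtain rfl := (mem_tier_unique this (hx' j')).2
    exact ⟨rfl, Or.inr ⟨by omega, by omega⟩⟩
  · exact absurd h.symm ((hf j).2.2 _ _)
  · exact absurd h.symm (huv.left_ne_right _ _ _ _)
  · exact absurd h ((hf' j').2.2 _ _)
  · obtain ⟨rfl, rfl⟩ := huv.right_inj h
    exact ⟨rfl, Or.inl rfl⟩

lemma exists_isColored (hρ : 0 < ρ) (huv : TuplesDistinct u v) (t : ℕ) :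
    ∃ col : Fin n → ℕ, ∀ i, ∀ x ∈ Fintype.piFinset (tier m T X u v t),
      IsColored ρ m col (pathTerm hρ u v i x) := by
  classical
  let P : Fin n → ℕ → Prop := fun y q => q < m + 2 * ρ ∧
    ∃ i, ∃ x ∈ Fintype.piFinset (tier m T X u v t), pathTerm hρ u v i x q = y
  refine ⟨fun y => if h : ∃ q, P y q then h.choose else 0, fun i x hx q hq => ?_⟩
  have h : ∃ q', P (pathTerm hρ u v i x q) q' := ⟨q, hq, i, x, hx, rfl⟩
  simp only [dif_pos h]
  obtain ⟨h1, i', x', hx', h2⟩ := h.choose_spec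
  exact (pathTerm_eq_imp hρ huv (Fintype.mem_piFinset.1 hx') (Fintype.mem_piFinset.1 hx) h1 hq
    h2).1

theorem IsGreedy.isConnection (hρ : 0 < ρ) {G : UHypergraph (ρ + 1) n}
    (huv : TuplesDistinct u v)
    {res : Fin k → Option (ℕ × (Fin m → Fin n))}
    (hres : IsGreedy ρ T (tier m T X u v) (pathTerm hρ u v) G.1 res)
    (hsome : ∀ i, ∃ t x, res i = some (t, x)) {ℓ : ℝ} (hℓ : ((m + ρ : ℕ) : ℝ) ≤ ℓ) :
    (⟨n, G, X, k, u, v, huv⟩ : ConnInput (ρ + 1)).IsConnection ℓ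
      fun i => chosenPath (u i) (v i) (res i) := by
  have hfree : ∀ i t x, res i = some (t, x) → ∀ j, x j ∈ freeVertices X u v := fun i t x h j =>
    mem_freeVertices_of_mem_tier (((hres i).1 t x h).2.1 j).1
  simp only [freeVertices, mem_filter] at hfree
  refine ⟨fun i => ?_, fun i i' hii => ?_⟩
  · obtain ⟨t, x, hi⟩ := hsome i
    obtain ⟨-, hx, hw⟩ := (hres i).1 t x hi
    have hlen := length_pathList (u i) x (v i)
    simp only [hi, chosenPath]
    refine ⟨⟨?_, fun e he => ?_⟩, ?_, ?_, ?_, fun y hy hyu hyv => ?_⟩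
    · obtain ⟨col, hcol⟩ := exists_isColored (m := m) (T := T) (X := X) hρ huv t
      -- The default value must be the one used in `pathTerm`; it is never attained as a default,
      -- since only positions inside the list matter.
      exact nodup_of_isColored _ (u i ⟨0, hρ⟩) hlen
        (hcol i x (Fintype.mem_piFinset.2 fun j => (hx j).1))
    · rw [toFinset_take_drop _ (u i ⟨0, hρ⟩) he]
      rw [hlen] at he
      exact hw (mem_image.2 ⟨e, mem_range.2 (by omega), rfl⟩)
    · exact ⟨List.ofFn x ++ List.ofFn (v i), (List.append_assoc _ _ _).symm⟩
    · exact ⟨List.ofFn (u i) ++ List.ofFn x, rfl⟩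
    · refine le_trans ?_ hℓ
      rw [tightPathLength, hlen]
      exact_mod_cast (by omega : m + 2 * ρ + 1 - (ρ + 1) ≤ m + ρ)
    · rcases (mem_pathList _ _ _).1 hy with ⟨e, h⟩ | ⟨j, h⟩ | ⟨e, h⟩
      · exact absurd ⟨e, h⟩ hyu
      · rw [← h]
        exact (hfree i t x hi j).1
      · exact absurd ⟨e, h⟩ hyv
  · obtain ⟨t, x, hi⟩ := hsome i
    obtain ⟨t', x', hi'⟩ := hsome i'
    have hf := hfree i t x hi
    have hf' := hfree i' t' x' hi'
    have hused := ((hres i).1 t x hi).2.1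
    have hused' := ((hres i').1 t' x' hi').2.1
    simp only [hi, hi', chosenPath]
    intro y hy hy'
    rcases (mem_pathList _ _ _).1 hy with ⟨e, rfl⟩ | ⟨j, rfl⟩ | ⟨e, rfl⟩ <;>
    rcases (mem_pathList _ _ _).1 hy' with ⟨e', h⟩ | ⟨j', h⟩ | ⟨e', h⟩
    · exact hii (huv.left_inj h).1.symm
    · exact (hf' j').2.1 _ _ h.symm
    · exact huv.left_ne_right _ _ _ _ h.symm
    · exact (hf j).2.1 _ _ h
    · rcases lt_or_gt_of_ne hii with hlt | hlt
      · exact (hused' j').2 ⟨i, hlt, t, x, hi, j, h.symm⟩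
      · exact (hused j).2 ⟨i', hlt, t', x', hi', j', h⟩
    · exact (hf j).2.2 _ _ h
    · exact huv.left_ne_right _ _ _ _ h
    · exact (hf' j').2.2 _ _ h.symm
    · exact hii (huv.right_inj h).1.symm

/-- The tuples occupy at most 2ρηn ≤ δn/2 vertices of `X`. Rounding in the division by the number of
layers costs one vertex, absorbed by δn ≥ 4Tm. -/
lemma le_card_tier {δ η : ℝ} {t : ℕ} (ht : t < T) (j : Fin m)
    (hX : δ * n ≤ #X) (hk : k ≤ η * n) (hη : 4 * ρ * η ≤ δ) (hn : 4 * ((T * m : ℕ) : ℝ) ≤ δ * n) :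
    δ * n / (4 * ((T * m : ℕ) : ℝ)) ≤ #(tier m T X u v t j) := by
  set N := T * m with hN
  have hNpos : 0 < N := Nat.mul_pos (by omega) j.pos
  have hN' : (0 : ℝ) < N := by exact_mod_cast hNpos
  have h1 : #(freeVertices X u v) / N ≤ #(tier m T X u v t j) :=
    div_le_card_layer _ (mul_add_lt ht j.isLt)
  have h2 := card_le_card_freeVertices_add X u v
  have h3 : #(freeVertices X u v) < (#(tier m T X u v t j) + 1) * N := by
    have := Nat.lt_div_mul_add (a := #(freeVertices X u v)) hNpos
    nlinarith
  have h2' : (#X : ℝ) ≤ #(freeVertices X u v) + 2 * (k * ρ) := by exact_mod_cast h2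
  have h3' : (#(freeVertices X u v) : ℝ) ≤ (#(tier m T X u v t j) + 1) * N := by
    exact_mod_cast h3.le
  have h4 : (2 : ℝ) * (k * ρ) ≤ δ * n / 2 := by
    have e1 : (k : ℝ) * ρ ≤ η * n * ρ := mul_le_mul_of_nonneg_right hk (by positivity)
    have e2 : 4 * ρ * η * n ≤ δ * n := mul_le_mul_of_nonneg_right hη (by positivity)
    linarith
  rw [div_le_iff₀ (by positivity)]
  nlinarith

end Paths

/-! ### Choice of the constants and conclusion. -/

theorem lemma2 (r : ℕ) (hr : 3 ≤ r) (ε δ : ℝ) (hε : 0 < ε) (hεr : ε < 1 / (4 * (r : ℝ)))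
    (hδ : 0 < δ) :
    ∃ η : ℝ, 0 < η ∧
      ∃ A : (I : ConnInput r) → List (List (Fin I.n)),
        RAM.PolyTimeComputable ConnInput.encode (fun I => encodePaths (A I)) ∧
        ∃ err : ℕ → ℝ, Tendsto err atTop (𝓝 0) ∧
          ∀ n k : ℕ, 1 ≤ k → (k : ℝ) ≤ η * n →
            ∀ X : Finset (Fin n), δ * n ≤ #X →
              ∀ (u v : Fin k → Fin (r - 1) → Fin n)
                (huv : Function.Injective (Sum.elim
                  (fun x : Fin k × Fin (r - 1) => u x.1 x.2) (fun x : Fin k × Fin (r - 1) => v x.1 x.2))),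
                1 - err n ≤ randomHypergraphProb r n ((n : ℝ) ^ (-1 + ε)) (fun G =>
                  ∃ P : Fin k → List (Fin n),
                    A ⟨n, G, X, k, u, v, huv⟩ = List.ofFn P ∧
                    (⟨n, G, X, k, u, v, huv⟩ : ConnInput r).IsConnection
                      (((r : ℝ) - 1) / ε + 2) P) := by
  obtain ⟨ρ, rfl⟩ : ∃ ρ, r = ρ + 1 := ⟨r - 1, by omega⟩
  have hρ : 0 < ρ := by omega
  have hρ' : (0 : ℝ) < ρ := by exact_mod_cast hρ
  have hε1 : ε < 1 := by
    refine hεr.trans_le ?_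
    rw [div_le_one (by positivity)]
    push_cast
    linarith
  have hρε : (ρ : ℝ) ≤ ρ / ε := by
    rw [le_div_iff₀ hε]
    nlinarith
  -- The number of edges is the least integer strictly above ρ/ε: being above makes c positive,
  -- being at most ρ/ε + 1 gives c ≤ ε and the length bound.
  set L := ⌊(ρ : ℝ) / ε⌋₊ + 1 with hL
  have hL1 : (ρ : ℝ) / ε < L := by
    rw [hL]; push_cast
    exact Nat.lt_floor_add_one _
  have hL2 : (L : ℝ) ≤ ρ / ε + 1 := by
    rw [hL]; push_cast
    linarith [Nat.floor_le (by positivity : 0 ≤ (ρ : ℝ) / ε)]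
  have hρL : ρ < L := by exact_mod_cast hρε.trans_lt hL1
  obtain ⟨m, hm⟩ := Nat.exists_eq_add_of_le' hρL.le
  have hm0 : 0 < m := by omega
  have hm0' : (0 : ℝ) < m := by exact_mod_cast hm0
  have hmL : (m : ℝ) + ρ = L := by rw [hm]; push_cast; rfl
  set c := ε * (m + ρ) - ρ with hc
  have hc0 : 0 < c := by
    rw [hc, hmL]
    have := (div_lt_iff₀ hε).1 hL1
    linarith
  have hcε : c ≤ ε := by
    rw [hc, hmL]
    have h1 : ε * L ≤ ε * (ρ / ε + 1) := mul_le_mul_of_nonneg_left hL2 hε.le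
    have h2 : ε * (ρ / ε + 1) = ρ + ε := by field_simp
    linarith
  -- Each tier reduces the unserved indices by n^(c/2), so 2/c tiers gain a factor n.
  set T := ⌈2 / c⌉₊ with hT
  have hT0 : 0 < T := Nat.ceil_pos.2 (by positivity)
  have hTc : 2 / c ≤ T := Nat.le_ceil _
  have hN0 : (0 : ℝ) < ((T * m : ℕ) : ℝ) := by exact_mod_cast Nat.mul_pos hT0 hm0
  set N : ℝ := ((T * m : ℕ) : ℝ) with hN
  set h : ℝ := 1 / 2 / 2 ^ m with hh
  have hh0 : 0 < h := by positivity
  -- The bounds by `h` make the overlap terms in Janson's inequality small. Those involving `N` give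
  -- 2γ + mη ≤ δ/(4N), so the layers still have 2γn vertices after losing mk of them, and η ≤ δ/(4ρ)
  -- leaves enough of `X` outside the tuples.
  set γ := min (h / 2) (δ / (16 * N)) with hγ
  have hγ0 : 0 < γ := lt_min (by positivity) (by positivity)
  set η := min (min h (1 / 2)) (min (δ / (4 * ρ)) (δ / (8 * N * m))) with hη
  have hη0 : 0 < η :=
    lt_min (lt_min hh0 (by norm_num)) (lt_min (by positivity) (by positivity))
  have hγ1 : 2 * γ ≤ h := by linarith [min_le_left (h / 2) (δ / (16 * N))]
  have hγ2 : γ ≤ δ / (16 * N) := min_le_right _ _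
  have hη1 : η ≤ h := (min_le_left _ _).trans (min_le_left _ _)
  have hη2 : η ≤ 1 / 2 := (min_le_left _ _).trans (min_le_right _ _)
  have hη3 : η ≤ δ / (4 * ρ) := (min_le_right _ _).trans (min_le_left _ _)
  have hη4 : η ≤ δ / (8 * N * m) := (min_le_right _ _).trans (min_le_right _ _)
  obtain ⟨A, hA, hAres⟩ := RAM.exists_polyTimeComputable_isGreedy (T := T) hρ hm0 hT0
  obtain ⟨err, herr, hbound⟩ := exists_tendsto_bernoulliProb_not_isRobust_le T hρ hm0 hε hε1 hc
    hc0 hcε hγ0 hγ1 hη1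
  set n₀ := max ⌈1 / γ⌉₊ ⌈4 * N / δ⌉₊ with hn₀
  -- For small n the layers may be too small; error 1 makes the claim trivial there without
  -- affecting the limit.
  refine ⟨η, hη0, A, hA, fun n => if n < n₀ then 1 else err n, ?_, ?_⟩
  · refine herr.congr' ?_
    filter_upwards [eventually_ge_atTop n₀] with n hn
    rw [if_neg (by omega)]
  intro n k hk1 hk X hX u v huv
  have hn1 : 1 ≤ n := by
    by_contra! hn
    obtain rfl : n = 0 := by omega
    have : (1 : ℝ) ≤ k := by exact_mod_cast hk1
    simp at hk
    omega
  have hn1' : (1 : ℝ) ≤ n := by exact_mod_cast hn1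
  have hp0 : 0 ≤ (n : ℝ) ^ (-1 + ε) := by positivity
  have hp1 : (n : ℝ) ^ (-1 + ε) ≤ 1 := Real.rpow_le_one_of_one_le_of_nonpos hn1' (by linarith)
  dsimp only
  split_ifs with hn
  · rw [sub_self]
    exact randomHypergraphProb_nonneg hp0 hp1 _
  push Not at hn
  have hγn : 1 ≤ γ * n := by
    have := (Nat.ceil_le.1 ((le_max_left _ _).trans hn))
    rw [div_le_iff₀ hγ0] at this
    linarith
  have hNn : 4 * N ≤ δ * n := by
    have := (Nat.ceil_le.1 ((le_max_right _ _).trans hn))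
    rw [div_le_iff₀ hδ] at this
    linarith
  have hsize : ∀ t < T, ∀ j : Fin m, (2 * γ + m * η) * n ≤ #(tier m T X u v t j) := by
    intro t ht j
    refine le_trans ?_ (le_card_tier ht j hX hk ?_ hNn)
    · have e1 : 2 * γ ≤ δ / (8 * N) := by
        calc 2 * γ ≤ 2 * (δ / (16 * N)) := by linarith
          _ = δ / (8 * N) := by field_simp; norm_num
      have e2 : m * η ≤ δ / (8 * N) := by
        calc m * η ≤ m * (δ / (8 * N * m)) := mul_le_mul_of_nonneg_left hη4 hm0'.le
          _ = δ / (8 * N) := by field_simp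
      have e3 : δ * n / (4 * N) = (δ / (8 * N) + δ / (8 * N)) * n := by field_simp; norm_num
      rw [e3]
      exact mul_le_mul_of_nonneg_right (by linarith) (by positivity)
    · rw [le_div_iff₀ (by positivity)] at hη3
      push_cast [Nat.add_sub_cancel]
      linarith
  have hprob := hbound n k hγn hn1 hk (tier m T X u v) hsize (pathTerm hρ u v)
    (fun t _ => exists_isColored hρ huv t)
    (fun i x j => getD_pathList_mid _ _ _ _ j)
    (fun t _ i i' hii x hx x' hx' q hq hqq =>
      (pathTerm_eq_imp hρ huv (Fintype.mem_piFinset.1 hx) (Fintype.mem_piFinset.1 hx') hq hq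
        hqq).2.resolve_left hii)
  refine (sub_le_sub_left hprob 1).trans (one_sub_le_randomHypergraphProb hp0 hp1 ?_)
  intro G hG
  obtain ⟨res, hres, hAeq⟩ := hAres ⟨n, G, X, k, u, v, huv⟩
  refine ⟨_, hAeq, IsGreedy.isConnection hρ huv hres (fun i => ?_) ?_⟩
  · refine hres.exists_eq_some hG (fun t t' j j' y h1 h2 => (mem_tier_unique h1 h2).1) hm0
      (Real.rpow_pos_of_pos (by linarith) _) ?_ i
    rw [← Real.rpow_mul_natCast (by linarith)]
    have e1 : (1 : ℝ) ≤ c / 2 * T := by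
      have := (div_le_iff₀ hc0).1 hTc
      linarith
    have e2 : (n : ℝ) ≤ (n : ℝ) ^ (c / 2 * T) := by
      calc (n : ℝ) = (n : ℝ) ^ (1 : ℝ) := (Real.rpow_one _).symm
        _ ≤ _ := Real.rpow_le_rpow_of_exponent_le hn1' e1
    -- The strict inequality k < n needed here comes from η ≤ 1/2.
    nlinarith
  · push_cast
    rw [hmL, add_sub_cancel_right]
    linarith
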